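/- Let $\Bbbk$ be $\mathbb{R}$ or $\mathbb{C}$, let $K=\Bbbk((t))$ and $O=\Bbbk[[t]]$, and let $\nu$ be the discrete valuation of $K$. We embed $K^*$ into $GL_2(K)$ by $y\mapsto \mathrm{diag}(y,1)$, so that $GL_2(K)=SL_2(K)\rtimes K^*$. (a) Let $1\to K_2(K)\to St(K)\to SL(K)\to 1$ be the Steinberg extension, where $SL(K)=\varinjlim_n SL_n(K)$, and let $\widetilde{SL_2(K)}$ be its pullback along $SL_2(K)\to SL(K)$. The conjugation action of $K^*$ on $SL(K)$ lifts to $St(K)$, and $\widehat{GL_2(K)}=\widetilde{SL_2(K)}\rtimes K^*$ is an extension of $GL_2(K)$ by $K_2(K)$. Write $(f,g)\in K_2(K)$ for the Steinberg symbol of $f,g\in K^*$. (b) A lattice is an $O$-submodule $gO^2\subset K^2$ with $g\in GL_2(K)$. For lattices $N\subset L$ let $\mu(L/N)$ be the $\mathbb{R}_+^*$-torsor of Haar measures on the finite-dimensional $\Bbbk$-vector space $L/N$; for any lattices $L,M$ let $\mu(L\mid M)$ be the $\mathbb{R}_+^*$-torsor determined by $\mu(L\mid M)=\mu(M/L)$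 for $L\subset M$ and $\mu(L\mid M)\otimes\mu(M\mid P)=\mu(L\mid P)$. Let $\widetilde{GL_2(K)}_{\mathbb{R}_+^*}$ be the group of pairs $(g,m)$ with $g\in GL_2(K)$ and $m\in\mu(O^2\mid gO^2)$, with product $(g_1,m_1)(g_2,m_2)=(g_1g_2,\,m_1\otimes g_1(m_2))$, let $\theta(g,m)=g$, and let $\widehat{GL_2(K)}_{\mathbb{R}_+^*}=\theta^{-1}(SL_2(K))\rtimes K^*$, where $y\in K^*$ acts by conjugation with a lift of $\mathrm{diag}(y,1)$ to $\widetilde{GL_2(K)}_{\mathbb{R}_+^*}$. Then $\widehat{GL_2(K)}$ and $\widehat{GL_2(K)}_{\mathbb{R}_+^*}$ are central extensions of $GL_2(K)$ by $K_2(K)$ and by $\mathbb{R}_+^*$, respectively, and the second one is obtained from the first one by pushout along the homomorphism $K_2(K)\to\mathbb{R}_+^*$ with $$(f,g)\mapsto\left|\overline{\frac{f^{\nu(g)}}{g^{\nu(f)}}}\right|_{\mathbb{R}}\quad\text{if }\Bbbk=\mathbb{R},\qquad (f,g)\mapsto\left|\overline{\frac{f^{\nu(g)}}{g^{\nu(f)}}}\right|_{\mathbb{C}}^{2}\quad\text{if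 }\Bbbk=\mathbb{C},$$ where the bar is the residue map $O\to\Bbbk$ and $|\cdot|_{\mathbb{R}}$, $|\cdot|_{\mathbb{C}}$ are the usual absolute values. -/

import Mathlib

/-- `1 → A → E → G → 1` is a central extension of `G` by `A`. -/
structure IsCentralExtension {A E G : Type*} [Group A] [Group E] [Group G]
    (i : A →* E) (p : E →* G) : Prop where
  injective : Function.Injective i
  exact : i.range = p.ker
  surjective : Function.Surjective p
  central : i.range ≤ Subgroup.center E

/-- The extension `A' → E' → G` is obtained from the extension `A → E → G` by means of
`φ : A →* A'` (it is the pushout along `φ`): there is a homomorphism `E →* E'` which induces `φ`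
on the kernels and the identity on `G`. -/
def IsObtainedBy {A E A' E' G : Type*} [Group A] [Group E] [Group A'] [Group E'] [Group G]
    (i : A →* E) (p : E →* G) (φ : A →* A') (i' : A' →* E') (p' : E' →* G) : Prop :=
  ∃ F : E →* E', F.comp i = i'.comp φ ∧ p'.comp F = p

/-- If a group `D` acts on `N` by automorphisms that preserve the subgroup `H`, it acts on `H`. -/
def restrictAction {D N : Type*} [Group D] [Group N] (σ : D →* MulAut N) (H : Subgroup N)
    (hH : ∀ d : D, ∀ x ∈ H, σ d x ∈ H) : D →* MulAut H where
  toFun d :=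
    { toFun := fun x => ⟨σ d x, hH d x x.2⟩
      invFun := fun x => ⟨σ d⁻¹ x, hH d⁻¹ x x.2⟩
      left_inv := fun x => Subtype.ext (by simp)
      right_inv := fun x => Subtype.ext (by simp)
      map_mul' := fun x y => Subtype.ext (by simp) }
  map_one' := by ext x; simp
  map_mul' d e := by ext x; simp

/-- The embedding `y ↦ diag(y, 1)` of `K^*` into the upper-left corner of `GL_2(K)`. -/
def cornerGL (K : Type*) [Field K] : Kˣ →* Matrix.GeneralLinearGroup (Fin 2) K where
  toFun y := ⟨!![(y : K), 0; 0, 1], !![((y⁻¹ : Kˣ) : K), 0; 0, 1],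
    by simp [Matrix.one_fin_two], by simp [Matrix.one_fin_two]⟩
  map_one' := by ext i j; fin_cases i <;> fin_cases j <;> simp
  map_mul' y z := by ext i j; fin_cases i <;> fin_cases j <;> simp

section Semidirect

variable {N K : Type*} [Group N] [Field K] (q : N →* Matrix.GeneralLinearGroup (Fin 2) K)
  (σ : Kˣ →* MulAut N) (hσ : ∀ y x, q (σ y x) = cornerGL K y * q x * (cornerGL K y)⁻¹)

/-- The map `(x, y) ↦ q(x) diag(y, 1)` from the semidirect product `N ⋊ K^*` to `GL_2(K)`. -/
def semidirectToGL : N ⋊[σ] Kˣ →* Matrix.GeneralLinearGroup (Fin 2) K where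
  toFun x := q x.left * cornerGL K x.right
  map_one' := by simp
  map_mul' x y := by simp [hσ, mul_assoc]

end Semidirect

/-- `SL_2(K)`, as the subgroup of matrices of determinant `1` of `GL_2(K)`. -/
abbrev SLTwo (K : Type*) [Field K] : Subgroup (Matrix.GeneralLinearGroup (Fin 2) K) :=
  (Matrix.GeneralLinearGroup.det : Matrix.GeneralLinearGroup (Fin 2) K →* Kˣ).ker

section Steinberg

open scoped commutatorElement

variable (K : Type*) [Field K]

/-- The generators `x_ij(a)` of the Steinberg group, with indices `i ≠ j` in `ℕ`. -/
structure SteinbergGen where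
  row : ℕ
  col : ℕ
  ne : row ≠ col
  coef : K

variable {K} in
/-- The free generator `x_ij(a)`. -/
abbrev freeX (i j : ℕ) (h : i ≠ j) (a : K) : FreeGroup (SteinbergGen K) :=
  FreeGroup.of ⟨i, j, h, a⟩

/-- The Steinberg relations. -/
inductive SteinbergRel : FreeGroup (SteinbergGen K) → Prop
  | add (i j : ℕ) (h : i ≠ j) (a b : K) :
      SteinbergRel (freeX i j h a * freeX i j h b * (freeX i j h (a + b))⁻¹)
  | comm (i j l : ℕ) (hij : i ≠ j) (hjl : j ≠ l) (hil : i ≠ l) (a b : K) :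
      SteinbergRel (⁅freeX i j hij a, freeX j l hjl b⁆ * (freeX i l hil (a * b))⁻¹)
  | commute (i j k l : ℕ) (hij : i ≠ j) (hkl : k ≠ l) (hjk : j ≠ k) (hil : i ≠ l) (a b : K) :
      SteinbergRel ⁅freeX i j hij a, freeX k l hkl b⁆

/-- The (stable) Steinberg group `St(K)`. -/
abbrev SteinbergGroup : Type _ := PresentedGroup {r | SteinbergRel K r}

variable {K}

/-- The generator `x_ij(a)` of `St(K)`. -/
def stX (i j : ℕ) (h : i ≠ j) (a : K) : SteinbergGroup K := PresentedGroup.of ⟨i, j, h, a⟩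

/-- A map on generators that respects the Steinberg relations extends to `St(K)`. -/
def SteinbergGroup.lift {G : Type*} [Group G] (f : SteinbergGen K → G)
    (h1 : ∀ i j h a b, f ⟨i, j, h, a⟩ * f ⟨i, j, h, b⟩ = f ⟨i, j, h, a + b⟩)
    (h2 : ∀ i j l hij hjl hil a b, ⁅f ⟨i, j, hij, a⟩, f ⟨j, l, hjl, b⟩⁆ = f ⟨i, l, hil, a * b⟩)
    (h3 : ∀ i j k l hij hkl, j ≠ k → i ≠ l → ∀ a b, ⁅f ⟨i, j, hij, a⟩, f ⟨k, l, hkl, b⟩⁆ = 1) :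
    SteinbergGroup K →* G :=
  PresentedGroup.toGroup (f := f) (by
    rintro r (⟨i, j, h, a, b⟩ | ⟨i, j, l, hij, hjl, hil, a, b⟩ | ⟨i, j, k, l, hij, hkl, hjk, hil, a, b⟩)
    · simp [h1]
    · simp [h2 i j l hij hjl hil, map_commutatorElement]
    · simp [h3 i j k l hij hkl hjk hil, map_commutatorElement])

@[simp] theorem SteinbergGroup.lift_stX {G : Type*} [Group G] (f : SteinbergGen K → G) (h1 h2 h3)
    (i j : ℕ) (h : i ≠ j) (a : K) :
    SteinbergGroup.lift f h1 h2 h3 (stX i j h a) = f ⟨i, j, h, a⟩ :=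
  PresentedGroup.toGroup.of _

theorem SteinbergGroup.hom_ext {G : Type*} [Group G] {φ ψ : SteinbergGroup K →* G}
    (h : ∀ i j hij a, φ (stX i j hij a) = ψ (stX i j hij a)) : φ = ψ :=
  PresentedGroup.ext fun x => h x.row x.col x.ne x.coef

theorem stX_add (i j : ℕ) (h : i ≠ j) (a b : K) : stX i j h a * stX i j h b = stX i j h (a + b) :=
  mul_inv_eq_one.mp (PresentedGroup.one_of_mem (SteinbergRel.add i j h a b))

theorem stX_comm (i j l : ℕ) (hij : i ≠ j) (hjl : j ≠ l) (hil : i ≠ l) (a b : K) :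
    ⁅stX i j hij a, stX j l hjl b⁆ = stX i l hil (a * b) := by
  have := PresentedGroup.one_of_mem (rels := {r | SteinbergRel K r}) (SteinbergRel.comm i j l hij hjl hil a b)
  rw [map_mul, map_inv, map_commutatorElement] at this
  exact mul_inv_eq_one.mp this

theorem stX_commute (i j k l : ℕ) (hij : i ≠ j) (hkl : k ≠ l) (hjk : j ≠ k) (hil : i ≠ l)
    (a b : K) : ⁅stX i j hij a, stX k l hkl b⁆ = 1 := by
  have := PresentedGroup.one_of_mem (rels := {r | SteinbergRel K r})
    (SteinbergRel.commute i j k l hij hkl hjk hil a b)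
  rwa [map_commutatorElement] at this

/-- The elements `w_ij(u) = x_ij(u) x_ji(-u⁻¹) x_ij(u)` of `St(K)`. -/
def stW (i j : ℕ) (h : i ≠ j) (u : Kˣ) : SteinbergGroup K :=
  stX i j h (u : K) * stX j i h.symm (-((u⁻¹ : Kˣ) : K)) * stX i j h (u : K)

/-- The elements `h_ij(u) = w_ij(u) w_ij(-1)` of `St(K)`. -/
def stH (i j : ℕ) (h : i ≠ j) (u : Kˣ) : SteinbergGroup K := stW i j h u * stW i j h (-1)

variable (K)

/-- The space `K^(ℕ)` of finitely supported sequences. The group `SL(K) = lim SL_n(K)` is a subgroup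
of its group of linear automorphisms `GLInf K` (a matrix acts on the first `n` coordinates, and
trivially on the other ones). -/
abbrev GLInf : Type _ := LinearMap.GeneralLinearGroup K (ℕ →₀ K)

variable {K}

/-- The matrix unit `E_ij` as an endomorphism of `K^(ℕ)`. -/
noncomputable def matUnit (i j : ℕ) : Module.End K (ℕ →₀ K) :=
  Finsupp.lsingle i ∘ₗ Finsupp.lapply j

theorem matUnit_mul (i j l : ℕ) : (matUnit i j * matUnit j l : Module.End K (ℕ →₀ K)) =
    matUnit i l := by
  refine LinearMap.ext fun f => ?_
  simp [matUnit]

theorem matUnit_mul_of_ne (i j k l : ℕ) (h : j ≠ k) :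
    (matUnit i j * matUnit k l : Module.End K (ℕ →₀ K)) = 0 := by
  refine LinearMap.ext fun f => ?_
  simp [matUnit, h.symm]

theorem one_add_matUnit_mul (i j : ℕ) (h : i ≠ j) (a b : K) :
    (1 + a • matUnit i j : Module.End K (ℕ →₀ K)) * (1 + b • matUnit i j) =
      1 + (a + b) • matUnit i j := by
  simp only [mul_add, add_mul, smul_mul_smul_comm,
    matUnit_mul_of_ne i j i j h.symm, add_smul, one_mul, mul_one, smul_zero]
  abel

/-- The elementary matrix `1 + a E_ij`. -/
noncomputable def elemInf (i j : ℕ) (h : i ≠ j) (a : K) : GLInf K where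
  val := 1 + a • matUnit i j
  inv := 1 + (-a) • matUnit i j
  val_inv := by rw [one_add_matUnit_mul i j h, add_neg_cancel, zero_smul, add_zero]
  inv_val := by rw [one_add_matUnit_mul i j h, neg_add_cancel, zero_smul, add_zero]

theorem elemInf_val (i j : ℕ) (h : i ≠ j) (a : K) :
    (elemInf i j h a : Module.End K (ℕ →₀ K)) = 1 + a • matUnit i j := rfl

theorem elemInf_add (i j : ℕ) (h : i ≠ j) (a b : K) :
    elemInf i j h a * elemInf i j h b = elemInf i j h (a + b) :=
  Units.ext (one_add_matUnit_mul i j h a b)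

theorem elemInf_comm (i j l : ℕ) (hij : i ≠ j) (hjl : j ≠ l) (hil : i ≠ l) (a b : K) :
    ⁅elemInf i j hij a, elemInf j l hjl b⁆ = elemInf i l hil (a * b) := by
  rw [commutatorElement_def, mul_inv_eq_iff_eq_mul, mul_inv_eq_iff_eq_mul]
  ext1
  have h1 := matUnit_mul_of_ne (K := K) j l i j hil.symm
  have h2 := matUnit_mul_of_ne (K := K) i l i j hil.symm
  have h3 := matUnit_mul_of_ne (K := K) i l j l hjl.symm
  simp only [Units.val_mul, elemInf_val, mul_add, add_mul, smul_mul_smul_comm, matUnit_mul,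
    h1, h2, h3, one_mul, mul_one, smul_zero, zero_mul]
  abel

theorem elemInf_commute (i j k l : ℕ) (hij : i ≠ j) (hkl : k ≠ l) (hjk : j ≠ k) (hil : i ≠ l)
    (a b : K) : ⁅elemInf i j hij a, elemInf k l hkl b⁆ = 1 := by
  rw [commutatorElement_eq_one_iff_mul_comm]
  ext1
  simp only [Units.val_mul, elemInf_val, mul_add, add_mul, smul_mul_smul_comm,
    matUnit_mul_of_ne _ _ _ _ hjk, matUnit_mul_of_ne _ _ _ _ hil.symm, one_mul, mul_one, smul_zero]
  abel

variable (K)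

/-- The homomorphism `St(K) → SL(K)`, `x_ij(a) ↦ 1 + a E_ij`. -/
noncomputable def stToGL : SteinbergGroup K →* GLInf K :=
  SteinbergGroup.lift (fun x => elemInf x.row x.col x.ne x.coef)
    (fun i j h a b => elemInf_add i j h a b)
    (fun i j l hij hjl hil a b => elemInf_comm i j l hij hjl hil a b)
    (fun i j k l hij hkl hjk hil a b => elemInf_commute i j k l hij hkl hjk hil a b)

/-- `K_2(K)`, the kernel of `St(K) → SL(K)`. -/
noncomputable abbrev KTwo : Subgroup (SteinbergGroup K) := (stToGL K).ker

variable {K}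

theorem stToGL_stX (i j : ℕ) (h : i ≠ j) (a : K) : stToGL K (stX i j h a) = elemInf i j h a :=
  SteinbergGroup.lift_stX _ _ _ _ i j h a



/-- `g` acts on `K^(ℕ)` as the diagonal matrix with entries `d`. -/
def IsDiagInf (g : GLInf K) (d : ℕ → Kˣ) : Prop :=
  ∀ k c, (g : Module.End K (ℕ →₀ K)) (Finsupp.single k c) = Finsupp.single k (d k * c)

theorem GLInf.ext_single {g h : GLInf K} (H : ∀ k c, (g : Module.End K (ℕ →₀ K))
    (Finsupp.single k c) = (h : Module.End K (ℕ →₀ K)) (Finsupp.single k c)) : g = h := by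
  ext1
  exact Finsupp.lhom_ext H

theorem IsDiagInf.mul_comm {g h : GLInf K} {d e : ℕ → Kˣ} (hg : IsDiagInf g d)
    (hh : IsDiagInf h e) : g * h = h * g := by
  refine GLInf.ext_single fun k c => ?_
  rw [Units.val_mul, Units.val_mul, Module.End.mul_apply, Module.End.mul_apply, hg, hh, hg, hh,
    mul_left_comm]

theorem elemInf_single (i j : ℕ) (h : i ≠ j) (a : K) (k : ℕ) (c : K) :
    (elemInf i j h a : Module.End K (ℕ →₀ K)) (Finsupp.single k c) =
      Finsupp.single k c + if k = j then Finsupp.single i (a * c) else 0 := by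
  rw [elemInf_val]
  by_cases hk : k = j
  · subst hk
    simp [matUnit]
  · simp [matUnit, hk]

theorem IsDiagInf.conj_elemInf {g : GLInf K} {d : ℕ → Kˣ} (hg : IsDiagInf g d)
    (i j : ℕ) (h : i ≠ j) (a : K) :
    g * elemInf i j h a * g⁻¹ = elemInf i j h (d i * a * ((d j)⁻¹ : Kˣ)) := by
  rw [mul_inv_eq_iff_eq_mul]
  refine GLInf.ext_single fun k c => ?_
  rw [Units.val_mul, Units.val_mul, Module.End.mul_apply, Module.End.mul_apply, hg,
    elemInf_single, elemInf_single, map_add, hg]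
  by_cases hk : k = j
  · subst hk
    simp [hg i _, mul_assoc, -Finsupp.single_mul]
  · simp [hk]

theorem stToGL_stW_single (i j : ℕ) (h : i ≠ j) (u : Kˣ) (k : ℕ) (c : K) :
    (stToGL K (stW i j h u) : Module.End K (ℕ →₀ K)) (Finsupp.single k c) =
      if k = i then Finsupp.single j (-((u⁻¹ : Kˣ) : K) * c)
      else if k = j then Finsupp.single i ((u : K) * c) else Finsupp.single k c := by
  simp only [stW, map_mul, stToGL_stX, Units.val_mul, Module.End.mul_apply]
  by_cases hi : k = i
  · subst hi
    simp [elemInf_single, h, -Finsupp.single_mul]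
  · by_cases hj : k = j
    · subst hj
      simp [elemInf_single, h.symm, h, -Finsupp.single_mul]
    · simp [elemInf_single, hi, hj]

theorem isDiagInf_stH (i j : ℕ) (h : i ≠ j) (u : Kˣ) : IsDiagInf (stToGL K (stH i j h u))
    (fun k => if k = i then u else if k = j then u⁻¹ else 1) := by
  intro k c
  rw [stH, map_mul, Units.val_mul, Module.End.mul_apply, stToGL_stW_single]
  by_cases hi : k = i
  · subst hi
    simp [stToGL_stW_single, h.symm]
  · by_cases hj : k = j
    · subst hj
      simp [stToGL_stW_single, h.symm]
    · simp [stToGL_stW_single, hi, hj]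

/-- The Steinberg symbol `(u, v) = [h_12(u), h_13(v)]` in `K_2(K)` (the three indices are `0, 1, 2`
here). -/
def steinbergSymbol (u v : Kˣ) : KTwo K :=
  ⟨⁅stH 0 1 (by decide) u, stH 0 2 (by decide) v⁆, by
    rw [MonoidHom.mem_ker, map_commutatorElement, commutatorElement_eq_one_iff_mul_comm]
    exact (isDiagInf_stH _ _ _ u).mul_comm (isDiagInf_stH _ _ _ v)⟩

/-- The embedding of `K^n` into `K^(ℕ)` as the span of the first `n` basis vectors. -/
noncomputable def finIncl (n : ℕ) : (Fin n → K) →ₗ[K] (ℕ →₀ K) :=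
  ∑ i : Fin n, Finsupp.lsingle (i : ℕ) ∘ₗ LinearMap.proj i

/-- The projection of `K^(ℕ)` to the first `n` coordinates. -/
noncomputable def finProj (n : ℕ) : (ℕ →₀ K) →ₗ[K] (Fin n → K) :=
  LinearMap.pi fun i => Finsupp.lapply (i : ℕ)

theorem finProj_finIncl (n : ℕ) (v : Fin n → K) : finProj n (finIncl n v) = v := by
  ext i
  simp [finProj, finIncl, Finsupp.single_apply, Fin.val_inj]

/-- The embedding of `n × n` matrices into endomorphisms of `K^(ℕ)`: a matrix acts on the first `n`
coordinates, and trivially on the other ones. -/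
noncomputable def matInf (n : ℕ) : Matrix (Fin n) (Fin n) K →* Module.End K (ℕ →₀ K) where
  toFun M := 1 + finIncl n ∘ₗ (M - 1).mulVecLin ∘ₗ finProj n
  map_one' := by simp
  map_mul' M N := by
    refine LinearMap.ext fun f => ?_
    have h : M * N - 1 = (M - 1) + (N - 1) + (M - 1) * (N - 1) := by noncomm_ring
    rw [h, Matrix.mulVecLin_add, Matrix.mulVecLin_add, Matrix.mulVecLin_mul]
    simp only [LinearMap.add_apply, Module.End.mul_apply, Module.End.one_apply,
      LinearMap.comp_apply, map_add, finProj_finIncl]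
    abel

/-- The embedding of `GL_n(K)` into the automorphisms of `K^(ℕ)`. -/
noncomputable def glInf (n : ℕ) : Matrix.GeneralLinearGroup (Fin n) K →* GLInf K :=
  Units.map (matInf n)

/-- The weights of `diag(y, 1, 1, …)`. -/
def cornerWeight (y : Kˣ) (k : ℕ) : Kˣ := if k = 0 then y else 1

theorem isDiagInf_cornerGL (y : Kˣ) : IsDiagInf (glInf 2 (cornerGL K y)) (cornerWeight y) := by
  intro k c
  change (1 + finIncl 2 ∘ₗ ((cornerGL K y : Matrix (Fin 2) (Fin 2) K) - 1).mulVecLin ∘ₗ finProj 2 :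
    Module.End K (ℕ →₀ K)) _ = _
  have : finIncl 2 (((cornerGL K y : Matrix (Fin 2) (Fin 2) K) - 1).mulVecLin
      (finProj 2 (Finsupp.single k c))) = Finsupp.single 0 (((y : K) - 1) *
        (Finsupp.single k c) 0) := by
    simp [finIncl, finProj, cornerGL, Matrix.one_fin_two, Matrix.vecHead, Matrix.vecTail]
  rw [LinearMap.add_apply, LinearMap.comp_apply, LinearMap.comp_apply, this]
  by_cases hk : k = 0
  · subst hk
    simp [cornerWeight, ← Finsupp.single_add, -Finsupp.single_mul]
    ring_nf
  · simp [cornerWeight, hk]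

theorem cornerWeight_mul (y z : Kˣ) (k : ℕ) :
    cornerWeight (y * z) k = cornerWeight y k * cornerWeight z k := by
  unfold cornerWeight
  split_ifs <;> simp

/-- The endomorphism `x_ij(a) ↦ x_ij(d_i a d_j⁻¹)` of `St(K)`, where `d = (y, 1, 1, …)`. -/
def stActHom (y : Kˣ) : SteinbergGroup K →* SteinbergGroup K :=
  SteinbergGroup.lift (fun x => stX x.row x.col x.ne
      (cornerWeight y x.row * x.coef * ((cornerWeight y x.col)⁻¹ : Kˣ)))
    (fun i j h a b => by rw [stX_add]; congr 1; ring)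
    (fun i j l hij hjl hil a b => by
      rw [stX_comm i j l hij hjl hil]
      congr 1
      have := (cornerWeight y j).inv_mul
      linear_combination (cornerWeight y i * a * b * ((cornerWeight y l)⁻¹ : Kˣ) : K) * this)
    (fun i j k l hij hkl hjk hil a b => stX_commute i j k l hij hkl hjk hil _ _)

theorem stActHom_stX (y : Kˣ) (i j : ℕ) (h : i ≠ j) (a : K) : stActHom y (stX i j h a) =
    stX i j h (cornerWeight y i * a * ((cornerWeight y j)⁻¹ : Kˣ)) :=
  SteinbergGroup.lift_stX _ _ _ _ i j h a

theorem stActHom_one : stActHom (1 : Kˣ) = MonoidHom.id (SteinbergGroup K) :=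
  SteinbergGroup.hom_ext fun i j h a => by
    rw [stActHom_stX]
    simp [cornerWeight]

theorem stActHom_mul (y z : Kˣ) : stActHom (y * z) = (stActHom y).comp (stActHom z) :=
  SteinbergGroup.hom_ext fun i j h a => by
    rw [MonoidHom.comp_apply, stActHom_stX, stActHom_stX, stActHom_stX, cornerWeight_mul,
      cornerWeight_mul, mul_inv]
    congr 1
    push_cast
    ring

/-- The action of `K^*` on `St(K)` which lifts the conjugation action of `K^*` (embedded as the
matrices `diag(y, 1, 1, …)`) on `SL(K)`. -/
def stAct : Kˣ →* MulAut (SteinbergGroup K) where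
  toFun y := MonoidHom.toMulEquiv (stActHom y) (stActHom y⁻¹)
    (by rw [← stActHom_mul, inv_mul_cancel, stActHom_one])
    (by rw [← stActHom_mul, mul_inv_cancel, stActHom_one])
  map_one' := MulEquiv.ext fun x => DFunLike.congr_fun stActHom_one x
  map_mul' y z := MulEquiv.ext fun x => DFunLike.congr_fun (stActHom_mul y z) x

/-- `stAct` lifts the conjugation by `diag(y, 1, 1, …)`. -/
theorem stToGL_stAct (y : Kˣ) (s : SteinbergGroup K) : stToGL K (stAct y s) =
    glInf 2 (cornerGL K y) * stToGL K s * (glInf 2 (cornerGL K y))⁻¹ := by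
  have : (stToGL K).comp (stActHom y) =
      (MulAut.conj (glInf 2 (cornerGL K y))).toMonoidHom.comp (stToGL K) := by
    refine SteinbergGroup.hom_ext fun i j h a => ?_
    rw [MonoidHom.comp_apply, MonoidHom.comp_apply, stActHom_stX, stToGL_stX, stToGL_stX]
    exact ((isDiagInf_cornerGL y).conj_elemInf i j h a).symm
  exact DFunLike.congr_fun this s

variable (K)

/-- The group `SL_2(K)~`, the pullback of `St(K) → SL(K)` along `SL_2(K) → SL(K)`: the pairs
`(s, A)` with `s ∈ St(K)` and `A ∈ SL_2(K)` that have the same image in `SL(K)`. -/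
noncomputable def SLTilde : Subgroup (SteinbergGroup K × Matrix.GeneralLinearGroup (Fin 2) K) :=
  ((stToGL K).comp (MonoidHom.fst _ _)).eqLocus ((glInf 2).comp (MonoidHom.snd _ _)) ⊓
    (SLTwo K).comap (MonoidHom.snd _ _)

variable {K}

theorem mem_SLTilde {x : SteinbergGroup K × Matrix.GeneralLinearGroup (Fin 2) K} :
    x ∈ SLTilde K ↔ stToGL K x.1 = glInf 2 x.2 ∧ x.2 ∈ SLTwo K := Iff.rfl

variable (K)

/-- The action of `K^*` on `SL_2(K)~`, by `stAct` on `St(K)` and by conjugation with `diag(y, 1)` on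
`SL_2(K)`. -/
noncomputable def slTildeAct : Kˣ →* MulAut (SLTilde K) :=
  restrictAction (D := Kˣ)
    { toFun := fun y => MulEquiv.prodCongr (stAct y) (MulAut.conj (cornerGL K y))
      map_one' := by rw [map_one, map_one, map_one]; rfl
      map_mul' := fun y z => by rw [map_mul, map_mul, map_mul]; rfl }
    (SLTilde K) (by
      rintro y ⟨s, A⟩ hx
      rw [mem_SLTilde] at hx ⊢
      refine ⟨?_, (MonoidHom.normal_ker _).conj_mem _ hx.2 _⟩
      change stToGL K (stAct y s) = glInf 2 (cornerGL K y * A * (cornerGL K y)⁻¹)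
      rw [stToGL_stAct, map_mul, map_mul, map_inv, hx.1])

/-- The group `GL_2(K)^ = SL_2(K)~ ⋊ K^*`. -/
abbrev GLHat : Type _ := SLTilde K ⋊[slTildeAct K] Kˣ

/-- The projection `GL_2(K)^ → GL_2(K)`, `((s, A), y) ↦ A diag(y, 1)`. -/
noncomputable def glHatProj : GLHat K →* Matrix.GeneralLinearGroup (Fin 2) K :=
  semidirectToGL ((MonoidHom.snd _ _).comp (SLTilde K).subtype) (slTildeAct K) fun _ _ => rfl

/-- The inclusion of `K_2(K)` into `GL_2(K)^`. -/
noncomputable def glHatIncl : KTwo K →* GLHat K :=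
  SemidirectProduct.inl.comp
    { toFun := fun k => ⟨((k : SteinbergGroup K), 1), by
        rw [mem_SLTilde, map_one]
        exact ⟨k.2, one_mem _⟩⟩
      map_one' := rfl
      map_mul' := fun a b => Subtype.ext (Prod.ext rfl (one_mul 1).symm) }

end Steinberg


/-- The multiplicative group `ℝ_+^*` of positive real numbers. -/
abbrev PosReal : Type := {x : ℝ // 0 < x}

section Haar

open MeasureTheory

variable {𝕜 : Type} [RCLike 𝕜] {n : ℕ}

/-- The vectors in `K^n`, `K = 𝕜((t))`, whose entries lie in `t^k 𝕜[[t]]`, as an `𝕜`-subspace. -/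
def laurentFil (𝕜 : Type) [RCLike 𝕜] (n : ℕ) (k : ℤ) :
    Submodule 𝕜 (Fin n → LaurentSeries 𝕜) where
  carrier := {v | ∀ i, ∀ m < k, (v i).coeff m = 0}
  add_mem' := fun {v w} hv hw i m hm => by simp [hv i m hm, hw i m hm]
  zero_mem' := fun i m _ => by simp
  smul_mem' := fun c v hv i m hm => by simp [hv i m hm]

theorem mem_laurentFil {k : ℤ} {v : Fin n → LaurentSeries 𝕜} :
    v ∈ laurentFil 𝕜 n k ↔ ∀ i, ∀ m < k, (v i).coeff m = 0 := Iff.rfl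

theorem mulVec_smul_laurent (g : Matrix (Fin n) (Fin n) (LaurentSeries 𝕜)) (c : 𝕜)
    (v : Fin n → LaurentSeries 𝕜) : g.mulVec (c • v) = c • g.mulVec v := by
  have h : ∀ w : Fin n → LaurentSeries 𝕜, c • w = (HahnSeries.C c : LaurentSeries 𝕜) • w := by
    intro w
    ext1 i
    exact HahnSeries.C_mul_eq_smul.symm
  rw [h, h, Matrix.mulVec_smul]

/-- The action of `GL_n(K)` on `K^n`, by `𝕜`-linear automorphisms. -/
noncomputable def glLin : Matrix.GeneralLinearGroup (Fin n) (LaurentSeries 𝕜) →*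
    ((Fin n → LaurentSeries 𝕜) ≃ₗ[𝕜] (Fin n → LaurentSeries 𝕜)) where
  toFun g :=
    { toFun := fun v => g.val.mulVec v
      invFun := fun v => g.inv.mulVec v
      map_add' := fun v w => Matrix.mulVec_add _ v w
      map_smul' := fun c v => mulVec_smul_laurent g.val c v
      left_inv := fun v => by
        beta_reduce
        rw [Matrix.mulVec_mulVec, Units.inv_val, Matrix.one_mulVec]
      right_inv := fun v => by
        beta_reduce
        rw [Matrix.mulVec_mulVec, Units.val_inv, Matrix.one_mulVec] }
  map_one' := LinearEquiv.ext fun v => Matrix.one_mulVec v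
  map_mul' g h := LinearEquiv.ext fun v => (Matrix.mulVec_mulVec v g.val h.val).symm

theorem glLin_apply (g : Matrix.GeneralLinearGroup (Fin n) (LaurentSeries 𝕜))
    (v : Fin n → LaurentSeries 𝕜) : glLin g v = g.val.mulVec v := rfl

/-- The lattices `g O^n`, for `O = 𝕜[[t]]` and `g ∈ GL_n(K)`. -/
abbrev OLattice (𝕜 : Type) [RCLike 𝕜] (n : ℕ) : Type :=
  {L : Submodule 𝕜 (Fin n → LaurentSeries 𝕜) //
    ∃ g : Matrix.GeneralLinearGroup (Fin n) (LaurentSeries 𝕜),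
      L = (laurentFil 𝕜 n 0).map (glLin g).toLinearMap}

noncomputable instance : MulAction (Matrix.GeneralLinearGroup (Fin n) (LaurentSeries 𝕜))
    (OLattice 𝕜 n) where
  smul g L := ⟨L.1.map (glLin g).toLinearMap, by
    obtain ⟨L, a, rfl⟩ := L
    exact ⟨g * a, by rw [map_mul, ← Submodule.map_comp]; rfl⟩⟩
  one_smul L := Subtype.ext (by
    change L.1.map (glLin 1).toLinearMap = L.1
    rw [map_one]
    exact Submodule.map_id _)
  mul_smul g h L := Subtype.ext (by
    change L.1.map (glLin (g * h)).toLinearMap =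
      (L.1.map (glLin h).toLinearMap).map (glLin g).toLinearMap
    rw [map_mul, ← Submodule.map_comp]; rfl)

/-- The standard lattice `O^n`. -/
noncomputable def stdLattice (𝕜 : Type) [RCLike 𝕜] (n : ℕ) : OLattice 𝕜 n :=
  ⟨laurentFil 𝕜 n 0, 1, by rw [map_one]; exact (Submodule.map_id _).symm⟩

theorem OLattice.smul_le_smul (g : Matrix.GeneralLinearGroup (Fin n) (LaurentSeries 𝕜))
    {N L : OLattice 𝕜 n} (h : N ≤ L) : g • N ≤ g • L := Submodule.map_mono h

theorem OLattice.glLin_mem (g : Matrix.GeneralLinearGroup (Fin n) (LaurentSeries 𝕜))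
    (L : OLattice 𝕜 n) : ∀ x ∈ (g⁻¹ • L).1, glLin g x ∈ L.1 := by
  rintro x ⟨y, hy, rfl⟩
  change glLin g (glLin g⁻¹ y) ∈ L.1
  rw [map_inv]
  simpa using hy

theorem OLattice.glLin_inv_mem (g : Matrix.GeneralLinearGroup (Fin n) (LaurentSeries 𝕜))
    (L : OLattice 𝕜 n) : ∀ x ∈ L.1, glLin g⁻¹ x ∈ (g⁻¹ • L).1 :=
  fun x hx => ⟨x, hx, rfl⟩

/-- The quotient `L / N` (for `N ≤ L`). For lattices this is a finite-dimensional vector space over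
`𝕜`, with its natural topology and its Borel `σ`-algebra. -/
def SubQuot (N L : Submodule 𝕜 (Fin n → LaurentSeries 𝕜)) : Type := L ⧸ N.submoduleOf L

namespace SubQuot

variable {N L N' L' N'' L'' : Submodule 𝕜 (Fin n → LaurentSeries 𝕜)}

noncomputable instance : AddCommGroup (SubQuot N L) :=
  inferInstanceAs (AddCommGroup (L ⧸ N.submoduleOf L))

noncomputable instance : Module 𝕜 (SubQuot N L) :=
  inferInstanceAs (Module 𝕜 (L ⧸ N.submoduleOf L))

noncomputable instance : TopologicalSpace (SubQuot N L) := moduleTopology 𝕜 (SubQuot N L)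

instance : IsModuleTopology 𝕜 (SubQuot N L) := ⟨rfl⟩

instance : IsTopologicalAddGroup (SubQuot N L) := IsModuleTopology.topologicalAddGroup 𝕜 _

noncomputable instance : MeasurableSpace (SubQuot N L) := borel _

instance : BorelSpace (SubQuot N L) := ⟨rfl⟩

/-- The map `L / N → L' / N'` which is induced by a linear map `f` with `f(N) ≤ N'`,
`f(L) ≤ L'`. -/
noncomputable def map (f : (Fin n → LaurentSeries 𝕜) →ₗ[𝕜] (Fin n → LaurentSeries 𝕜))
    (hN : ∀ x ∈ N, f x ∈ N') (hL : ∀ x ∈ L, f x ∈ L') : SubQuot N L →ₗ[𝕜] SubQuot N' L' :=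
  Submodule.mapQ (N.submoduleOf L) (N'.submoduleOf L') (f.restrict hL) fun x hx => hN x.1 hx

theorem map_map (f g : (Fin n → LaurentSeries 𝕜) →ₗ[𝕜] (Fin n → LaurentSeries 𝕜))
    (hN : ∀ x ∈ N, f x ∈ N') (hL : ∀ x ∈ L, f x ∈ L')
    (hN' : ∀ x ∈ N', g x ∈ N'') (hL' : ∀ x ∈ L', g x ∈ L'') (x : SubQuot N L) :
    map g hN' hL' (map f hN hL x) =
      map (g ∘ₗ f) (fun x hx => hN' _ (hN x hx)) (fun x hx => hL' _ (hL x hx)) x := by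
  induction x using Submodule.Quotient.induction_on with
  | H x => rfl

theorem map_eq_self (f : (Fin n → LaurentSeries 𝕜) →ₗ[𝕜] (Fin n → LaurentSeries 𝕜))
    (hf : f = LinearMap.id)
    (hN : ∀ x ∈ N, f x ∈ N) (hL : ∀ x ∈ L, f x ∈ L) (x : SubQuot N L) : map f hN hL x = x := by
  subst hf
  induction x using Submodule.Quotient.induction_on with
  | H x => rfl

/-- The inclusion `L / N → P / N`, for `N ≤ L ≤ P`. -/
noncomputable def incl (N : Submodule 𝕜 (Fin n → LaurentSeries 𝕜)) (h : L ≤ L') :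
    SubQuot N L →ₗ[𝕜] SubQuot N L' :=
  map LinearMap.id (fun _ hx => hx) (fun _ hx => h hx)

/-- The projection `P / N → P / L`, for `N ≤ L ≤ P`. -/
noncomputable def proj (h : N ≤ N') (L : Submodule 𝕜 (Fin n → LaurentSeries 𝕜)) :
    SubQuot N L →ₗ[𝕜] SubQuot N' L :=
  map LinearMap.id (fun _ hx => h hx) (fun _ hx => hx)

theorem proj_surjective (h : N ≤ N') (L : Submodule 𝕜 (Fin n → LaurentSeries 𝕜)) :
    Function.Surjective (proj h L) := by
  intro x
  induction x using Submodule.Quotient.induction_on with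
  | H x => exact ⟨Submodule.Quotient.mk x, rfl⟩

theorem measurable_of_linearMap (f : SubQuot N L →ₗ[𝕜] SubQuot N' L') : Measurable f :=
  (IsModuleTopology.continuous_of_linearMap f).measurable

end SubQuot

/-- A Haar theory: a choice of a Haar measure on `L / N` for all lattices `N ≤ L`, such that for
`N ≤ L ≤ P` the measure on `P / N` is the product of those on `L / N` and `P / L`, i.e. it
corresponds to `meas N L ⊗ meas L P` under `μ(L / N) ⊗ μ(P / L) = μ(P / N)`. -/
structure HaarTheory (𝕜 : Type) [RCLike 𝕜] (n : ℕ) where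
  meas : ∀ N L : OLattice 𝕜 n, N ≤ L → Measure (SubQuot N.1 L.1)
  haar : ∀ N L h, (meas N L h).IsAddHaarMeasure
  mul : ∀ (N L P : OLattice 𝕜 n) (hNL : N ≤ L) (hLP : L ≤ P)
    (s : SubQuot L.1 P.1 →ₗ[𝕜] SubQuot N.1 P.1),
    SubQuot.proj hNL P.1 ∘ₗ s = LinearMap.id →
    meas N P (hNL.trans hLP) = Measure.map (fun x => SubQuot.incl N.1 hLP x.1 + s x.2)
      ((meas N L hNL).prod (meas L P hLP))

instance (h : HaarTheory 𝕜 n) (N L : OLattice 𝕜 n) (hNL : N ≤ L) :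
    (h.meas N L hNL).IsAddHaarMeasure := h.haar N L hNL

section FiniteDim

theorem coeff_mul_of_lt (x y : LaurentSeries 𝕜) (a b : ℤ) (hx : ∀ m < a, x.coeff m = 0)
    (hy : ∀ m < b, y.coeff m = 0) : ∀ m < a + b, (x * y).coeff m = 0 := by
  intro m hm
  rw [HahnSeries.coeff_mul]
  refine Finset.sum_eq_zero fun ij hij => ?_
  rw [Finset.mem_antidiagonal] at hij
  by_cases h : ij.1 < a
  · rw [hx _ h, zero_mul]
  · rw [hy ij.2 (by omega), mul_zero]

theorem glLin_fil (g : Matrix.GeneralLinearGroup (Fin n) (LaurentSeries 𝕜)) :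
    ∃ c : ℤ, ∀ k, ∀ v ∈ laurentFil 𝕜 n k, glLin g v ∈ laurentFil 𝕜 n (k - c) := by
  obtain ⟨c, hc⟩ : ∃ c : ℤ, ∀ i j, c ≤ (g.val i j).order := by
    obtain ⟨c, hc⟩ := (Set.finite_range fun ij : Fin n × Fin n =>
      (g.val ij.1 ij.2).order).bddBelow
    exact ⟨c, fun i j => hc ⟨(i, j), rfl⟩⟩
  refine ⟨-c, fun k v hv i m hm => ?_⟩
  rw [glLin_apply, Matrix.mulVec, dotProduct, HahnSeries.coeff_sum]
  refine Finset.sum_eq_zero fun j _ => ?_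
  refine coeff_mul_of_lt _ _ c k (fun l hl => ?_) (hv j) m (by omega)
  exact HahnSeries.coeff_eq_zero_of_lt_order (hl.trans_le (hc i j))

theorem OLattice.exists_le_fil (L : OLattice 𝕜 n) : ∃ a : ℤ, L.1 ≤ laurentFil 𝕜 n a := by
  obtain ⟨L, g, rfl⟩ := L
  obtain ⟨c, hc⟩ := glLin_fil g
  refine ⟨0 - c, ?_⟩
  rintro _ ⟨v, hv, rfl⟩
  exact hc 0 v hv

theorem OLattice.exists_fil_le (L : OLattice 𝕜 n) : ∃ b : ℤ, ∀ k, b ≤ k → laurentFil 𝕜 n k ≤ L.1 := by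
  obtain ⟨L, g, rfl⟩ := L
  obtain ⟨c, hc⟩ := glLin_fil g⁻¹
  refine ⟨c, fun k hk v hv => ⟨glLin g⁻¹ v, fun i m hm => hc k v hv i m (by omega), ?_⟩⟩
  change glLin g (glLin g⁻¹ v) = v
  rw [map_inv]
  simp

/-- The lattice `t^k O^n`. -/
noncomputable def filLattice (𝕜 : Type) [RCLike 𝕜] (n : ℕ) (k : ℤ) : OLattice 𝕜 n :=
  ⟨laurentFil 𝕜 n k, by
    have hk : (HahnSeries.single k 1 : LaurentSeries 𝕜) * HahnSeries.single (-k) 1 = 1 := by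
      rw [HahnSeries.single_mul_single]; simp
    let u : (LaurentSeries 𝕜)ˣ := ⟨HahnSeries.single k 1, HahnSeries.single (-k) 1, hk, by
      rw [mul_comm]; exact hk⟩
    refine ⟨Units.map (Matrix.scalar (Fin n) : LaurentSeries 𝕜 →+* _).toMonoidHom u, ?_⟩
    have hmul : ∀ (w : (LaurentSeries 𝕜)ˣ) (v : Fin n → LaurentSeries 𝕜),
        glLin (Units.map (Matrix.scalar (Fin n) : LaurentSeries 𝕜 →+* _).toMonoidHom w) v =
          (w : LaurentSeries 𝕜) • v := by
      intro w v
      rw [glLin_apply]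
      ext1 i
      change (Matrix.diagonal fun _ => (w : LaurentSeries 𝕜)).mulVec v i = _
      rw [Matrix.mulVec_diagonal]
      rfl
    ext v
    constructor
    · intro hv
      refine ⟨(↑u⁻¹ : LaurentSeries 𝕜) • v, fun i m hm => ?_, ?_⟩
      · change ((HahnSeries.single (-k) (1 : 𝕜)) * v i).coeff m = 0
        rw [HahnSeries.coeff_single_mul, hv i _ (by omega), mul_zero]
      · change glLin _ _ = _
        rw [hmul, smul_smul, Units.mul_inv, one_smul]
    · rintro ⟨w, hw, rfl⟩ i m hm
      change ((glLin _ w) i).coeff m = 0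
      rw [hmul]
      change ((HahnSeries.single k (1 : 𝕜)) * w i).coeff m = 0
      rw [HahnSeries.coeff_single_mul, hw i _ (by omega), mul_zero]⟩

theorem OLattice.exists_le_le (L M : OLattice 𝕜 n) : ∃ N : OLattice 𝕜 n, N ≤ L ∧ N ≤ M := by
  obtain ⟨a, ha⟩ := L.exists_fil_le
  obtain ⟨b, hb⟩ := M.exists_fil_le
  exact ⟨filLattice 𝕜 n (max a b), ha _ (le_max_left _ _), hb _ (le_max_right _ _)⟩

instance finite_subQuot (N L : OLattice 𝕜 n) : Module.Finite 𝕜 (SubQuot N.1 L.1) := by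
  obtain ⟨a, ha⟩ := L.exists_le_fil
  obtain ⟨b, hb⟩ := N.exists_fil_le
  let f : L.1 →ₗ[𝕜] (Fin n → Finset.Ico a b → 𝕜) :=
    { toFun := fun v i m => (v.1 i).coeff m
      map_add' := fun v w => by ext; simp
      map_smul' := fun c v => by ext; simp }
  have hf : LinearMap.ker f ≤ N.1.submoduleOf L.1 := by
    intro v hv
    refine hb b le_rfl fun i m hm => ?_
    by_cases h : m < a
    · exact ha v.2 i m h
    · exact congrFun (congrFun hv i) ⟨m, by simp; omega⟩
  have : Module.Finite 𝕜 (L.1 ⧸ LinearMap.ker f) :=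
    have : Module.Finite 𝕜 (LinearMap.range f) := FiniteDimensional.finiteDimensional_submodule _
    Module.Finite.equiv f.quotKerEquivRange.symm
  exact Module.Finite.of_surjective (Submodule.factor hf) (Submodule.factor_surjective hf)

variable (N L : OLattice 𝕜 n)

noncomputable def subQuotEquiv :
    SubQuot N.1 L.1 ≃L[𝕜] (Fin (Module.finrank 𝕜 (SubQuot N.1 L.1)) → 𝕜) where
  toLinearEquiv := (Module.finBasis 𝕜 (SubQuot N.1 L.1)).equivFun
  continuous_toFun := IsModuleTopology.continuous_of_linearMap
    (Module.finBasis 𝕜 (SubQuot N.1 L.1)).equivFun.toLinearMap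
  continuous_invFun := IsModuleTopology.continuous_of_linearMap
    (Module.finBasis 𝕜 (SubQuot N.1 L.1)).equivFun.symm.toLinearMap

instance : T2Space (SubQuot N.1 L.1) := (subQuotEquiv N L).toHomeomorph.isEmbedding.t2Space

instance : LocallyCompactSpace (SubQuot N.1 L.1) :=
  (subQuotEquiv N L).toHomeomorph.isClosedEmbedding.locallyCompactSpace

instance : SecondCountableTopology (SubQuot N.1 L.1) :=
  (subQuotEquiv N L).toHomeomorph.isEmbedding.secondCountableTopology

end FiniteDim

/-- The isomorphism `g⁻¹L / g⁻¹N ≅ L / N` which is given by `g`. -/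
noncomputable def actEquiv (g : Matrix.GeneralLinearGroup (Fin n) (LaurentSeries 𝕜))
    (N L : OLattice 𝕜 n) : SubQuot (g⁻¹ • N).1 (g⁻¹ • L).1 ≃L[𝕜] SubQuot N.1 L.1 where
  toLinearEquiv := LinearEquiv.ofLinearMap
    (SubQuot.map (glLin g).toLinearMap (N.glLin_mem g) (L.glLin_mem g))
    (SubQuot.map (glLin g⁻¹).toLinearMap (N.glLin_inv_mem g) (L.glLin_inv_mem g))
    (LinearMap.ext fun x => by
      rw [LinearMap.comp_apply, SubQuot.map_map, SubQuot.map_eq_self]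
      · rfl
      · rw [map_inv]; exact LinearMap.ext fun v => (glLin g).apply_symm_apply v)
    (LinearMap.ext fun x => by
      rw [LinearMap.comp_apply, SubQuot.map_map, SubQuot.map_eq_self]
      · rfl
      · rw [map_inv]; exact LinearMap.ext fun v => (glLin g).symm_apply_apply v)
  continuous_toFun := IsModuleTopology.continuous_of_linearMap
    (SubQuot.map (glLin g).toLinearMap (N.glLin_mem g) (L.glLin_mem g))
  continuous_invFun := IsModuleTopology.continuous_of_linearMap
    (SubQuot.map (glLin g⁻¹).toLinearMap (N.glLin_inv_mem g) (L.glLin_inv_mem g))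

theorem actEquiv_apply (g : Matrix.GeneralLinearGroup (Fin n) (LaurentSeries 𝕜))
    (N L : OLattice 𝕜 n) (x : SubQuot (g⁻¹ • N).1 (g⁻¹ • L).1) : actEquiv g N L x =
      SubQuot.map (glLin g).toLinearMap (N.glLin_mem g) (L.glLin_mem g) x := rfl

theorem measurable_add_section {N L P : OLattice 𝕜 n} (hLP : L ≤ P)
    (s : SubQuot L.1 P.1 →ₗ[𝕜] SubQuot N.1 P.1) :
    Measurable (fun x : SubQuot N.1 L.1 × SubQuot L.1 P.1 => SubQuot.incl N.1 hLP x.1 + s x.2) :=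
  ((SubQuot.measurable_of_linearMap _).comp measurable_fst).add
    ((SubQuot.measurable_of_linearMap _).comp measurable_snd)

namespace HaarTheory

/-- An element `g ∈ GL_n(K)` sends a Haar theory `h` to the Haar theory whose measure on `L / N` is
the image under `g` of the measure of `h` on `g⁻¹L / g⁻¹N`. -/
noncomputable instance : SMul (Matrix.GeneralLinearGroup (Fin n) (LaurentSeries 𝕜))
    (HaarTheory 𝕜 n) where
  smul g h :=
    { meas := fun N L hNL =>
        (h.meas (g⁻¹ • N) (g⁻¹ • L) (OLattice.smul_le_smul g⁻¹ hNL)).map (actEquiv g N L)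
      haar := fun N L hNL => ContinuousLinearEquiv.isAddHaarMeasure_map _ _
      mul := by
        intro N L P hNL hLP s hs
        have hNL' := OLattice.smul_le_smul g⁻¹ hNL
        have hLP' := OLattice.smul_le_smul g⁻¹ hLP
        have e1 : Measurable (actEquiv g N L) := (actEquiv g N L).continuous.measurable
        have e2 : Measurable (actEquiv g L P) := (actEquiv g L P).continuous.measurable
        have e3 : Measurable (actEquiv g N P) := (actEquiv g N P).continuous.measurable
        let s' : SubQuot (g⁻¹ • L).1 (g⁻¹ • P).1 →ₗ[𝕜] SubQuot (g⁻¹ • N).1 (g⁻¹ • P).1 :=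
          (actEquiv g N P).symm.toLinearMap ∘ₗ s ∘ₗ (actEquiv g L P).toLinearMap
        have hs' : ∀ x, actEquiv g N P (s' x) = s (actEquiv g L P x) := fun x =>
          (actEquiv g N P).apply_symm_apply _
        have comm_proj : ∀ x, actEquiv g L P (SubQuot.proj hNL' (g⁻¹ • P).1 x) =
            SubQuot.proj hNL P.1 (actEquiv g N P x) := fun x => by
          induction x using Submodule.Quotient.induction_on with
          | H x => rfl
        have comm_incl : ∀ x, actEquiv g N P (SubQuot.incl (g⁻¹ • N).1 hLP' x) =
            SubQuot.incl N.1 hLP (actEquiv g N L x) := fun x => by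
          induction x using Submodule.Quotient.induction_on with
          | H x => rfl
        rw [h.mul _ _ _ hNL' hLP' s' (LinearMap.ext fun x => (actEquiv g L P).injective (by
            rw [LinearMap.comp_apply, comm_proj, hs']
            exact LinearMap.congr_fun hs _)),
          Measure.map_map e3 (measurable_add_section hLP' s'), Measure.map_prod_map _ _ e1 e2,
          Measure.map_map (measurable_add_section hLP s) (e1.prodMap e2)]
        congr 1
        ext1 x
        simp only [Function.comp_apply, Prod.map_fst, Prod.map_snd, map_add, hs', comm_incl] }

theorem smul_meas (g : Matrix.GeneralLinearGroup (Fin n) (LaurentSeries 𝕜)) (h : HaarTheory 𝕜 n)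
    (N L : OLattice 𝕜 n) (hNL : N ≤ L) : (g • h).meas N L hNL =
      (h.meas (g⁻¹ • N) (g⁻¹ • L) (OLattice.smul_le_smul g⁻¹ hNL)).map (actEquiv g N L) := rfl

theorem ext' {h h' : HaarTheory 𝕜 n} (H : ∀ N L hNL, h.meas N L hNL = h'.meas N L hNL) :
    h = h' := by
  cases h
  cases h'
  congr
  ext1 N
  ext1 L
  ext1 hNL
  exact H N L hNL

theorem map_meas_congr (h : HaarTheory 𝕜 n) {N N' L L' P Q : OLattice 𝕜 n} (hN : N' = N)
    (hL : L' = L) (hNL : N ≤ L) (hNL' : N' ≤ L')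
    (f f' : (Fin n → LaurentSeries 𝕜) →ₗ[𝕜] (Fin n → LaurentSeries 𝕜)) (hf : f = f')
    (h1 : ∀ x ∈ N.1, f x ∈ P.1) (h2 : ∀ x ∈ L.1, f x ∈ Q.1)
    (h1' : ∀ x ∈ N'.1, f' x ∈ P.1) (h2' : ∀ x ∈ L'.1, f' x ∈ Q.1) :
    (h.meas N L hNL).map (SubQuot.map f h1 h2) =
      (h.meas N' L' hNL').map (SubQuot.map f' h1' h2') := by
  subst hN hL hf
  rfl

noncomputable instance : MulAction (Matrix.GeneralLinearGroup (Fin n) (LaurentSeries 𝕜))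
    (HaarTheory 𝕜 n) where
  one_smul h := ext' fun N L hNL => by
    have h1 : (1 : Matrix.GeneralLinearGroup (Fin n) (LaurentSeries 𝕜))⁻¹ • N = N := by simp
    have h2 : (1 : Matrix.GeneralLinearGroup (Fin n) (LaurentSeries 𝕜))⁻¹ • L = L := by simp
    rw [smul_meas]
    refine (map_meas_congr h h1.symm h2.symm _ hNL (glLin 1).toLinearMap LinearMap.id
      (by rw [map_one]; rfl) (N.glLin_mem 1) (L.glLin_mem 1)
      (fun _ hx => hx) (fun _ hx => hx)).trans ?_
    convert Measure.map_id
    ext1 x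
    exact SubQuot.map_eq_self _ rfl _ _ x
  mul_smul a b h := ext' fun N L hNL => by
    rw [smul_meas, smul_meas, smul_meas,
      Measure.map_map (actEquiv a N L).continuous.measurable
        (actEquiv b _ _).continuous.measurable]
    have : (actEquiv a N L ∘ actEquiv b (a⁻¹ • N) (a⁻¹ • L)) =
        SubQuot.map ((glLin a).toLinearMap ∘ₗ (glLin b).toLinearMap)
          (fun x hx => N.glLin_mem a _ ((a⁻¹ • N).glLin_mem b x hx))
          (fun x hx => L.glLin_mem a _ ((a⁻¹ • L).glLin_mem b x hx)) := by
      ext1 x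
      exact SubQuot.map_map _ _ _ _ _ _ x
    rw [this]
    exact map_meas_congr h (by rw [mul_inv_rev, mul_smul]) (by rw [mul_inv_rev, mul_smul]) _ _
      (glLin (a * b)).toLinearMap _ (by rw [map_mul]; rfl) (N.glLin_mem (a * b))
      (L.glLin_mem (a * b)) _ _

/-- The positive number `c` with `h'.meas N L = c • h.meas N L`. -/
noncomputable def factor (h h' : HaarTheory 𝕜 n) (N L : OLattice 𝕜 n) (hNL : N ≤ L) : NNReal :=
  (h'.meas N L hNL).addHaarScalarFactor (h.meas N L hNL)

theorem factor_pos (h h' : HaarTheory 𝕜 n) (N L : OLattice 𝕜 n) (hNL : N ≤ L) :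
    0 < factor h h' N L hNL := Measure.addHaarScalarFactor_pos_of_isAddHaarMeasure _ _

theorem meas_eq_factor_smul (h h' : HaarTheory 𝕜 n) (N L : OLattice 𝕜 n) (hNL : N ≤ L) :
    h'.meas N L hNL = factor h h' N L hNL • h.meas N L hNL :=
  Measure.isAddLeftInvariant_eq_smul _ _

theorem factor_eq_of_smul (h h' : HaarTheory 𝕜 n) (N L : OLattice 𝕜 n) (hNL : N ≤ L) (c : NNReal)
    (H : h'.meas N L hNL = c • h.meas N L hNL) : factor h h' N L hNL = c := by
  unfold factor
  simp only [H]
  rw [Measure.addHaarScalarFactor_smul, Measure.addHaarScalarFactor_self, smul_eq_mul, mul_one]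

theorem factor_mul (h h' : HaarTheory 𝕜 n) {N L P : OLattice 𝕜 n} (hNL : N ≤ L) (hLP : L ≤ P) :
    factor h h' N P (hNL.trans hLP) = factor h h' N L hNL * factor h h' L P hLP := by
  obtain ⟨s, hs⟩ := (SubQuot.proj hNL P.1).exists_rightInverse_of_surjective
    (LinearMap.range_eq_top.2 (SubQuot.proj_surjective hNL P.1))
  apply factor_eq_of_smul
  rw [h.mul N L P hNL hLP s hs, h'.mul N L P hNL hLP s hs, meas_eq_factor_smul h h' N L hNL,
    meas_eq_factor_smul h h' L P hLP, Measure.prod_smul_left, Measure.prod_smul_right,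
    Measure.map_smul, Measure.map_smul, smul_smul]

theorem factor_trans (h h' h'' : HaarTheory 𝕜 n) (N L : OLattice 𝕜 n) (hNL : N ≤ L) :
    factor h h'' N L hNL = factor h h' N L hNL * factor h' h'' N L hNL := by
  rw [mul_comm]
  exact Measure.addHaarScalarFactor_eq_mul _ _ _

theorem factor_smul (g : Matrix.GeneralLinearGroup (Fin n) (LaurentSeries 𝕜))
    (h h' : HaarTheory 𝕜 n) (N L : OLattice 𝕜 n) (hNL : N ≤ L) :
    factor (g • h) (g • h') N L hNL =
      factor h h' (g⁻¹ • N) (g⁻¹ • L) (OLattice.smul_le_smul g⁻¹ hNL) := by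
  apply factor_eq_of_smul
  rw [smul_meas, smul_meas, ← Measure.map_smul, ← meas_eq_factor_smul]

end HaarTheory

open HaarTheory

/-- The `ℝ_+^*`-torsor `μ(L | M)`. An element of it is given by its coordinates `r(h)` with respect
to all Haar theories `h`: it is `r(h) • (h_(L/N))⁻¹ ⊗ h_(M/N)` in `μ(L/N)⁻¹ ⊗ μ(M/N)` for each
lattice `N ≤ L, M`. This means that if `h'_(L/N) = a h_(L/N)` and `h'_(M/N) = b h_(M/N)`, then
`r(h') b = r(h) a`. The isomorphism `μ(L | M) ⊗ μ(M | P) → μ(L | P)` is the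
multiplication of coordinates; for `L ≤ M` a Haar measure `c • h_(M/L)` on `M / L` is the element
of `μ(L | M)` with coordinates `r(h) = c`. -/
def RelHaar (L M : OLattice 𝕜 n) : Set (HaarTheory 𝕜 n → PosReal) :=
  {r | ∀ (h h' : HaarTheory 𝕜 n) (N : OLattice 𝕜 n) (hL : N ≤ L) (hM : N ≤ M),
    (r h' : ℝ) * factor h h' N M hM = r h * factor h h' N L hL}

namespace RelHaar

variable {L M P : OLattice 𝕜 n} {r r' : HaarTheory 𝕜 n → PosReal}

theorem of_exists (H : ∃ (N : OLattice 𝕜 n) (hL : N ≤ L) (hM : N ≤ M),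
    ∀ h h' : HaarTheory 𝕜 n, (r h' : ℝ) * factor h h' N M hM = r h * factor h h' N L hL) :
    r ∈ RelHaar L M := by
  obtain ⟨N, hL, hM, H⟩ := H
  intro h h' N' hL' hM'
  obtain ⟨Q, hQ, hQ'⟩ := N.exists_le_le N'
  have p1 : (0 : ℝ) < factor h h' Q N hQ := factor_pos _ _ _ _ _
  have p2 : (0 : ℝ) < factor h h' Q N' hQ' := factor_pos _ _ _ _ _
  have e1 := (factor_mul h h' hQ hL).symm.trans (factor_mul h h' hQ' hL')
  have e2 := (factor_mul h h' hQ hM).symm.trans (factor_mul h h' hQ' hM')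
  have e1' : (factor h h' Q N hQ : ℝ) * factor h h' N L hL =
    factor h h' Q N' hQ' * factor h h' N' L hL' := by exact_mod_cast e1
  have e2' : (factor h h' Q N hQ : ℝ) * factor h h' N M hM =
    factor h h' Q N' hQ' * factor h h' N' M hM' := by exact_mod_cast e2
  apply mul_left_cancel₀ p2.ne'
  linear_combination (factor h h' Q N hQ : ℝ) * H h h' - (r h' : ℝ) * e2' + (r h : ℝ) * e1'

theorem one_mem : (1 : HaarTheory 𝕜 n → PosReal) ∈ RelHaar L L := fun _ _ _ _ _ => rfl

theorem const_mem (c : PosReal) : (fun _ => c) ∈ RelHaar L L := fun _ _ _ _ _ => rfl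

theorem mul_mem (hr : r ∈ RelHaar L M) (hr' : r' ∈ RelHaar M P) : r * r' ∈ RelHaar L P := by
  obtain ⟨Q, hQL, hQM⟩ := L.exists_le_le M
  obtain ⟨N, hNQ, hNP⟩ := Q.exists_le_le P
  refine of_exists ⟨N, hNQ.trans hQL, hNP, fun h h' => ?_⟩
  have e1 := hr h h' N (hNQ.trans hQL) (hNQ.trans hQM)
  have e2 := hr' h h' N (hNQ.trans hQM) hNP
  change ((r h' : ℝ) * r' h') * _ = (r h * r' h) * _
  linear_combination (r h' : ℝ) * e2 + (r' h : ℝ) * e1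

theorem inv_mem (hr : r ∈ RelHaar L M) : r⁻¹ ∈ RelHaar M L := by
  intro h h' N hM hL
  have e := hr h h' N hL hM
  change (r h' : ℝ)⁻¹ * _ = (r h : ℝ)⁻¹ * _
  have p1 := (r h).2
  have p2 := (r h').2
  field_simp
  linear_combination -e

theorem smul_mem (g : Matrix.GeneralLinearGroup (Fin n) (LaurentSeries 𝕜))
    (hr : r ∈ RelHaar L M) : (mulAutArrow g r : HaarTheory 𝕜 n → PosReal) ∈
      RelHaar (g • L) (g • M) := by
  intro h h' N hL hM
  have hL' : g⁻¹ • N ≤ L := by simpa using OLattice.smul_le_smul g⁻¹ hL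
  have hM' : g⁻¹ • N ≤ M := by simpa using OLattice.smul_le_smul g⁻¹ hM
  have key : ∀ (Q : OLattice 𝕜 n) (hQ : N ≤ g • Q) (hQ' : g⁻¹ • N ≤ Q),
      factor h h' N (g • Q) hQ = factor (g⁻¹ • h) (g⁻¹ • h') (g⁻¹ • N) Q hQ' := by
    intro Q hQ hQ'
    rw [factor_smul]
    congr 1
    all_goals simp
  rw [key L hL hL', key M hM hM']
  exact hr (g⁻¹ • h) (g⁻¹ • h') (g⁻¹ • N) hL' hM'

theorem nonempty (L M : OLattice 𝕜 n) : (RelHaar L M).Nonempty := by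
  by_cases hne : Nonempty (HaarTheory 𝕜 n)
  · obtain ⟨h₀⟩ := hne
    obtain ⟨N, hL, hM⟩ := L.exists_le_le M
    refine ⟨fun h => ⟨(factor h₀ h N L hL : ℝ) / factor h₀ h N M hM,
      div_pos (factor_pos _ _ _ _ _) (factor_pos _ _ _ _ _)⟩, of_exists ⟨N, hL, hM, ?_⟩⟩
    intro h h'
    have p1 : (0 : ℝ) < factor h₀ h N M hM := factor_pos _ _ _ _ _
    have p2 : (0 : ℝ) < factor h h' N M hM := factor_pos _ _ _ _ _
    change (factor h₀ h' N L hL : ℝ) / factor h₀ h' N M hM * _ =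
      (factor h₀ h N L hL : ℝ) / factor h₀ h N M hM * _
    rw [factor_trans h₀ h h' N L hL, factor_trans h₀ h h' N M hM]
    push_cast
    field_simp
  · exact ⟨1, fun h => (hne ⟨h⟩).elim⟩

end RelHaar

variable (𝕜 n) in
/-- The group `GL_n(K)~` of all pairs `(g, r)` with `g ∈ GL_n(K)` and `r ∈ μ(O^n | g O^n)`, with the
product `(g₁, r₁) (g₂, r₂) = (g₁ g₂, r₁ ⊗ g₁(r₂))`. The second component is written first here, and
`GL_n(K)` acts on the functions on Haar theories by `(g(r))(h) = r(g⁻¹ h)`. -/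
noncomputable def GLTilde : Subgroup ((HaarTheory 𝕜 n → PosReal) ⋊[mulAutArrow]
    Matrix.GeneralLinearGroup (Fin n) (LaurentSeries 𝕜)) where
  carrier := {x | x.left ∈ RelHaar (stdLattice 𝕜 n) (x.right • stdLattice 𝕜 n)}
  one_mem' := by
    change (1 : HaarTheory 𝕜 n → PosReal) ∈ RelHaar _ ((1 : Matrix.GeneralLinearGroup _ _) • _)
    rw [one_smul]
    exact RelHaar.one_mem
  mul_mem' := by
    intro x y hx hy
    have := RelHaar.mul_mem hx (RelHaar.smul_mem x.right hy)
    rwa [← mul_smul] at this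
  inv_mem' := by
    intro x hx
    have := RelHaar.smul_mem x.right⁻¹ (RelHaar.inv_mem hx)
    rwa [inv_smul_smul] at this

variable (𝕜 n) in
/-- The projection `θ : GL_n(K)~ → GL_n(K)`. -/
noncomputable def glTildeProj :
    GLTilde 𝕜 n →* Matrix.GeneralLinearGroup (Fin n) (LaurentSeries 𝕜) :=
  SemidirectProduct.rightHom.comp (GLTilde 𝕜 n).subtype

theorem mem_GLTilde {x : (HaarTheory 𝕜 n → PosReal) ⋊[mulAutArrow]
    Matrix.GeneralLinearGroup (Fin n) (LaurentSeries 𝕜)} : x ∈ GLTilde 𝕜 n ↔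
      x.left ∈ RelHaar (stdLattice 𝕜 n) (x.right • stdLattice 𝕜 n) := Iff.rfl

theorem glTildeProj_surjective : Function.Surjective (glTildeProj 𝕜 n) := by
  intro g
  obtain ⟨r, hr⟩ := RelHaar.nonempty (stdLattice 𝕜 n) (g • stdLattice 𝕜 n)
  exact ⟨⟨⟨r, g⟩, hr⟩, rfl⟩

variable (𝕜 n) in
/-- The inclusion of `ℝ_+^*` into `GL_n(K)~`, which sends `c` to `c ∈ ℝ_+^* = μ(O^n | O^n)` (the
constant function `c`). -/
noncomputable def glTildeIncl : PosReal →* GLTilde 𝕜 n where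
  toFun c := ⟨⟨fun _ => c, 1⟩, by
    rw [mem_GLTilde, one_smul]
    exact RelHaar.const_mem c⟩
  map_one' := rfl
  map_mul' c d := Subtype.ext (SemidirectProduct.ext (by rw [Subgroup.coe_mul]; rfl)
    (one_mul 1).symm)

/-- The kernel of `θ` is central. -/
theorem glTilde_ker_comm (z x : GLTilde 𝕜 n) (hz : glTildeProj 𝕜 n z = 1) : z * x = x * z := by
  obtain ⟨⟨r, g⟩, hr⟩ := z
  obtain ⟨⟨r', g'⟩, hr'⟩ := x
  change g = 1 at hz
  subst hz
  rw [mem_GLTilde, one_smul] at hr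
  have hconst : ∀ h h', r h = r h' := fun h h' => by
    have e := hr h h' (stdLattice 𝕜 n) le_rfl le_rfl
    have p : (0 : ℝ) < factor h h' (stdLattice 𝕜 n) (stdLattice 𝕜 n) le_rfl :=
      factor_pos _ _ _ _ _
    exact Subtype.ext (mul_right_cancel₀ p.ne' e).symm
  refine Subtype.ext (SemidirectProduct.ext ?_ ?_)
  · ext1 h
    change r h * r' ((1 : Matrix.GeneralLinearGroup _ _)⁻¹ • h) = r' h * r (g'⁻¹ • h)
    rw [inv_one, one_smul, hconst h (g'⁻¹ • h), mul_comm]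
  · exact (one_mul g').trans (mul_one g').symm

variable (𝕜)

/-- The group `θ⁻¹(SL_2(K))`. -/
noncomputable abbrev SLPreimage : Subgroup (GLTilde 𝕜 2) :=
  (SLTwo (LaurentSeries 𝕜)).comap (glTildeProj 𝕜 2)

/-- The action of `GL_2(K)~` on `θ⁻¹(SL_2(K))` by conjugation. -/
noncomputable def slPreimageConj : GLTilde 𝕜 2 →* MulAut (SLPreimage 𝕜) :=
  restrictAction MulAut.conj (SLPreimage 𝕜) fun d x hx =>
    ((MonoidHom.normal_ker Matrix.GeneralLinearGroup.det).comap (glTildeProj 𝕜 2)).conj_mem x hx d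

/-- The action of `K^*` on `θ⁻¹(SL_2(K))`: the element `y` acts as the conjugation by any lift of
`diag(y, 1)` to `GL_2(K)~`. -/
noncomputable def slPreimageAct : (LaurentSeries 𝕜)ˣ →* MulAut (SLPreimage 𝕜) :=
  ((glTildeProj 𝕜 2).liftOfSurjective glTildeProj_surjective ⟨slPreimageConj 𝕜, fun z hz =>
    MulEquiv.ext fun x => Subtype.ext (by
      change z * x.1 * z⁻¹ = x.1
      rw [glTilde_ker_comm z x.1 hz, mul_inv_cancel_right])⟩).comp (cornerGL (LaurentSeries 𝕜))

theorem slPreimageAct_apply (y : (LaurentSeries 𝕜)ˣ) (d : GLTilde 𝕜 2)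
    (hd : glTildeProj 𝕜 2 d = cornerGL (LaurentSeries 𝕜) y) (x : SLPreimage 𝕜) :
    (slPreimageAct 𝕜 y x : GLTilde 𝕜 2) = d * x * d⁻¹ := by
  have : slPreimageAct 𝕜 y = slPreimageConj 𝕜 d := by
    rw [slPreimageAct, MonoidHom.comp_apply, ← hd]
    exact (glTildeProj 𝕜 2).liftOfRightInverse_comp_apply _ _ _ d
  rw [this]
  rfl

/-- The group `θ⁻¹(SL_2(K)) ⋊ K^*`, i.e. the central extension of `GL_2(K)` by `ℝ_+^*` which splits
over the subgroup `K^*`. -/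
abbrev GLHatReal : Type := SLPreimage 𝕜 ⋊[slPreimageAct 𝕜] (LaurentSeries 𝕜)ˣ

/-- The projection to `GL_2(K)`, `(x, y) ↦ θ(x) diag(y, 1)`. -/
noncomputable def glHatRealProj :
    GLHatReal 𝕜 →* Matrix.GeneralLinearGroup (Fin 2) (LaurentSeries 𝕜) :=
  semidirectToGL ((glTildeProj 𝕜 2).comp (SLPreimage 𝕜).subtype) (slPreimageAct 𝕜) fun y x => by
    obtain ⟨d, hd⟩ := glTildeProj_surjective (cornerGL (LaurentSeries 𝕜) y)
    change glTildeProj 𝕜 2 (slPreimageAct 𝕜 y x) = _ * glTildeProj 𝕜 2 x * _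
    rw [slPreimageAct_apply 𝕜 y d hd, map_mul, map_mul, map_inv, hd]

/-- The inclusion of `ℝ_+^*`. -/
noncomputable def glHatRealIncl : PosReal →* GLHatReal 𝕜 :=
  SemidirectProduct.inl.comp ((glTildeIncl 𝕜 2).codRestrict (SLPreimage 𝕜) fun _ =>
    (map_one _ : Matrix.GeneralLinearGroup.det
      (1 : Matrix.GeneralLinearGroup (Fin 2) (LaurentSeries 𝕜)) = 1))

end Haar

/-- The residue in `𝕜` of `f^ν(g) / g^ν(f)` (the tame symbol of `f`, `g` without the sign), for
`f, g ∈ 𝕜((t))^*`. The valuation `ν` is the order of a Laurent series, and the residue of a series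
of order `0` is its constant coefficient. -/
noncomputable def unsignedTame {𝕜 : Type} [Field 𝕜] (f g : (LaurentSeries 𝕜)ˣ) : 𝕜 :=
  ((f : LaurentSeries 𝕜) ^ (g : LaurentSeries 𝕜).order /
    (g : LaurentSeries 𝕜) ^ (f : LaurentSeries 𝕜).order).coeff 0

/-!
The proof compares the two extensions after stabilization. The groups `GL_n(K)~` of pairs `(g, m)`
with `m ∈ μ(O^n | g O^n)` form a direct system (a Haar theory on `K^m` restricts to one on `K^n` by
means of the lattices `L ⊕ O^(m-n)`), and their direct limit `GLTildeInf` is a central extension by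
`ℝ_+^*` of the group of the automorphisms of `K^(ℕ)` that come from some `GL_n(K)`.

An element `g` that stabilizes a lattice `L` has a canonical lift to `GL_n(K)~`, namely `ρ ⊗ g(ρ)⁻¹`
for any `ρ ∈ μ(O^n | L)`, and this is multiplicative on the stabilizer of `L`. If `g` is unipotent,
it preserves the Haar measures on all quotients of lattices which it stabilizes, and so its canonical
lift does not depend on `L` (`canonLift_eq_of_unipotent`). Since the elementary matrices which occur
in a given Steinberg relation stabilize a common lattice of the form `⨁ t^(w_k) O`, their canonical
lifts satisfy the Steinberg relations. This gives a homomorphism `stLift` from `St(K)` to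
`GLTildeInf` over the group of automorphisms of `K^(ℕ)`. It is compatible with the actions of `K^*`
because the conjugate of a canonical lift is a canonical lift (`conj_canonLift`), and hence it induces
the homomorphism of extensions of `GL_2(K)`; its restriction to `K_2(K)` is `kTwoToReal`.

The image of the symbol `(f, g)` is the commutator in `GL_3(K)~` of lifts of `diag(f, f⁻¹, 1)` and
`diag(g, 1, g⁻¹)`. Commutators of lifts of diagonal matrices are bimultiplicative, so that one only
has to consider units and the uniformizer `t` (`entryComm_eq`). The matrices with units as entries all
stabilize `O^n`, the commutator for `t` and `t` in any two places is antisymmetric and symmetric, hence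
trivial, and a unit `u` and `t` give the factor by which `u` changes the Haar measures on
`O^n / (O ⊕ … ⊕ tO ⊕ … ⊕ O)` (`diagComm_eq_factor`). This is the modulus of the residue of `u` if the
two places coincide, and `1` otherwise.

That `K_2(K)` is central in `St(K)` is Steinberg's argument with the column and the row group
(`kTwo_comm`). The extension by `ℝ_+^*` is faithful because Haar theories exist
(`nonempty_haarTheory`).
-/

/-! ### The Steinberg extension is central -/

section SteinbergCentral

open scoped commutatorElement

variable {K : Type*} [Field K]

theorem stX_zero (i j : ℕ) (h : i ≠ j) : stX i j h (0 : K) = 1 := by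
  have := stX_add i j h (0 : K) 0
  rw [add_zero] at this
  exact mul_eq_left.mp this

theorem stX_inv (i j : ℕ) (h : i ≠ j) (a : K) : (stX i j h a)⁻¹ = stX i j h (-a) := by
  rw [inv_eq_iff_mul_eq_one, stX_add, add_neg_cancel, stX_zero]

/-- The subgroup of `St(K)` generated by the `x_ij(a)` with `i, j < N`. -/
def stLT (K : Type*) [Field K] (N : ℕ) : Subgroup (SteinbergGroup K) :=
  Subgroup.closure {s | ∃ i j h a, i < N ∧ j < N ∧ s = stX i j h a}

theorem stX_mem_stLT {N i j : ℕ} (h : i ≠ j) (a : K) (hi : i < N) (hj : j < N) :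
    stX i j h a ∈ stLT K N :=
  Subgroup.subset_closure ⟨i, j, h, a, hi, hj, rfl⟩

theorem stLT_mono {M N : ℕ} (h : M ≤ N) : stLT K M ≤ stLT K N := by
  refine Subgroup.closure_mono ?_
  rintro _ ⟨i, j, hij, a, hi, hj, rfl⟩
  exact ⟨i, j, hij, a, hi.trans_le h, hj.trans_le h, rfl⟩

/-- An induction principle: a property of elements of `stLT K N` may be checked on the generators
if it is stable under products, since the inverses of generators are generators. -/
theorem stLT_induction {N : ℕ} {p : (s : SteinbergGroup K) → s ∈ stLT K N → Prop}
    (one : p 1 (one_mem _))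
    (mul : ∀ s s' hs hs', p s hs → p s' hs' → p (s * s') (mul_mem hs hs'))
    (gen : ∀ i j h a (hi : i < N) (hj : j < N), p (stX i j h a) (stX_mem_stLT h a hi hj))
    {s : SteinbergGroup K} (hs : s ∈ stLT K N) : p s hs := by
  have H : s ∈ Submonoid.closure ({s | ∃ i j h a, i < N ∧ j < N ∧ s = stX i j h a} ∪
      {s : SteinbergGroup K | ∃ i j h a, i < N ∧ j < N ∧ s = stX i j h a}⁻¹) := by
    rwa [← Subgroup.closure_toSubmonoid]
  suffices ∃ hs, p s hs from this.2
  clear hs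
  induction H using Submonoid.closure_induction with
  | mem x hx =>
    rcases hx with ⟨i, j, h, a, hi, hj, rfl⟩ | ⟨i, j, h, a, hi, hj, e⟩
    · exact ⟨_, gen i j h a hi hj⟩
    · rw [inv_eq_iff_eq_inv, stX_inv] at e
      exact e ▸ ⟨_, gen i j h _ hi hj⟩
  | one => exact ⟨_, one⟩
  | mul x y _ _ h1 h2 =>
    obtain ⟨_, h1⟩ := h1
    obtain ⟨_, h2⟩ := h2
    exact ⟨_, mul _ _ _ _ h1 h2⟩

theorem SteinbergGroup.induction {p : SteinbergGroup K → Prop} (one : p 1)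
    (mul : ∀ s s', p s → p s' → p (s * s')) (inv : ∀ s, p s → p s⁻¹)
    (gen : ∀ i j h a, p (stX i j h a)) (s : SteinbergGroup K) : p s := by
  have H : s ∈ Subgroup.closure (Set.range (PresentedGroup.of (rels := {r | SteinbergRel K r}))) := by
    rw [PresentedGroup.closure_range_of]
    trivial
  induction H using Subgroup.closure_induction with
  | mem x hx =>
    obtain ⟨⟨i, j, h, a⟩, rfl⟩ := hx
    exact gen i j h a
  | one => exact one
  | mul x y _ _ h1 h2 => exact mul _ _ h1 h2
  | inv x _ h1 => exact inv _ h1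

theorem exists_mem_stLT (s : SteinbergGroup K) : ∃ N, s ∈ stLT K N := by
  induction s using SteinbergGroup.induction with
  | one => exact ⟨0, one_mem _⟩
  | mul s s' h h' =>
    obtain ⟨N, h⟩ := h
    obtain ⟨N', h'⟩ := h'
    exact ⟨max N N', mul_mem (stLT_mono (le_max_left _ _) h) (stLT_mono (le_max_right _ _) h')⟩
  | inv s h =>
    obtain ⟨N, h⟩ := h
    exact ⟨N, inv_mem h⟩
  | gen i j h a => exact ⟨max i j + 1, stX_mem_stLT h a (by omega) (by omega)⟩

/-- The homomorphism `a ↦ x_ij(a)`. -/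
def stXHom (i j : ℕ) (h : i ≠ j) : Multiplicative K →* SteinbergGroup K where
  toFun a := stX i j h a.toAdd
  map_one' := stX_zero i j h
  map_mul' a b := (stX_add i j h a.toAdd b.toAdd).symm

theorem stX_mul_comm (i j k l : ℕ) (hij : i ≠ j) (hkl : k ≠ l) (hjk : j ≠ k) (hil : i ≠ l)
    (a b : K) : stX i j hij a * stX k l hkl b = stX k l hkl b * stX i j hij a :=
  commutatorElement_eq_one_iff_mul_comm.mp (stX_commute i j k l hij hkl hjk hil a b)

/-- The homomorphism `v ↦ ∏_i x_iN(v_i)` from `K^N` to `St(K)`. -/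
def stCol (N : ℕ) : (Fin N → Multiplicative K) →* SteinbergGroup K :=
  MonoidHom.noncommPiCoprod (fun i : Fin N => stXHom (i : ℕ) N i.2.ne) fun i j _ _ _ =>
    stX_mul_comm _ _ _ _ _ _ j.2.ne' i.2.ne _ _

/-- The homomorphism `v ↦ ∏_j x_Nj(v_j)` from `K^N` to `St(K)`. -/
def stRow (N : ℕ) : (Fin N → Multiplicative K) →* SteinbergGroup K :=
  MonoidHom.noncommPiCoprod (fun i : Fin N => stXHom N (i : ℕ) i.2.ne') fun i j _ _ _ =>
    stX_mul_comm _ _ _ _ _ _ i.2.ne j.2.ne' _ _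

theorem stCol_mulSingle (N : ℕ) (i : Fin N) (a : Multiplicative K) :
    stCol N (Pi.mulSingle i a) = stX i N i.2.ne a.toAdd :=
  MonoidHom.noncommPiCoprod_mulSingle _ _ _

theorem stRow_mulSingle (N : ℕ) (i : Fin N) (a : Multiplicative K) :
    stRow N (Pi.mulSingle i a) = stX N i i.2.ne' a.toAdd :=
  MonoidHom.noncommPiCoprod_mulSingle _ _ _

/-- The homomorphism `v ↦ c v_j e_i`. -/
def shiftHom {N : ℕ} (i j : Fin N) (c : K) :
    (Fin N → Multiplicative K) →* (Fin N → Multiplicative K) :=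
  (MonoidHom.mulSingle (fun _ => Multiplicative K) i).comp
    ((AddMonoidHom.mulLeft c).toMultiplicative.comp (Pi.evalMonoidHom _ j))

theorem shiftHom_apply {N : ℕ} (i j : Fin N) (c : K) (v : Fin N → Multiplicative K) :
    shiftHom i j c v = Pi.mulSingle i (Multiplicative.ofAdd (c * (v j).toAdd)) := rfl

/-- The vector of `K^N` underlying an element of the multiplicatively written group `K^N`. -/
def toVec {N : ℕ} (v : Fin N → Multiplicative K) : Fin N → K := fun i => (v i).toAdd

theorem toVec_injective {R : Type*} {N : ℕ} : Function.Injective (toVec (K := R) (N := N)) := fun _ _ h => h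

theorem toVec_mul_shiftHom {N : ℕ} (i j : Fin N) (c : K) (v : Fin N → Multiplicative K) :
    toVec (v * shiftHom i j c v) = toVec v + Pi.single i (c * toVec v j) := rfl

/-- `x_ij(a)` acts on the column group as the matrix `1 + a E_ij`. -/
theorem conj_stCol {N : ℕ} (i j : Fin N) (h : (i : ℕ) ≠ j) (a : K) (v : Fin N → Multiplicative K) :
    stX i j h a * stCol N v * (stX i j h a)⁻¹ = stCol N (v * shiftHom i j a v) := by
  have : (MulAut.conj (stX (i : ℕ) j h a)).toMonoidHom.comp (stCol N) =
      (stCol N).comp (MonoidHom.id _ * shiftHom i j a) := by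
    refine MonoidHom.pi_ext fun l b => ?_
    simp only [MonoidHom.comp_apply, MulEquiv.coe_toMonoidHom, MulAut.conj_apply,
      MonoidHom.mul_apply, MonoidHom.id_apply, map_mul, shiftHom_apply, stCol_mulSingle, toAdd_ofAdd]
    rw [mul_inv_eq_iff_eq_mul]
    by_cases hl : j = l
    · subst hl
      rw [Pi.mulSingle_eq_same,
        stX_mul_comm _ _ _ _ j.2.ne i.2.ne i.2.ne' j.2.ne b.toAdd (a * b.toAdd),
        ← stX_comm (i : ℕ) j N h j.2.ne i.2.ne a b.toAdd, commutatorElement_def]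
      group
    · rw [Pi.mulSingle_eq_of_ne hl, toAdd_one, mul_zero, stX_zero, mul_one]
      exact stX_mul_comm _ _ _ _ _ _ (fun e => hl (Fin.ext e)) i.2.ne _ _
  exact DFunLike.congr_fun this v

/-- `x_ij(a)` acts on the row group as the transpose of the matrix `1 - a E_ij`. -/
theorem conj_stRow {N : ℕ} (i j : Fin N) (h : (i : ℕ) ≠ j) (a : K) (v : Fin N → Multiplicative K) :
    stX i j h a * stRow N v * (stX i j h a)⁻¹ = stRow N (v * shiftHom j i (-a) v) := by
  have : (MulAut.conj (stX (i : ℕ) j h a)).toMonoidHom.comp (stRow N) =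
      (stRow N).comp (MonoidHom.id _ * shiftHom j i (-a)) := by
    refine MonoidHom.pi_ext fun l b => ?_
    simp only [MonoidHom.comp_apply, MulEquiv.coe_toMonoidHom, MulAut.conj_apply,
      MonoidHom.mul_apply, MonoidHom.id_apply, map_mul, shiftHom_apply, stRow_mulSingle, toAdd_ofAdd]
    rw [mul_inv_eq_iff_eq_mul]
    by_cases hl : i = l
    · subst hl
      rw [Pi.mulSingle_eq_same,
        stX_mul_comm _ _ _ _ i.2.ne' j.2.ne' i.2.ne j.2.ne' b.toAdd (-a * b.toAdd),
        neg_mul, ← stX_inv, mul_comm a,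
        ← stX_comm N i (j : ℕ) i.2.ne' h j.2.ne' b.toAdd a, commutatorElement_def]
      group
    · rw [Pi.mulSingle_eq_of_ne hl, toAdd_one, mul_zero, stX_zero, mul_one]
      exact stX_mul_comm _ _ _ _ _ _ j.2.ne (fun e => hl (Fin.ext e)) _ _
  exact DFunLike.congr_fun this v

/-- The linear functional on `K^(ℕ)` with coefficients `v`. -/
noncomputable def rowFun {N : ℕ} (v : Fin N → K) : (ℕ →₀ K) →ₗ[K] K :=
  ∑ i : Fin N, v i • Finsupp.lapply (i : ℕ)

theorem rowFun_injective {N : ℕ} : Function.Injective (rowFun (K := K) (N := N)) := by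
  intro v w h
  ext i
  have := LinearMap.congr_fun h (Finsupp.single (i : ℕ) 1)
  simpa [rowFun, Finsupp.single_apply, Fin.val_inj] using this

theorem finIncl_injective (n : ℕ) : Function.Injective (finIncl (K := K) n) :=
  Function.LeftInverse.injective (finProj_finIncl n)

theorem finIncl_apply_val {n : ℕ} (v : Fin n → K) (i : Fin n) : finIncl n v (i : ℕ) = v i :=
  congrFun (finProj_finIncl n v) i

theorem finIncl_single (n : ℕ) (i : Fin n) (a : K) :
    finIncl n (Pi.single i a) = Finsupp.single (i : ℕ) a := by
  rw [finIncl, LinearMap.sum_apply, Finset.sum_eq_single i]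
  · simp
  · intro j _ hj
    simp [hj]
  · simp

/-- An element of `stLT K N` acts on the column group as its image in `SL(K)` acts on `K^N`. -/
theorem conj_stCol_of_mem {N : ℕ} {s : SteinbergGroup K} (hs : s ∈ stLT K N)
    (v : Fin N → Multiplicative K) : ∃ w, s * stCol N v * s⁻¹ = stCol N w ∧
      finIncl N (toVec w) = (stToGL K s : Module.End K (ℕ →₀ K)) (finIncl N (toVec v)) := by
  induction hs using stLT_induction generalizing v with
  | one => exact ⟨v, by simp, by simp⟩
  | mul s s' _ _ h h' =>
    obtain ⟨w, h1, h2⟩ := h' v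
    obtain ⟨w', h3, h4⟩ := h w
    refine ⟨w', ?_, ?_⟩
    · rw [← h3, ← h1]
      group
    · rw [h4, h2, map_mul]
      rfl
  | gen i j h a hi hj =>
    refine ⟨_, conj_stCol ⟨i, hi⟩ ⟨j, hj⟩ h a v, ?_⟩
    rw [stToGL_stX, elemInf_val]
    rw [toVec_mul_shiftHom, map_add, finIncl_single]
    have hv := finIncl_apply_val (toVec v) ⟨j, hj⟩
    simp only [LinearMap.add_apply, Module.End.one_apply, LinearMap.smul_apply, matUnit,
      LinearMap.comp_apply, Finsupp.lapply_apply, Finsupp.lsingle_apply, Finsupp.smul_single,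
      smul_eq_mul]
    exact congrArg (fun z => finIncl N (toVec v) + Finsupp.single i (a * z)) hv.symm

/-- An element of `stLT K N` acts on the row group as the inverse of its image in `SL(K)` acts on
linear functionals. -/
theorem conj_stRow_of_mem {N : ℕ} {s : SteinbergGroup K} (hs : s ∈ stLT K N)
    (v : Fin N → Multiplicative K) : ∃ w, s * stRow N v * s⁻¹ = stRow N w ∧
      rowFun (toVec w) ∘ₗ (stToGL K s : Module.End K (ℕ →₀ K)) = rowFun (toVec v) := by
  induction hs using stLT_induction generalizing v with
  | one => exact ⟨v, by simp, by ext; simp⟩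
  | mul s s' _ _ h h' =>
    obtain ⟨w, h1, h2⟩ := h' v
    obtain ⟨w', h3, h4⟩ := h w
    refine ⟨w', ?_, ?_⟩
    · rw [← h3, ← h1]
      group
    · rw [← h2, ← h4, map_mul]
      rfl
  | gen i j h a hi hj =>
    refine ⟨_, conj_stRow ⟨i, hi⟩ ⟨j, hj⟩ h a v, ?_⟩
    rw [stToGL_stX, elemInf_val]
    have hadd : ∀ v w : Fin N → K, rowFun (v + w) = rowFun v + rowFun w := fun v w => by
      simp [rowFun, add_smul, Finset.sum_add_distrib]
    have hsing : ∀ (l : Fin N) (c : K), rowFun (Pi.single l c) = c • Finsupp.lapply (l : ℕ) :=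
      fun l c => by
        rw [rowFun, Finset.sum_eq_single l]
        · simp
        · intro m _ hm
          simp [hm]
        · simp
    rw [toVec_mul_shiftHom, hadd, hsing]
    have hv : ∀ c : K, rowFun (toVec v) (Finsupp.single i c) = toVec v ⟨i, hi⟩ * c := fun c => by
      rw [rowFun, LinearMap.sum_apply, Finset.sum_eq_single ⟨i, hi⟩]
      · simp
      · intro m _ hm
        have : i ≠ (m : ℕ) := fun e => hm (Fin.ext e.symm)
        simp [this]
      · simp
    refine LinearMap.ext fun f => ?_
    have hv' := hv (a * f j)
    simp only [LinearMap.comp_apply, LinearMap.add_apply, Module.End.one_apply,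
      LinearMap.smul_apply, matUnit, Finsupp.lapply_apply, Finsupp.lsingle_apply,
      Finsupp.smul_single, smul_eq_mul, map_add, hv',
      Finsupp.single_eq_of_ne (Ne.symm h)]
    ring

/-- `K_2(K)` is central in `St(K)`. An element `k` of `K_2(K)` which is a product of generators with
indices less than `N` commutes with the `x_iN(a)` and `x_Nj(a)`, since it acts trivially on the
column and on the row group; hence it commutes with their commutators `x_ij(a)`. -/
theorem kTwo_comm {k : SteinbergGroup K} (hk : k ∈ KTwo K) (s : SteinbergGroup K) :
    k * s = s * k := by
  obtain ⟨N₀, hN₀⟩ := exists_mem_stLT k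
  have key : ∀ N, N₀ ≤ N → ∀ i < N, ∀ (h : i ≠ N) (a : K),
      Commute k (stX i N h a) ∧ Commute k (stX N i h.symm a) := by
    intro N hN i hi h a
    have hkN := stLT_mono hN hN₀
    constructor
    · obtain ⟨w, h1, h2⟩ := conj_stCol_of_mem hkN (Pi.mulSingle ⟨i, hi⟩ (Multiplicative.ofAdd a))
      rw [MonoidHom.mem_ker.mp hk, Units.val_one, Module.End.one_apply] at h2
      rw [toVec_injective (finIncl_injective N h2), stCol_mulSingle] at h1
      exact mul_inv_eq_iff_eq_mul.mp h1
    · obtain ⟨w, h1, h2⟩ := conj_stRow_of_mem hkN (Pi.mulSingle ⟨i, hi⟩ (Multiplicative.ofAdd a))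
      rw [MonoidHom.mem_ker.mp hk, Units.val_one] at h2
      rw [toVec_injective (rowFun_injective h2), stRow_mulSingle] at h1
      exact mul_inv_eq_iff_eq_mul.mp h1
  induction s using SteinbergGroup.induction with
  | one => simp
  | mul s s' h h' => exact Commute.mul_right h h'
  | inv s h => exact Commute.inv_right h
  | gen i j h a =>
    have hi : i < max N₀ (max i j + 1) := by omega
    have hj : j < max N₀ (max i j + 1) := by omega
    rw [← mul_one a, ← stX_comm i _ j hi.ne hj.ne' h a 1, commutatorElement_def]
    have h1 := (key _ (le_max_left _ _) i hi hi.ne a).1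
    have h2 := (key _ (le_max_left _ _) j hj hj.ne 1).2
    exact ((h1.mul_right h2).mul_right h1.inv_right).mul_right h2.inv_right

/-! ### The action of the torus on the Steinberg group -/

/-- Commutators do not change when the two elements are multiplied by central elements. -/
theorem commutatorElement_mul_central {G : Type*} [Group G] {p q c d : G}
    (hc : ∀ x, c * x = x * c) (hd : ∀ x, d * x = x * d) : ⁅p * c, q * d⁆ = ⁅p, q⁆ := by
  have hc' : ∀ x, Commute c x := hc
  have hd' : ∀ x, Commute d x := hd
  rw [commutatorElement_def, commutatorElement_def, mul_inv_rev, mul_inv_rev]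
  calc p * c * (q * d) * (c⁻¹ * p⁻¹) * (d⁻¹ * q⁻¹) =
      p * (c * (q * d)) * c⁻¹ * p⁻¹ * d⁻¹ * q⁻¹ := by group
    _ = p * q * (d * p⁻¹) * d⁻¹ * q⁻¹ := by rw [hc]; group
    _ = _ := by rw [hd]; group

/-- On the elements with indices less than `N`, the action of `y ∈ K^*` is the conjugation by
`h_0N(y)`: both lift the same conjugation in `SL(K)`, so they differ by a homomorphism to the central
subgroup `K_2(K)`, and this is trivial because the generators are commutators. -/
theorem stAct_eq_conj (y : Kˣ) {N : ℕ} (hN : 3 ≤ N) {s : SteinbergGroup K} (hs : s ∈ stLT K N) :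
    stAct y s = stH 0 N (by omega) y * s * (stH 0 N (by omega) y)⁻¹ := by
  have hN0 : 0 ≠ N := by omega
  have gen : ∀ i j (h : i ≠ j) a, i < N → j < N → ∃ c ∈ KTwo K,
      stH 0 N hN0 y * stX i j h a * (stH 0 N hN0 y)⁻¹ = stAct y (stX i j h a) * c := by
    intro i j h a hi hj
    refine ⟨(stAct y (stX i j h a))⁻¹ * (stH 0 N hN0 y * stX i j h a * (stH 0 N hN0 y)⁻¹), ?_,
      by group⟩
    have e := stActHom_stX y i j h a
    change stAct y (stX i j h a) = _ at e
    rw [MonoidHom.mem_ker, map_mul, map_inv, inv_mul_eq_one, e, map_mul, map_mul, map_inv,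
      stToGL_stX, stToGL_stX, (isDiagInf_stH 0 N hN0 y).conj_elemInf]
    have hw : ∀ l < N, cornerWeight y l = if l = 0 then y else if l = N then y⁻¹ else 1 := by
      intro l hl
      rw [if_neg hl.ne]
      rfl
    rw [hw i hi, hw j hj]
  induction hs using stLT_induction with
  | one => simp
  | mul s s' _ _ h h' => rw [map_mul, h, h']; group
  | gen i j h a hi hj =>
    -- `3 ≤ N` leaves an index `l` which is different from `i` and `j`, so that `x_ij(a)` is the
    -- commutator of `x_il(a)` and `x_lj(1)`.
    obtain ⟨l, hl, hil, hlj⟩ : ∃ l < N, i ≠ l ∧ l ≠ j := by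
      by_contra! H
      have h0 := H 0 (by omega)
      have h1 := H 1 (by omega)
      have h2 := H 2 (by omega)
      omega
    obtain ⟨c, hc, e1⟩ := gen i l hil a hi hl
    obtain ⟨d, hd, e2⟩ := gen l j hlj 1 hl hj
    have e3 : ∀ x z : SteinbergGroup K, stH 0 N hN0 y * ⁅x, z⁆ * (stH 0 N hN0 y)⁻¹ =
        ⁅stH 0 N hN0 y * x * (stH 0 N hN0 y)⁻¹, stH 0 N hN0 y * z * (stH 0 N hN0 y)⁻¹⁆ :=
      fun x z => map_commutatorElement (MulAut.conj (stH 0 N hN0 y)) x z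
    rw [← mul_one a, ← stX_comm i l j hil hlj h a 1, map_commutatorElement, e3, e1, e2,
      commutatorElement_mul_central (kTwo_comm hc) (kTwo_comm hd)]

/-- `K^*` acts trivially on `K_2(K)`. -/
theorem stAct_kTwo (y : Kˣ) {k : SteinbergGroup K} (hk : k ∈ KTwo K) : stAct y k = k := by
  obtain ⟨N, hN⟩ := exists_mem_stLT k
  rw [stAct_eq_conj y (le_max_left 3 N) (stLT_mono (le_max_right 3 N) hN), ← kTwo_comm hk,
    mul_inv_cancel_right]

/-! ### Elementary matrices and the extension of `GL_2(K)` by `K_2(K)` -/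

/-- The elementary matrix `1 + a E_ij` in `GL_n(K)`. -/
def elemGL {n : ℕ} (i j : Fin n) (h : i ≠ j) (a : K) : Matrix.GeneralLinearGroup (Fin n) K where
  val := Matrix.transvection i j a
  inv := Matrix.transvection i j (-a)
  val_inv := by rw [Matrix.transvection_mul_transvection_same _ _ h, add_neg_cancel,
    Matrix.transvection_zero]
  inv_val := by rw [Matrix.transvection_mul_transvection_same _ _ h, neg_add_cancel,
    Matrix.transvection_zero]

theorem matInf_apply (n : ℕ) (M : Matrix (Fin n) (Fin n) K) (f : ℕ →₀ K) :
    matInf n M f = f + finIncl n ((M - 1).mulVec (finProj n f)) := rfl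

theorem glInf_injective (n : ℕ) : Function.Injective (glInf (K := K) n) := by
  intro g g' h
  have h' : matInf n g.val = matInf n g'.val := congrArg Units.val h
  refine Units.ext (Matrix.mulVec_injective (funext fun v => ?_))
  have := LinearMap.congr_fun h' (finIncl n v)
  rw [matInf_apply, matInf_apply, add_right_inj, finProj_finIncl] at this
  have := finIncl_injective n this
  rwa [Matrix.sub_mulVec, Matrix.sub_mulVec, sub_left_inj] at this

theorem glInf_elemGL {n : ℕ} (i j : Fin n) (h : i ≠ j) (a : K) :
    glInf n (elemGL i j h a) = elemInf i j (fun e => h (Fin.ext e)) a := by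
  refine Units.ext (LinearMap.ext fun f => ?_)
  change matInf n (Matrix.transvection i j a) f = (1 + a • matUnit (i : ℕ) j : Module.End K _) f
  rw [matInf_apply, Matrix.transvection, add_sub_cancel_left]
  have : (Matrix.single i j a).mulVec (finProj n f) = Pi.single i (a * f j) := by
    ext l
    rw [Matrix.single_mulVec]
    rfl
  rw [this, finIncl_single]
  simp [matUnit]

/-- `SL_2(K)` is in the image of `St(K)`, since it is generated by elementary matrices. -/
theorem exists_stToGL_eq {A : Matrix.GeneralLinearGroup (Fin 2) K} (hA : A ∈ SLTwo K) :
    ∃ s, stToGL K s = glInf 2 A := by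
  suffices A ∈ (stToGL K).range.comap (glInf 2) from this
  set H := (stToGL K).range.comap (glInf 2) with hH
  have hel : ∀ i j h a, elemGL i j h a ∈ H := fun i j h a =>
    ⟨stX i j (fun e => h (Fin.ext e)) a, by rw [stToGL_stX, glInf_elemGL]⟩
  have hne : (0 : Fin 2) ≠ 1 := by decide
  -- If the lower left entry `c` of a matrix with entries `a, b, c, d` is not `0`, the matrix is the
  -- product of `1 + (a - 1) / c E_12`, `1 + c E_21` and `1 + (d - 1) / c E_12`.
  have main : ∀ B ∈ SLTwo K, B.val 1 0 ≠ 0 → B ∈ H := by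
    intro B hB hc
    have hdet : B.val 0 0 * B.val 1 1 - B.val 0 1 * B.val 1 0 = 1 := by
      rw [← Matrix.det_fin_two]
      exact congrArg Units.val (MonoidHom.mem_ker.mp hB)
    have : B = elemGL 0 1 hne ((B.val 0 0 - 1) / B.val 1 0) * elemGL 1 0 hne.symm (B.val 1 0) *
        elemGL 0 1 hne ((B.val 1 1 - 1) / B.val 1 0) := by
      refine Units.ext ?_
      change B.val = Matrix.transvection _ _ _ * Matrix.transvection _ _ _ *
        Matrix.transvection _ _ _
      ext i j
      fin_cases i <;> fin_cases j <;>
        simp [Matrix.transvection, Matrix.mul_apply, Fin.sum_univ_two, Matrix.single] <;>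
        field_simp
      all_goals first | ring1 | linear_combination hdet | linear_combination -hdet
    rw [this]
    exact mul_mem (mul_mem (hel _ _ _ _) (hel _ _ _ _)) (hel _ _ _ _)
  by_cases hc : A.val 1 0 = 0
  -- Otherwise the upper left entry is not `0`, and one adds the first row to the second one.
  · have hdet : A.val 0 0 * A.val 1 1 - A.val 0 1 * A.val 1 0 = 1 := by
      rw [← Matrix.det_fin_two]
      exact congrArg Units.val (MonoidHom.mem_ker.mp hA)
    have hel' : elemGL 1 0 hne.symm (1 : K) ∈ SLTwo K := by
      refine MonoidHom.mem_ker.mpr (Units.ext ?_)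
      exact Matrix.det_transvection_of_ne _ _ hne.symm _
    rw [← H.mul_mem_cancel_left (hel 1 0 hne.symm 1)]
    refine main _ (mul_mem hel' hA) ?_
    change (Matrix.transvection (1 : Fin 2) 0 (1 : K) * A.val) 1 0 ≠ 0
    have : (Matrix.transvection (1 : Fin 2) 0 (1 : K) * A.val) 1 0 = A.val 0 0 := by
      simp [Matrix.transvection, Matrix.mul_apply, Fin.sum_univ_two, Matrix.single, hc]
    rw [this]
    intro h0
    rw [h0, hc] at hdet
    simp at hdet
  · exact main A hA hc

theorem det_cornerGL (y : Kˣ) : Matrix.GeneralLinearGroup.det (cornerGL K y) = y := by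
  refine Units.ext ?_
  change Matrix.det !![(y : K), 0; 0, 1] = y
  simp [Matrix.det_fin_two]

/-- `GL_2(K)^` is a central extension of `GL_2(K)` by `K_2(K)`. -/
theorem isCentralExtension_glHat (K : Type*) [Field K] :
    IsCentralExtension (glHatIncl K) (glHatProj K) where
  injective a b h := Subtype.ext (congrArg (fun x : GLHat K => x.left.1.1) h)
  exact := by
    ext ⟨⟨⟨s, A⟩, hA⟩, y⟩
    constructor
    · rintro ⟨k, hk⟩
      rw [← hk]
      change (1 : Matrix.GeneralLinearGroup (Fin 2) K) * cornerGL K 1 = 1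
      rw [map_one, mul_one]
    · intro h
      change A * cornerGL K y = 1 at h
      have hy : y = 1 := by
        have := congrArg Matrix.GeneralLinearGroup.det h
        rwa [map_mul, MonoidHom.mem_ker.mp (mem_SLTilde.mp hA).2, det_cornerGL, one_mul,
          map_one] at this
      subst hy
      rw [map_one, mul_one] at h
      subst h
      exact ⟨⟨s, by rw [MonoidHom.mem_ker, (mem_SLTilde.mp hA).1]; exact map_one _⟩, rfl⟩
  surjective g := by
    have hA : g * (cornerGL K (Matrix.GeneralLinearGroup.det g))⁻¹ ∈ SLTwo K := by
      rw [MonoidHom.mem_ker, map_mul, map_inv, det_cornerGL, mul_inv_cancel]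
    obtain ⟨s, hs⟩ := exists_stToGL_eq hA
    exact ⟨⟨⟨(s, _), mem_SLTilde.mpr ⟨hs, hA⟩⟩, Matrix.GeneralLinearGroup.det g⟩,
      inv_mul_cancel_right _ _⟩
  central := by
    rintro _ ⟨k, rfl⟩
    rw [Subgroup.mem_center_iff]
    rintro ⟨⟨⟨s, A⟩, hA⟩, y⟩
    refine SemidirectProduct.ext (Subtype.ext (Prod.ext ?_ ?_)) ((mul_one y).trans (one_mul y).symm)
    · change s * stAct y k = k * stAct 1 s
      rw [stAct_kTwo y k.2, map_one, ← kTwo_comm k.2]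
      rfl
    · change A * (cornerGL K y * 1 * (cornerGL K y)⁻¹) = 1 * (cornerGL K 1 * A * (cornerGL K 1)⁻¹)
      simp

end SteinbergCentral

/-! ### Existence of Haar theories -/

section HaarExistence

open MeasureTheory

/-- On a downward directed preorder, every `2`-cocycle with values in a constant group is a
coboundary. -/
theorem exists_cobound_of_cocycle {X : Type*} [Preorder X] (L₀ : X)
    (hdir : ∀ L M : X, ∃ N, N ≤ L ∧ N ≤ M) (c : X → X → X → ℝ)
    (hc : ∀ N L P Q, N ≤ L → L ≤ P → P ≤ Q → c N L P + c N P Q = c L P Q + c N L Q) :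
    ∃ b : X → X → ℝ, ∀ N L P, N ≤ L → L ≤ P → b N P = b N L + b L P + c N L P := by
  -- Each `c Q` is a cochain with coboundary `c`, but only on the elements above `Q`. The terms `u Q L`
  -- compensate for the dependence on `Q`, so that the corrected cochains fit together.
  choose n hnL hn₀ using fun L => hdir L L₀
  let u : X → X → ℝ := fun Q L => c Q (n L) L - c Q (n L) L₀
  -- The dependence of `u Q L` on `Q`.
  have hu : ∀ Q' Q L, Q' ≤ Q → Q ≤ n L → u Q' L - u Q L = c Q' Q L - c Q' Q L₀ := by
    intro Q' Q L h h'
    have e1 := hc Q' Q (n L) L h h' (hnL L)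
    have e2 := hc Q' Q (n L) L₀ h h' (hn₀ L)
    simp only [u]
    linarith
  have hind' : ∀ N L Q Q', N ≤ L → Q' ≤ Q → Q ≤ n N → Q ≤ n L →
      u Q L - u Q N - c Q N L = u Q' L - u Q' N - c Q' N L := by
    intro N L Q Q' hNL h hN hL
    have e1 := hu Q' Q L h hL
    have e2 := hu Q' Q N h hN
    have e3 := hc Q' Q N L h (hN.trans (hnL N)) hNL
    linarith
  have hind : ∀ N L Q Q', N ≤ L → Q ≤ n N → Q ≤ n L → Q' ≤ n N → Q' ≤ n L →
      u Q L - u Q N - c Q N L = u Q' L - u Q' N - c Q' N L := by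
    intro N L Q Q' hNL h1 h2 h3 h4
    obtain ⟨R, hR, hR'⟩ := hdir Q Q'
    rw [hind' N L Q R hNL hR h1 h2, hind' N L Q' R hNL hR' h3 h4]
  choose q hqN hqL using fun N L => hdir (n N) (n L)
  refine ⟨fun N L => u (q N L) L - u (q N L) N - c (q N L) N L, fun N L P hNL hLP => ?_⟩
  obtain ⟨Q, hQ1, hQP⟩ := hdir (q N L) (n P)
  have hQN := hQ1.trans (hqN N L)
  have hQL := hQ1.trans (hqL N L)
  beta_reduce
  rw [hind N P _ Q (hNL.trans hLP) (hqN N P) (hqL N P) hQN hQP,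
    hind N L _ Q hNL (hqN N L) (hqL N L) hQN hQL, hind L P _ Q hLP (hqN L P) (hqL L P) hQL hQP]
  have := hc Q N L P (hQN.trans (hnL N)) hNL hLP
  linarith

variable {𝕜 : Type} [RCLike 𝕜] {n : ℕ}

namespace SubQuot

theorem incl_injective {N L P : Submodule 𝕜 (Fin n → LaurentSeries 𝕜)} (h : L ≤ P) :
    Function.Injective (incl N h) := by
  rw [← LinearMap.ker_eq_bot, LinearMap.ker_eq_bot']
  intro x hx
  induction x using Submodule.Quotient.induction_on with
  | H x => exact (Submodule.Quotient.mk_eq_zero _).mpr ((Submodule.Quotient.mk_eq_zero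
      (N.submoduleOf P)).mp hx)

theorem proj_incl {N L P : Submodule 𝕜 (Fin n → LaurentSeries 𝕜)} (hNL : N ≤ L) (hLP : L ≤ P)
    (x : SubQuot N L) : proj hNL P (incl N hLP x) = 0 := by
  induction x using Submodule.Quotient.induction_on with
  | H x => exact (Submodule.Quotient.mk_eq_zero _).mpr x.2

theorem exists_incl_eq {N L P : Submodule 𝕜 (Fin n → LaurentSeries 𝕜)} (hNL : N ≤ L) (hLP : L ≤ P)
    {x : SubQuot N P} (hx : proj hNL P x = 0) : ∃ y, incl N hLP y = x := by
  induction x using Submodule.Quotient.induction_on with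
  | H x => exact ⟨Submodule.Quotient.mk ⟨x.1, (Submodule.Quotient.mk_eq_zero
      (L.submoduleOf P)).mp hx⟩, rfl⟩

/-- A linear map to `P / N` which vanishes in `P / L` factors through `L / N`. -/
theorem exists_comp_incl {N L P : Submodule 𝕜 (Fin n → LaurentSeries 𝕜)} (hNL : N ≤ L)
    (hLP : L ≤ P) {V : Type*} [AddCommGroup V] [Module 𝕜 V] (f : V →ₗ[𝕜] SubQuot N P)
    (hf : ∀ x, proj hNL P (f x) = 0) : ∃ g : V →ₗ[𝕜] SubQuot N L, ∀ x, incl N hLP (g x) = f x := by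
  choose g hg using fun x => exists_incl_eq hNL hLP (hf x)
  refine ⟨{ toFun := g, map_add' := fun x y => ?_, map_smul' := fun c x => ?_ }, hg⟩
  · apply incl_injective hLP
    rw [map_add, hg, hg, hg, map_add]
  · apply incl_injective hLP
    rw [hg, RingHom.id_apply, map_smul, map_smul, hg]

end SubQuot

namespace OLattice

variable {N L P Q : OLattice 𝕜 n}

theorem exists_section (hNL : N ≤ L) (P : OLattice 𝕜 n) :
    ∃ s : SubQuot L.1 P.1 →ₗ[𝕜] SubQuot N.1 P.1, SubQuot.proj hNL P.1 ∘ₗ s = LinearMap.id :=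
  (SubQuot.proj hNL P.1).exists_rightInverse_of_surjective
    (LinearMap.range_eq_top.2 (SubQuot.proj_surjective hNL P.1))

/-- The image of the product of measures on `L / N` and `P / L` under the isomorphism
`L / N × P / L ≅ P / N` which is given by a section `s`. -/
noncomputable def secMeas (hLP : L ≤ P) (s : SubQuot L.1 P.1 →ₗ[𝕜] SubQuot N.1 P.1)
    (α : Measure (SubQuot N.1 L.1)) (β : Measure (SubQuot L.1 P.1)) : Measure (SubQuot N.1 P.1) :=
  Measure.map (fun x => SubQuot.incl N.1 hLP x.1 + s x.2) (α.prod β)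

theorem secMeas_smul (hLP : L ≤ P) (s : SubQuot L.1 P.1 →ₗ[𝕜] SubQuot N.1 P.1)
    (α : Measure (SubQuot N.1 L.1)) (β : Measure (SubQuot L.1 P.1)) [SFinite α] [SFinite β]
    (a b : NNReal) : secMeas hLP s (a • α) (b • β) = (a * b) • secMeas hLP s α β := by
  rw [secMeas, Measure.prod_smul_left, Measure.prod_smul_right, Measure.map_smul,
    Measure.map_smul, smul_smul]
  rfl

/-- The product measure on `P / N` does not depend on the section. -/
theorem secMeas_eq (hNL : N ≤ L) (hLP : L ≤ P) (s s' : SubQuot L.1 P.1 →ₗ[𝕜] SubQuot N.1 P.1)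
    (hs : SubQuot.proj hNL P.1 ∘ₗ s = LinearMap.id)
    (hs' : SubQuot.proj hNL P.1 ∘ₗ s' = LinearMap.id) (α : Measure (SubQuot N.1 L.1))
    (β : Measure (SubQuot L.1 P.1)) [α.IsAddHaarMeasure] [β.IsAddHaarMeasure] :
    secMeas hLP s α β = secMeas hLP s' α β := by
  obtain ⟨T, hT⟩ := SubQuot.exists_comp_incl hNL hLP (s - s') fun x => by
    rw [LinearMap.sub_apply, map_sub]
    exact sub_eq_zero.mpr ((LinearMap.congr_fun hs x).trans (LinearMap.congr_fun hs' x).symm)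
  -- The two isomorphisms differ by the shear `(x, y) ↦ (x + T y, y)`, which preserves the measure.
  have hT' : Measurable T := SubQuot.measurable_of_linearMap T
  have shear : MeasurePreserving (fun p : SubQuot N.1 L.1 × SubQuot L.1 P.1 => (p.1 + T p.2, p.2))
      (α.prod β) (α.prod β) := by
    have h1 : MeasurePreserving (fun p : SubQuot L.1 P.1 × SubQuot N.1 L.1 => (p.1, p.2 + T p.1))
        (β.prod α) (β.prod α) :=
      (MeasurePreserving.id β).skew_product (g := fun y x => x + T y)
        (measurable_snd.add (hT'.comp measurable_fst))
        (Filter.Eventually.of_forall fun y => map_add_right_eq_self α (T y))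
    exact (Measure.measurePreserving_swap.comp h1).comp Measure.measurePreserving_swap
  rw [secMeas, secMeas]
  nth_rw 2 [← shear.map_eq]
  rw [Measure.map_map (measurable_add_section hLP s') shear.measurable]
  congr 1
  ext1 p
  simp only [Function.comp_apply, map_add, hT, LinearMap.sub_apply]
  abel

theorem isAddHaarMeasure_secMeas (hNL : N ≤ L) (hLP : L ≤ P)
    (s : SubQuot L.1 P.1 →ₗ[𝕜] SubQuot N.1 P.1)
    (hs : SubQuot.proj hNL P.1 ∘ₗ s = LinearMap.id) (α : Measure (SubQuot N.1 L.1))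
    (β : Measure (SubQuot L.1 P.1)) [α.IsAddHaarMeasure] [β.IsAddHaarMeasure] :
    (secMeas hLP s α β).IsAddHaarMeasure := by
  let f : (SubQuot N.1 L.1 × SubQuot L.1 P.1) →ₗ[𝕜] SubQuot N.1 P.1 :=
    (SubQuot.incl N.1 hLP).coprod s
  have hs' : ∀ y, SubQuot.proj hNL P.1 (s y) = y := LinearMap.congr_fun hs
  have hf : Function.Bijective f := by
    constructor
    · rw [← LinearMap.ker_eq_bot, LinearMap.ker_eq_bot']
      rintro ⟨x, y⟩ h
      have h' : SubQuot.incl N.1 hLP x + s y = 0 := h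
      have hy : y = 0 := by
        have := congrArg (SubQuot.proj hNL P.1) h'
        rwa [map_add, SubQuot.proj_incl, hs', zero_add, map_zero] at this
      subst hy
      rw [map_zero, add_zero] at h'
      rw [SubQuot.incl_injective hLP (h'.trans (map_zero _).symm)]
      rfl
    · intro z
      obtain ⟨x, hx⟩ := SubQuot.exists_incl_eq hNL hLP
        (x := z - s (SubQuot.proj hNL P.1 z)) (by rw [map_sub, hs', sub_self])
      refine ⟨(x, SubQuot.proj hNL P.1 z), ?_⟩
      change SubQuot.incl N.1 hLP x + _ = _
      rw [hx]
      exact sub_add_cancel _ _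
  let e : (SubQuot N.1 L.1 × SubQuot L.1 P.1) ≃L[𝕜] SubQuot N.1 P.1 :=
    { LinearEquiv.ofBijective f hf with
      continuous_toFun := IsModuleTopology.continuous_of_linearMap f
      continuous_invFun := IsModuleTopology.continuous_of_linearMap
        (LinearEquiv.ofBijective f hf).symm.toLinearMap }
  exact ContinuousLinearEquiv.isAddHaarMeasure_map e _

/-- For `N ≤ L ≤ P ≤ Q` there are compatible sections, for which the products of measures on `L / N`,
`P / L` and `Q / P` in the two orders agree. -/
theorem exists_secMeas_assoc (hNL : N ≤ L) (hLP : L ≤ P) (hPQ : P ≤ Q) :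
    ∃ (s₁ : SubQuot L.1 P.1 →ₗ[𝕜] SubQuot N.1 P.1) (s₂ : SubQuot P.1 Q.1 →ₗ[𝕜] SubQuot N.1 Q.1)
      (t₁ : SubQuot P.1 Q.1 →ₗ[𝕜] SubQuot L.1 Q.1) (t₂ : SubQuot L.1 Q.1 →ₗ[𝕜] SubQuot N.1 Q.1),
      SubQuot.proj hNL P.1 ∘ₗ s₁ = LinearMap.id ∧
      SubQuot.proj (hNL.trans hLP) Q.1 ∘ₗ s₂ = LinearMap.id ∧
      SubQuot.proj hLP Q.1 ∘ₗ t₁ = LinearMap.id ∧ SubQuot.proj hNL Q.1 ∘ₗ t₂ = LinearMap.id ∧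
      ∀ (α : Measure (SubQuot N.1 L.1)) (β : Measure (SubQuot L.1 P.1))
        (γ : Measure (SubQuot P.1 Q.1)) [α.IsAddHaarMeasure] [β.IsAddHaarMeasure]
        [γ.IsAddHaarMeasure], secMeas hPQ s₂ (secMeas hLP s₁ α β) γ =
          secMeas (hLP.trans hPQ) t₂ α (secMeas hPQ t₁ β γ) := by
  obtain ⟨t₁, ht₁⟩ := exists_section hLP Q
  obtain ⟨t₂, ht₂⟩ := exists_section hNL Q
  have e1 : ∀ x, SubQuot.proj hLP Q.1 (SubQuot.proj hNL Q.1 x) =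
      SubQuot.proj (hNL.trans hLP) Q.1 x := fun x => by
    induction x using Submodule.Quotient.induction_on with
    | H x => rfl
  have e2 : ∀ x : SubQuot N.1 L.1, SubQuot.incl N.1 hPQ (SubQuot.incl N.1 hLP x) =
      SubQuot.incl N.1 (hLP.trans hPQ) x := fun x => by
    induction x using Submodule.Quotient.induction_on with
    | H x => rfl
  have e3 : ∀ x : SubQuot N.1 P.1, SubQuot.proj hNL Q.1 (SubQuot.incl N.1 hPQ x) =
      SubQuot.incl L.1 hPQ (SubQuot.proj hNL P.1 x) := fun x => by
    induction x using Submodule.Quotient.induction_on with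
    | H x => rfl
  have ht₁' : ∀ y, SubQuot.proj hLP Q.1 (t₁ y) = y := LinearMap.congr_fun ht₁
  have ht₂' : ∀ y, SubQuot.proj hNL Q.1 (t₂ y) = y := LinearMap.congr_fun ht₂
  obtain ⟨s₁, hs₁⟩ := SubQuot.exists_comp_incl (hNL.trans hLP) hPQ
    (t₂ ∘ₗ SubQuot.incl L.1 hPQ) fun x => by
      rw [LinearMap.comp_apply, ← e1, ht₂', SubQuot.proj_incl]
  refine ⟨s₁, t₂ ∘ₗ t₁, t₁, t₂, LinearMap.ext fun x => ?_, LinearMap.ext fun x => ?_, ht₁, ht₂, ?_⟩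
  · apply SubQuot.incl_injective hPQ
    rw [LinearMap.comp_apply, ← e3, hs₁, LinearMap.comp_apply, ht₂']
    rfl
  · rw [LinearMap.comp_apply, LinearMap.comp_apply, ← e1, ht₂', ht₁']
    rfl
  · intro α β γ _ _ _
    have m1 := measurable_add_section hLP s₁
    have m2 := measurable_add_section hPQ t₁
    unfold secMeas
    have h1 := Measure.map_prod_map (α.prod β) γ m1 measurable_id
    have h2 := Measure.map_prod_map α (β.prod γ) measurable_id m2
    rw [Measure.map_id] at h1 h2
    have h3 : ((α.prod β).prod γ).map MeasurableEquiv.prodAssoc = α.prod (β.prod γ) :=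
      Measure.prodAssoc_prod
    have h4 := (congrArg (Measure.map (Prod.map id
      fun x => SubQuot.incl L.1 hPQ x.1 + t₁ x.2)) h3.symm).trans
        (Measure.map_map (measurable_id.prodMap m2) MeasurableEquiv.prodAssoc.measurable)
    refine ((congrArg (Measure.map _) h1).trans (Measure.map_map
      (measurable_add_section hPQ _) (m1.prodMap measurable_id))).trans (Eq.trans ?_
        ((congrArg (Measure.map _) (h2.trans h4)).trans (Measure.map_map
          (measurable_add_section _ t₂)
          ((measurable_id.prodMap m2).comp MeasurableEquiv.prodAssoc.measurable))).symm)
    congr 1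
    ext1 p
    simp only [Function.comp_apply, Prod.map_fst, Prod.map_snd, id_eq, MeasurableEquiv.prodAssoc,
      MeasurableEquiv.coe_mk, Equiv.prodAssoc_apply, map_add, LinearMap.comp_apply, e2, hs₁,
      add_assoc]

end OLattice

open OLattice in
/-- Haar theories exist: for arbitrary choices of Haar measures on the quotients `L / N`, the
failure of multiplicativity is a `2`-cocycle on the directed set of lattices, which is a coboundary,
so that the choices can be corrected. -/
theorem nonempty_haarTheory (𝕜 : Type) [RCLike 𝕜] (n : ℕ) : Nonempty (HaarTheory 𝕜 n) := by
  let α : ∀ N L : OLattice 𝕜 n, Measure (SubQuot N.1 L.1) := fun N L => Measure.addHaar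
  have hα : ∀ N L, (α N L).IsAddHaarMeasure := fun N L => by
    change (Measure.addHaar : Measure (SubQuot N.1 L.1)).IsAddHaarMeasure
    infer_instance
  -- `c` is the logarithm of the factor by which multiplicativity fails
  have hex : ∀ N L P : OLattice 𝕜 n, ∃ c : ℝ, ∀ (hNL : N ≤ L) (hLP : L ≤ P)
      (s : SubQuot L.1 P.1 →ₗ[𝕜] SubQuot N.1 P.1), SubQuot.proj hNL P.1 ∘ₗ s = LinearMap.id →
      secMeas hLP s (α N L) (α L P) = (Real.exp c).toNNReal • α N P := by
    intro N L P
    by_cases h : N ≤ L ∧ L ≤ P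
    · obtain ⟨hNL, hLP⟩ := h
      obtain ⟨s₀, hs₀⟩ := exists_section hNL P
      have := isAddHaarMeasure_secMeas hNL hLP s₀ hs₀ (α N L) (α L P)
      refine ⟨Real.log ((secMeas hLP s₀ (α N L) (α L P)).addHaarScalarFactor (α N P)),
        fun _ _ s hs => ?_⟩
      have hpos : (0 : ℝ) < (secMeas hLP s₀ (α N L) (α L P)).addHaarScalarFactor (α N P) :=
        NNReal.coe_pos.mpr (Measure.addHaarScalarFactor_pos_of_isAddHaarMeasure _ _)
      rw [Real.exp_log hpos, Real.toNNReal_coe, secMeas_eq hNL hLP s s₀ hs hs₀]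
      exact Measure.isAddLeftInvariant_eq_smul _ _
    · exact ⟨0, fun hNL hLP => (h ⟨hNL, hLP⟩).elim⟩
  choose c hc using hex
  have hinj : ∀ (N L : OLattice 𝕜 n) (x y : ℝ),
      (Real.exp x).toNNReal • α N L = (Real.exp y).toNNReal • α N L → x = y := by
    intro N L x y h
    have hx : ∀ z : ℝ, ((Real.exp z).toNNReal • α N L).addHaarScalarFactor (α N L) =
        (Real.exp z).toNNReal := fun z => by
      rw [Measure.addHaarScalarFactor_smul, Measure.addHaarScalarFactor_self, smul_eq_mul, mul_one]
    have h' : (Real.exp x).toNNReal = (Real.exp y).toNNReal := by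
      rw [← hx x, ← hx y]
      simp only [h]
    rw [Real.toNNReal_eq_toNNReal_iff (Real.exp_pos _).le (Real.exp_pos _).le] at h'
    exact Real.exp_injective h'
  obtain ⟨b, hb⟩ := exists_cobound_of_cocycle (stdLattice 𝕜 n) OLattice.exists_le_le c (by
    intro N L P Q hNL hLP hPQ
    obtain ⟨s₁, s₂, t₁, t₂, hs₁, hs₂, ht₁, ht₂, H⟩ := exists_secMeas_assoc hNL hLP hPQ
    have e := H (α N L) (α L P) (α P Q)
    rw [hc N L P hNL hLP s₁ hs₁, hc L P Q hLP hPQ t₁ ht₁, ← one_smul NNReal (α P Q),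
      ← one_smul NNReal (α N L), secMeas_smul, secMeas_smul,
      hc N P Q (hNL.trans hLP) hPQ s₂ hs₂, hc N L Q hNL (hLP.trans hPQ) t₂ ht₂, mul_one, one_mul,
      smul_smul, smul_smul, ← Real.toNNReal_mul (Real.exp_pos _).le,
      ← Real.toNNReal_mul (Real.exp_pos _).le, ← Real.exp_add, ← Real.exp_add] at e
    exact hinj _ _ _ _ e)
  refine ⟨⟨fun N L _ => (Real.exp (b N L)).toNNReal • α N L, fun N L _ => ?_, ?_⟩⟩
  · exact Measure.IsAddHaarMeasure.nnreal_smul _ (by simpa using Real.exp_pos _)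
  · intro N L P hNL hLP s hs
    change _ = secMeas hLP s _ _
    rw [secMeas_smul, hc N L P hNL hLP s hs, smul_smul, ← Real.toNNReal_mul (Real.exp_pos _).le,
      ← Real.exp_add, ← Real.toNNReal_mul (Real.exp_pos _).le, ← Real.exp_add, hb N L P hNL hLP]

end HaarExistence

/-! ### The extension of `GL_2(K)` by `ℝ_+^*` -/

section RealExtension

open MeasureTheory HaarTheory

variable {𝕜 : Type} [RCLike 𝕜] {n : ℕ}

/-- The coordinates of `c ∈ μ(O^n | O^n)` determine `c` only because there is a Haar theory. -/
theorem glTildeIncl_injective : Function.Injective (glTildeIncl 𝕜 n) := fun _ _ h =>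
  congrFun (congrArg (fun x : GLTilde 𝕜 n => x.1.left) h) (nonempty_haarTheory 𝕜 n).some

theorem glTildeProj_incl (c : PosReal) : glTildeProj 𝕜 n (glTildeIncl 𝕜 n c) = 1 := rfl

theorem glTildeIncl_comm (c : PosReal) (x : GLTilde 𝕜 n) :
    glTildeIncl 𝕜 n c * x = x * glTildeIncl 𝕜 n c :=
  glTilde_ker_comm _ x (glTildeProj_incl c)

/-- The elements of `μ(L | L)` are constants. -/
theorem RelHaar.eq_const {L : OLattice 𝕜 n} {r : HaarTheory 𝕜 n → PosReal} (hr : r ∈ RelHaar L L)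
    (h h' : HaarTheory 𝕜 n) : r h = r h' := by
  have e := hr h h' L le_rfl le_rfl
  have p : (0 : ℝ) < factor h h' L L le_rfl := factor_pos _ _ _ _ _
  exact Subtype.ext (mul_right_cancel₀ p.ne' e).symm

theorem exists_glTildeIncl_eq {x : GLTilde 𝕜 n} (hx : glTildeProj 𝕜 n x = 1) :
    ∃ c, glTildeIncl 𝕜 n c = x := by
  obtain ⟨⟨r, g⟩, hr⟩ := x
  change g = 1 at hx
  subst hx
  rw [mem_GLTilde, one_smul] at hr
  exact ⟨r (nonempty_haarTheory 𝕜 n).some,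
    Subtype.ext (SemidirectProduct.ext (funext fun h => RelHaar.eq_const hr _ h) rfl)⟩

/-- `θ⁻¹(SL_2(K)) ⋊ K^*` is a central extension of `GL_2(K)` by `ℝ_+^*`. -/
theorem isCentralExtension_glHatReal (𝕜 : Type) [RCLike 𝕜] :
    IsCentralExtension (glHatRealIncl 𝕜) (glHatRealProj 𝕜) where
  injective c d h := glTildeIncl_injective (n := 2)
    (congrArg (fun x : GLHatReal 𝕜 => x.left.1) h)
  exact := by
    ext ⟨⟨x, hx⟩, y⟩
    constructor
    · rintro ⟨k, hk⟩
      rw [← hk]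
      change (1 : Matrix.GeneralLinearGroup (Fin 2) (LaurentSeries 𝕜)) * cornerGL _ 1 = 1
      rw [map_one, mul_one]
    · intro h
      change glTildeProj 𝕜 2 x * cornerGL _ y = 1 at h
      have hy : y = 1 := by
        have := congrArg Matrix.GeneralLinearGroup.det h
        rwa [map_mul, MonoidHom.mem_ker.mp (Subgroup.mem_comap.mp hx), det_cornerGL, one_mul,
          map_one] at this
      subst hy
      rw [map_one, mul_one] at h
      obtain ⟨c, rfl⟩ := exists_glTildeIncl_eq h
      exact ⟨c, rfl⟩
  surjective g := by
    have hA : g * (cornerGL _ (Matrix.GeneralLinearGroup.det g))⁻¹ ∈ SLTwo (LaurentSeries 𝕜) := by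
      rw [MonoidHom.mem_ker, map_mul, map_inv, det_cornerGL, mul_inv_cancel]
    obtain ⟨x, hx⟩ := glTildeProj_surjective
      (g * (cornerGL _ (Matrix.GeneralLinearGroup.det g))⁻¹)
    refine ⟨⟨⟨x, Subgroup.mem_comap.mpr (hx ▸ hA)⟩, Matrix.GeneralLinearGroup.det g⟩, ?_⟩
    change glTildeProj 𝕜 2 x * cornerGL _ (Matrix.GeneralLinearGroup.det g) = g
    rw [hx, inv_mul_cancel_right]
  central := by
    rintro _ ⟨c, rfl⟩
    rw [Subgroup.mem_center_iff]
    rintro ⟨⟨x, hx⟩, y⟩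
    refine SemidirectProduct.ext (Subtype.ext ?_) ((mul_one y).trans (one_mul y).symm)
    obtain ⟨d, hd⟩ := glTildeProj_surjective (cornerGL (LaurentSeries 𝕜) y)
    change x * ((slPreimageAct 𝕜 y _ : SLPreimage 𝕜) : GLTilde 𝕜 2) =
      glTildeIncl 𝕜 2 c * ((slPreimageAct 𝕜 1 _ : SLPreimage 𝕜) : GLTilde 𝕜 2)
    rw [slPreimageAct_apply 𝕜 y d hd, map_one]
    change x * (d * glTildeIncl 𝕜 2 c * d⁻¹) = glTildeIncl 𝕜 2 c * x
    rw [← glTildeIncl_comm, mul_inv_cancel_right, glTildeIncl_comm]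

end RealExtension

/-! ### The direct limit of the groups `GL_n(K)~` -/

section Stabilization

open MeasureTheory HaarTheory

section Matrices

variable {K : Type*} [Field K] {n m : ℕ}

/-- The matrix of the embedding of `K^n` into `K^m` as the span of the first basis vectors. -/
def stabMat (K : Type*) [Field K] (n m : ℕ) : Matrix (Fin m) (Fin n) K :=
  Matrix.of fun i j => if (i : ℕ) = j then 1 else 0

theorem stabMat_mulVec_castLE (h : n ≤ m) (v : Fin n → K) (i : Fin n) :
    (stabMat K n m).mulVec v (Fin.castLE h i) = v i := by
  simp [stabMat, Matrix.mulVec, dotProduct, Fin.val_inj]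

theorem stabMat_mulVec_of_le (v : Fin n → K) (i : Fin m) (hi : n ≤ i) :
    (stabMat K n m).mulVec v i = 0 := by
  simp only [stabMat, Matrix.mulVec, dotProduct, Matrix.of_apply]
  exact Finset.sum_eq_zero fun j _ => by rw [if_neg (by omega), zero_mul]

theorem stabMat_transpose_mulVec (h : n ≤ m) (v : Fin m → K) :
    (stabMat K n m).transpose.mulVec v = fun i => v (Fin.castLE h i) := by
  ext i
  simp only [stabMat, Matrix.mulVec, dotProduct, Matrix.transpose_apply, Matrix.of_apply]
  rw [Finset.sum_eq_single (Fin.castLE h i)]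
  · simp
  · intro j _ hj
    rw [if_neg (fun e => hj (Fin.ext e) : ¬(j : ℕ) = i), zero_mul]
  · simp

theorem stabMat_transpose_mul (h : n ≤ m) : (stabMat K n m).transpose * stabMat K n m = 1 := by
  refine Matrix.mulVec_injective (funext fun v => ?_)
  rw [← Matrix.mulVec_mulVec, stabMat_transpose_mulVec h, Matrix.one_mulVec]
  exact funext fun i => stabMat_mulVec_castLE h v i

/-- The embedding `GL_n(K) → GL_m(K)`, `g ↦ diag(g, 1)`, for `n ≤ m`. -/
def stabGL (h : n ≤ m) :
    Matrix.GeneralLinearGroup (Fin n) K →* Matrix.GeneralLinearGroup (Fin m) K :=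
  Units.map
    { toFun := fun M => 1 + stabMat K n m * (M - 1) * (stabMat K n m).transpose
      map_one' := by simp
      map_mul' := fun M N => by
        have e : (stabMat K n m * (M - 1) * (stabMat K n m).transpose) *
            (stabMat K n m * (N - 1) * (stabMat K n m).transpose) =
            stabMat K n m * ((M - 1) * (N - 1)) * (stabMat K n m).transpose := by
          rw [show (stabMat K n m * (M - 1) * (stabMat K n m).transpose) *
            (stabMat K n m * (N - 1) * (stabMat K n m).transpose) =
            stabMat K n m * (M - 1) * ((stabMat K n m).transpose * stabMat K n m) * (N - 1) *
              (stabMat K n m).transpose by simp only [Matrix.mul_assoc],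
            stabMat_transpose_mul h]
          simp only [Matrix.mul_one, Matrix.mul_assoc]
        have e2 : M * N - 1 = (M - 1) + (N - 1) + (M - 1) * (N - 1) := by noncomm_ring
        rw [add_mul, mul_add, mul_add, e, e2]
        simp only [Matrix.mul_add, Matrix.add_mul, one_mul, mul_one]
        abel }

theorem stabGL_mulVec (h : n ≤ m) (g : Matrix.GeneralLinearGroup (Fin n) K) (v : Fin m → K) :
    (stabGL h g).val.mulVec v =
      v + (stabMat K n m).mulVec ((g.val - 1).mulVec fun i => v (Fin.castLE h i)) := by
  change (1 + stabMat K n m * (g.val - 1) * (stabMat K n m).transpose).mulVec v = _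
  rw [Matrix.add_mulVec, Matrix.one_mulVec, ← Matrix.mulVec_mulVec, ← Matrix.mulVec_mulVec,
    stabMat_transpose_mulVec h]

theorem stabGL_mulVec_castLE (h : n ≤ m) (g : Matrix.GeneralLinearGroup (Fin n) K)
    (v : Fin m → K) (i : Fin n) : (stabGL h g).val.mulVec v (Fin.castLE h i) =
      g.val.mulVec (fun i => v (Fin.castLE h i)) i := by
  rw [stabGL_mulVec, Pi.add_apply, stabMat_mulVec_castLE h, Matrix.sub_mulVec, Matrix.one_mulVec,
    Pi.sub_apply, add_sub_cancel]

theorem stabGL_mulVec_of_le (h : n ≤ m) (g : Matrix.GeneralLinearGroup (Fin n) K)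
    (v : Fin m → K) (i : Fin m) (hi : n ≤ i) : (stabGL h g).val.mulVec v i = v i := by
  rw [stabGL_mulVec, Pi.add_apply, stabMat_mulVec_of_le _ _ hi, add_zero]

theorem glInf_stabGL (h : n ≤ m) (g : Matrix.GeneralLinearGroup (Fin n) K) :
    glInf m (stabGL h g) = glInf n g := by
  have hI : ∀ w : Fin n → K, finIncl m ((stabMat K n m).mulVec w) = finIncl n w := by
    have hc : finIncl m ∘ₗ (stabMat K n m).mulVecLin = finIncl (K := K) n := by
      refine LinearMap.pi_ext fun i a => ?_
      have : (stabMat K n m).mulVec (Pi.single i a) = Pi.single (Fin.castLE h i) a := by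
        ext j
        rw [Matrix.mulVec_single]
        by_cases hj : j = Fin.castLE h i
        · subst hj
          simp [stabMat]
        · have : (j : ℕ) ≠ i := fun e => hj (Fin.ext e)
          simp [stabMat, this, hj]
      rw [LinearMap.comp_apply, Matrix.mulVecLin_apply, this, finIncl_single, finIncl_single]
      rfl
    exact LinearMap.congr_fun hc
  refine Units.ext (LinearMap.ext fun f => ?_)
  change matInf m (stabGL h g).val f = matInf n g.val f
  rw [matInf_apply, matInf_apply, Matrix.sub_mulVec, Matrix.one_mulVec, stabGL_mulVec,
    add_sub_cancel_left, hI]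
  rfl

end Matrices

variable {𝕜 : Type} [RCLike 𝕜] {n m l : ℕ}

/-- The projection of `K^m` to the first `n` coordinates, for `n ≤ m`. -/
def vecProj (𝕜 : Type) [RCLike 𝕜] (h : n ≤ m) :
    (Fin m → LaurentSeries 𝕜) →ₗ[𝕜] (Fin n → LaurentSeries 𝕜) where
  toFun v i := v (Fin.castLE h i)
  map_add' _ _ := rfl
  map_smul' _ _ := rfl

/-- The embedding of `K^n` into `K^m` as the span of the first basis vectors. -/
def vecIncl (𝕜 : Type) [RCLike 𝕜] (n m : ℕ) :
    (Fin n → LaurentSeries 𝕜) →ₗ[𝕜] (Fin m → LaurentSeries 𝕜) where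
  toFun v i := if hi : (i : ℕ) < n then v ⟨i, hi⟩ else 0
  map_add' v w := by
    ext1 i
    by_cases hi : (i : ℕ) < n <;> simp [hi]
  map_smul' c v := by
    ext1 i
    by_cases hi : (i : ℕ) < n <;> simp [hi]

theorem vecProj_vecIncl (h : n ≤ m) (v : Fin n → LaurentSeries 𝕜) :
    vecProj 𝕜 h (vecIncl 𝕜 n m v) = v := by
  ext1 i
  simp [vecProj, vecIncl]

theorem vecProj_glLin (h : n ≤ m) (g : Matrix.GeneralLinearGroup (Fin n) (LaurentSeries 𝕜))
    (v : Fin m → LaurentSeries 𝕜) :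
    vecProj 𝕜 h (glLin (stabGL h g) v) = glLin g (vecProj 𝕜 h v) :=
  funext fun i => stabGL_mulVec_castLE h g v i

/-- The subspace `L ⊕ O^(m-n)` of `K^m`, for a subspace `L` of `K^n`. -/
def extSub (h : n ≤ m) (L : Submodule 𝕜 (Fin n → LaurentSeries 𝕜)) :
    Submodule 𝕜 (Fin m → LaurentSeries 𝕜) where
  carrier := {v | vecProj 𝕜 h v ∈ L ∧ ∀ i : Fin m, n ≤ i → ∀ k < 0, (v i).coeff k = 0}
  add_mem' := fun {v w} hv hw => ⟨by rw [map_add]; exact L.add_mem hv.1 hw.1,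
    fun i hi k hk => by simp [hv.2 i hi k hk, hw.2 i hi k hk]⟩
  zero_mem' := ⟨by rw [map_zero]; exact L.zero_mem, fun i _ k _ => by simp⟩
  smul_mem' := fun c v hv => ⟨by rw [map_smul]; exact L.smul_mem c hv.1,
    fun i hi k hk => by simp [hv.2 i hi k hk]⟩

theorem mem_extSub {h : n ≤ m} {L : Submodule 𝕜 (Fin n → LaurentSeries 𝕜)}
    {v : Fin m → LaurentSeries 𝕜} : v ∈ extSub h L ↔
      vecProj 𝕜 h v ∈ L ∧ ∀ i : Fin m, n ≤ i → ∀ k < 0, (v i).coeff k = 0 := Iff.rfl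

theorem vecProj_mem {h : n ≤ m} {L : Submodule 𝕜 (Fin n → LaurentSeries 𝕜)} :
    ∀ v ∈ extSub h L, vecProj 𝕜 h v ∈ L := fun _ hv => hv.1

theorem mem_map_glLin {g : Matrix.GeneralLinearGroup (Fin n) (LaurentSeries 𝕜)}
    {L : Submodule 𝕜 (Fin n → LaurentSeries 𝕜)} {v : Fin n → LaurentSeries 𝕜} :
    v ∈ L.map (glLin g).toLinearMap ↔ glLin g⁻¹ v ∈ L := by
  have e : ∀ w, glLin g (glLin g⁻¹ w) = w := fun w => by rw [map_inv]; simp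
  have e' : ∀ w, glLin g⁻¹ (glLin g w) = w := fun w => by rw [map_inv]; simp
  constructor
  · rintro ⟨w, hw, rfl⟩
    change glLin g⁻¹ (glLin g w) ∈ L
    rwa [e']
  · intro hv
    exact ⟨_, hv, e v⟩

theorem extSub_map (h : n ≤ m) (g : Matrix.GeneralLinearGroup (Fin n) (LaurentSeries 𝕜))
    (L : Submodule 𝕜 (Fin n → LaurentSeries 𝕜)) :
    extSub h (L.map (glLin g).toLinearMap) =
      (extSub h L).map (glLin (stabGL h g)).toLinearMap := by
  ext v
  rw [mem_map_glLin, mem_extSub, mem_extSub, mem_map_glLin, ← map_inv, vecProj_glLin]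
  refine and_congr_right fun _ => forall_congr' fun i => forall_congr' fun hi => ?_
  rw [glLin_apply, stabGL_mulVec_of_le h _ v i hi]

theorem extSub_laurentFil (h : n ≤ m) : extSub h (laurentFil 𝕜 n 0) = laurentFil 𝕜 m 0 := by
  ext v
  rw [mem_extSub, mem_laurentFil, mem_laurentFil]
  constructor
  · rintro ⟨h1, h2⟩ i
    by_cases hi : (i : ℕ) < n
    · exact h1 ⟨i, hi⟩
    · exact h2 i (not_lt.mp hi)
  · intro hv
    exact ⟨fun i => hv _, fun i _ => hv i⟩

/-- The lattice `L ⊕ O^(m-n)` in `K^m`, for a lattice `L` in `K^n`. -/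
def OLattice.ext (h : n ≤ m) (L : OLattice 𝕜 n) : OLattice 𝕜 m :=
  ⟨extSub h L.1, by
    obtain ⟨L, g, rfl⟩ := L
    exact ⟨stabGL h g, by rw [extSub_map, extSub_laurentFil]⟩⟩

theorem OLattice.ext_mono (h : n ≤ m) {N L : OLattice 𝕜 n} (hNL : N ≤ L) :
    N.ext h ≤ L.ext h := fun _ hv => ⟨hNL hv.1, hv.2⟩

theorem OLattice.ext_smul (h : n ≤ m) (g : Matrix.GeneralLinearGroup (Fin n) (LaurentSeries 𝕜))
    (L : OLattice 𝕜 n) : (g • L).ext h = stabGL h g • L.ext h :=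
  Subtype.ext (extSub_map h g L.1)

theorem OLattice.ext_std (h : n ≤ m) : (stdLattice 𝕜 n).ext h = stdLattice 𝕜 m :=
  Subtype.ext (extSub_laurentFil h)

/-- The map `L / N → L' / N'` which is induced by a linear map `f : K^m → K^n` with `f(N) ≤ N'`,
`f(L) ≤ L'`. -/
noncomputable def subQuotMap {N L : Submodule 𝕜 (Fin m → LaurentSeries 𝕜)}
    {N' L' : Submodule 𝕜 (Fin n → LaurentSeries 𝕜)}
    (f : (Fin m → LaurentSeries 𝕜) →ₗ[𝕜] (Fin n → LaurentSeries 𝕜))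
    (hN : ∀ x ∈ N, f x ∈ N') (hL : ∀ x ∈ L, f x ∈ L') : SubQuot N L →ₗ[𝕜] SubQuot N' L' :=
  Submodule.mapQ (N.submoduleOf L) (N'.submoduleOf L') (f.restrict hL) fun x hx => hN x.1 hx

theorem HaarTheory.map_meas_congr_hom (h : HaarTheory 𝕜 m) {N N' L L' : OLattice 𝕜 m}
    {P Q : OLattice 𝕜 n} (hN : N' = N)
    (hL : L' = L) (hNL : N ≤ L) (hNL' : N' ≤ L')
    (f f' : (Fin m → LaurentSeries 𝕜) →ₗ[𝕜] (Fin n → LaurentSeries 𝕜)) (hf : f = f')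
    (h1 : ∀ x ∈ N.1, f x ∈ P.1) (h2 : ∀ x ∈ L.1, f x ∈ Q.1)
    (h1' : ∀ x ∈ N'.1, f' x ∈ P.1) (h2' : ∀ x ∈ L'.1, f' x ∈ Q.1) :
    (h.meas N L hNL).map (subQuotMap f h1 h2) =
      (h.meas N' L' hNL').map (subQuotMap f' h1' h2') := by
  subst hN hL hf
  rfl

theorem vecIncl_mem_extSub (h : n ≤ m) {L : Submodule 𝕜 (Fin n → LaurentSeries 𝕜)}
    (x : Fin n → LaurentSeries 𝕜) (hx : x ∈ L) : vecIncl 𝕜 n m x ∈ extSub h L := by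
  refine ⟨by rwa [vecProj_vecIncl], fun i hi k _ => ?_⟩
  simp [vecIncl, not_lt.mpr hi]

/-- The isomorphism `(L ⊕ O^(m-n)) / (N ⊕ O^(m-n)) ≅ L / N`. -/
noncomputable def extEquiv (h : n ≤ m) (N L : OLattice 𝕜 n) :
    SubQuot (N.ext h).1 (L.ext h).1 ≃L[𝕜] SubQuot N.1 L.1 where
  toLinearEquiv := LinearEquiv.ofLinearMap
    (subQuotMap (vecProj 𝕜 h) vecProj_mem vecProj_mem)
    (subQuotMap (vecIncl 𝕜 n m) (vecIncl_mem_extSub h) (vecIncl_mem_extSub h))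
    (LinearMap.ext fun x => by
      induction x using Submodule.Quotient.induction_on with
      | H x =>
        exact congrArg (Submodule.Quotient.mk (p := N.1.submoduleOf L.1))
          (Subtype.ext (vecProj_vecIncl h x.1)))
    (LinearMap.ext fun x => by
      induction x using Submodule.Quotient.induction_on with
      | H x =>
        refine (Submodule.Quotient.eq ((N.ext h).1.submoduleOf (L.ext h).1)).mpr ⟨?_, ?_⟩
        · change vecProj 𝕜 h (vecIncl 𝕜 n m (vecProj 𝕜 h x.1) - x.1) ∈ N.1
          rw [map_sub, vecProj_vecIncl, sub_self]
          exact zero_mem _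
        · intro i hi k hk
          have e : vecIncl 𝕜 n m (vecProj 𝕜 h x.1) i = 0 := dif_neg (not_lt.mpr hi)
          change (vecIncl 𝕜 n m (vecProj 𝕜 h x.1) i - x.1 i).coeff k = 0
          rw [e, zero_sub, HahnSeries.coeff_neg, x.2.2 i hi k hk, neg_zero])
  continuous_toFun := IsModuleTopology.continuous_of_linearMap
    (subQuotMap (vecProj 𝕜 h) vecProj_mem vecProj_mem)
  continuous_invFun := IsModuleTopology.continuous_of_linearMap
    (subQuotMap (vecIncl 𝕜 n m) (vecIncl_mem_extSub h) (vecIncl_mem_extSub h))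

/-- The restriction of a Haar theory on `K^m` to `K^n`, for `n ≤ m`: its measure on `L / N` is the
given measure on `(L ⊕ O^(m-n)) / (N ⊕ O^(m-n))`. -/
noncomputable def HaarTheory.res (h : n ≤ m) (τ : HaarTheory 𝕜 m) : HaarTheory 𝕜 n where
  meas N L hNL := (τ.meas (N.ext h) (L.ext h) (OLattice.ext_mono h hNL)).map (extEquiv h N L)
  haar N L hNL := ContinuousLinearEquiv.isAddHaarMeasure_map _ _
  mul := by
    intro N L P hNL hLP s hs
    have hNL' := OLattice.ext_mono h hNL
    have hLP' := OLattice.ext_mono h hLP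
    have e1 : Measurable (extEquiv h N L) := (extEquiv h N L).continuous.measurable
    have e2 : Measurable (extEquiv h L P) := (extEquiv h L P).continuous.measurable
    have e3 : Measurable (extEquiv h N P) := (extEquiv h N P).continuous.measurable
    let s' : SubQuot (L.ext h).1 (P.ext h).1 →ₗ[𝕜] SubQuot (N.ext h).1 (P.ext h).1 :=
      (extEquiv h N P).symm.toLinearMap ∘ₗ s ∘ₗ (extEquiv h L P).toLinearMap
    have hs' : ∀ x, extEquiv h N P (s' x) = s (extEquiv h L P x) := fun x =>
      (extEquiv h N P).apply_symm_apply _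
    have comm_proj : ∀ x, extEquiv h L P (SubQuot.proj hNL' (P.ext h).1 x) =
        SubQuot.proj hNL P.1 (extEquiv h N P x) := fun x => by
      induction x using Submodule.Quotient.induction_on with
      | H x => rfl
    have comm_incl : ∀ x, extEquiv h N P (SubQuot.incl (N.ext h).1 hLP' x) =
        SubQuot.incl N.1 hLP (extEquiv h N L x) := fun x => by
      induction x using Submodule.Quotient.induction_on with
      | H x => rfl
    rw [τ.mul _ _ _ hNL' hLP' s' (LinearMap.ext fun x => (extEquiv h L P).injective (by
        rw [LinearMap.comp_apply, comm_proj, hs']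
        exact LinearMap.congr_fun hs _)),
      Measure.map_map e3 (measurable_add_section hLP' s'), Measure.map_prod_map _ _ e1 e2,
      Measure.map_map (measurable_add_section hLP s) (e1.prodMap e2)]
    congr 1
    ext1 x
    simp only [Function.comp_apply, Prod.map_fst, Prod.map_snd, map_add, hs', comm_incl]

theorem HaarTheory.res_meas (h : n ≤ m) (τ : HaarTheory 𝕜 m) (N L : OLattice 𝕜 n) (hNL : N ≤ L) :
    (τ.res h).meas N L hNL =
      (τ.meas (N.ext h) (L.ext h) (OLattice.ext_mono h hNL)).map (extEquiv h N L) := rfl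

theorem HaarTheory.factor_res (h : n ≤ m) (τ τ' : HaarTheory 𝕜 m) (N L : OLattice 𝕜 n)
    (hNL : N ≤ L) : factor (τ.res h) (τ'.res h) N L hNL =
      factor τ τ' (N.ext h) (L.ext h) (OLattice.ext_mono h hNL) := by
  apply factor_eq_of_smul
  rw [res_meas, res_meas, ← Measure.map_smul, ← meas_eq_factor_smul]

theorem HaarTheory.res_smul (h : n ≤ m) (g : Matrix.GeneralLinearGroup (Fin n) (LaurentSeries 𝕜))
    (τ : HaarTheory 𝕜 m) : (stabGL h g • τ).res h = g • τ.res h := by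
  refine ext' fun N L hNL => ?_
  rw [res_meas, smul_meas, smul_meas, res_meas,
    Measure.map_map (extEquiv h N L).continuous.measurable
      (actEquiv (stabGL h g) _ _).continuous.measurable,
    Measure.map_map (actEquiv g N L).continuous.measurable
      (extEquiv h _ _).continuous.measurable]
  have e : ∀ L : OLattice 𝕜 n, (g⁻¹ • L).ext h = (stabGL h g)⁻¹ • L.ext h := fun L => by
    rw [OLattice.ext_smul, map_inv]
  have e1 : (extEquiv h N L ∘ actEquiv (stabGL h g) (N.ext h) (L.ext h)) =
      subQuotMap (vecProj 𝕜 h ∘ₗ (glLin (stabGL h g)).toLinearMap)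
        (fun x hx => ((N.ext h).glLin_mem _ x hx).1)
        (fun x hx => ((L.ext h).glLin_mem _ x hx).1) := by
    ext1 x
    induction x using Submodule.Quotient.induction_on with
    | H x => rfl
  have e2 : (actEquiv g N L ∘ extEquiv h (g⁻¹ • N) (g⁻¹ • L)) =
      subQuotMap ((glLin g).toLinearMap ∘ₗ vecProj 𝕜 h)
        (fun x hx => N.glLin_mem g _ (vecProj_mem x hx))
        (fun x hx => L.glLin_mem g _ (vecProj_mem x hx)) := by
    ext1 x
    induction x using Submodule.Quotient.induction_on with
    | H x => rfl
  rw [e1, e2]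
  exact map_meas_congr_hom τ (e N) (e L) _ _ _ _ (LinearMap.ext fun v => vecProj_glLin h g v)
    _ _ _ _

theorem OLattice.ext_ext (h : n ≤ m) (h' : m ≤ l) (L : OLattice 𝕜 n) :
    (L.ext h).ext h' = L.ext (h.trans h') := by
  refine Subtype.ext (Submodule.ext fun v => ?_)
  change (vecProj 𝕜 h (vecProj 𝕜 h' v) ∈ L.1 ∧ _) ∧ _ ↔ _ ∧ _
  rw [and_assoc]
  refine and_congr_right fun _ => ⟨fun H i hi => ?_, fun H => ⟨fun i hi => H _ hi, fun i hi =>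
    H i (h.trans hi)⟩⟩
  by_cases him : (i : ℕ) < m
  · exact H.1 ⟨i, him⟩ hi
  · exact H.2 i (not_lt.mp him)

theorem OLattice.ext_self (L : OLattice 𝕜 n) : L.ext le_rfl = L :=
  Subtype.ext (Submodule.ext fun _ => ⟨fun hv => hv.1, fun hv =>
    ⟨hv, fun i hi => (not_lt.mpr hi i.2).elim⟩⟩)

/-- The class in `L / N` of an element of `L`. -/
noncomputable def SubQuot.mk (N : Submodule 𝕜 (Fin n → LaurentSeries 𝕜))
    {L : Submodule 𝕜 (Fin n → LaurentSeries 𝕜)} (x : L) : SubQuot N L :=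
  Submodule.Quotient.mk (p := N.submoduleOf L) x

theorem SubQuot.mk_surjective {N L : Submodule 𝕜 (Fin n → LaurentSeries 𝕜)} (x : SubQuot N L) :
    ∃ y, SubQuot.mk N y = x :=
  Submodule.Quotient.mk_surjective (N.submoduleOf L) x

theorem subQuotMap_mk {N L : Submodule 𝕜 (Fin m → LaurentSeries 𝕜)}
    {N' L' : Submodule 𝕜 (Fin n → LaurentSeries 𝕜)}
    (f : (Fin m → LaurentSeries 𝕜) →ₗ[𝕜] (Fin n → LaurentSeries 𝕜))
    (hN : ∀ x ∈ N, f x ∈ N') (hL : ∀ x ∈ L, f x ∈ L') (x : L) :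
    subQuotMap f hN hL (SubQuot.mk N x) = SubQuot.mk N' ⟨f x, hL x x.2⟩ := rfl

theorem OLattice.vecProj_mem {h : n ≤ m} {L : OLattice 𝕜 n} :
    ∀ v ∈ (L.ext h).1, vecProj 𝕜 h v ∈ L.1 := fun _ hv => hv.1

theorem extEquiv_mk (h : n ≤ m) (N L : OLattice 𝕜 n) (x : (L.ext h).1) :
    extEquiv h N L (SubQuot.mk _ x) = SubQuot.mk N.1 ⟨vecProj 𝕜 h x, vecProj_mem _ x.2⟩ := rfl

theorem OLattice.vecProj_comp_mem {h : n ≤ m} {h' : m ≤ l} {L : OLattice 𝕜 n} :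
    ∀ v ∈ ((L.ext h).ext h').1, (vecProj 𝕜 h ∘ₗ vecProj 𝕜 h') v ∈ L.1 := fun v hv => by
  rw [LinearMap.comp_apply]
  exact OLattice.vecProj_mem _ (OLattice.vecProj_mem v hv)

theorem extEquiv_comp (h : n ≤ m) (h' : m ≤ l) (N L : OLattice 𝕜 n) :
    (extEquiv h N L ∘ extEquiv h' (N.ext h) (L.ext h)) =
      subQuotMap (vecProj 𝕜 h ∘ₗ vecProj 𝕜 h')
        OLattice.vecProj_comp_mem
        OLattice.vecProj_comp_mem := by
  ext1 x
  obtain ⟨x, rfl⟩ := SubQuot.mk_surjective x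
  rw [Function.comp_apply, extEquiv_mk, extEquiv_mk, subQuotMap_mk]
  rfl

theorem HaarTheory.res_res (h : n ≤ m) (h' : m ≤ l) (τ : HaarTheory 𝕜 l) :
    (τ.res h').res h = τ.res (h.trans h') := by
  refine ext' fun N L hNL => ?_
  rw [res_meas, res_meas, res_meas, Measure.map_map (extEquiv h N L).continuous.measurable
    (extEquiv h' _ _).continuous.measurable, extEquiv_comp]
  have e2 : vecProj 𝕜 h ∘ₗ vecProj 𝕜 h' = vecProj 𝕜 (h.trans h') := LinearMap.ext fun _ => rfl
  exact map_meas_congr_hom τ (OLattice.ext_ext h h' N).symm (OLattice.ext_ext h h' L).symm _ _ _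
    (vecProj 𝕜 (h.trans h')) e2 _ _ OLattice.vecProj_mem OLattice.vecProj_mem

theorem HaarTheory.res_self (τ : HaarTheory 𝕜 n) : τ.res le_rfl = τ := by
  refine ext' fun N L hNL => ?_
  rw [res_meas]
  refine (map_meas_congr_hom τ (OLattice.ext_self N).symm (OLattice.ext_self L).symm _ hNL _
    LinearMap.id rfl vecProj_mem vecProj_mem
    (fun _ hx => hx) (fun _ hx => hx)).trans ?_
  convert Measure.map_id
  ext1 x
  exact SubQuot.map_eq_self _ rfl (fun _ hx => hx) (fun _ hx => hx) x

theorem RelHaar.res_mem (h : n ≤ m) {L M : OLattice 𝕜 n} {r : HaarTheory 𝕜 n → PosReal}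
    (hr : r ∈ RelHaar L M) : (fun τ : HaarTheory 𝕜 m => r (τ.res h)) ∈
      RelHaar (L.ext h) (M.ext h) := by
  obtain ⟨N, hL, hM⟩ := L.exists_le_le M
  refine of_exists ⟨N.ext h, OLattice.ext_mono h hL, OLattice.ext_mono h hM, fun τ τ' => ?_⟩
  rw [← factor_res, ← factor_res]
  exact hr _ _ N hL hM

/-- The homomorphism which is induced by the restriction of Haar theories and by `g ↦ diag(g, 1)`
on the groups in which `GL_n(K)~` and `GL_m(K)~` are contained. -/
noncomputable def stabSemi (𝕜 : Type) [RCLike 𝕜] (h : n ≤ m) :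
    ((HaarTheory 𝕜 n → PosReal) ⋊[mulAutArrow]
      Matrix.GeneralLinearGroup (Fin n) (LaurentSeries 𝕜)) →*
    ((HaarTheory 𝕜 m → PosReal) ⋊[mulAutArrow]
      Matrix.GeneralLinearGroup (Fin m) (LaurentSeries 𝕜)) :=
  SemidirectProduct.map
    { toFun := fun r τ => r (τ.res h), map_one' := rfl, map_mul' := fun _ _ => rfl } (stabGL h)
    fun g => MonoidHom.ext fun r => funext fun τ => by
      change r (g⁻¹ • τ.res h) = r (((stabGL h g)⁻¹ • τ).res h)
      rw [← map_inv, HaarTheory.res_smul]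

/-- The homomorphism `GL_n(K)~ → GL_m(K)~` over `g ↦ diag(g, 1)`, for `n ≤ m`. -/
noncomputable def stabTilde (𝕜 : Type) [RCLike 𝕜] (h : n ≤ m) : GLTilde 𝕜 n →* GLTilde 𝕜 m :=
  ((stabSemi 𝕜 h).comp (GLTilde 𝕜 n).subtype).codRestrict (GLTilde 𝕜 m) fun x => by
    have := RelHaar.res_mem h (mem_GLTilde.mp x.2)
    rw [OLattice.ext_smul, OLattice.ext_std] at this
    exact mem_GLTilde.mpr this

theorem glTildeProj_stabTilde (h : n ≤ m) (x : GLTilde 𝕜 n) :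
    glTildeProj 𝕜 m (stabTilde 𝕜 h x) = stabGL h (glTildeProj 𝕜 n x) := rfl

theorem stabTilde_incl (h : n ≤ m) (c : PosReal) :
    stabTilde 𝕜 h (glTildeIncl 𝕜 n c) = glTildeIncl 𝕜 m c :=
  Subtype.ext (SemidirectProduct.ext rfl (map_one (stabGL h)))

theorem stabGL_injective {K : Type*} [Field K] (h : n ≤ m) :
    Function.Injective (stabGL (K := K) h) := fun g g' e =>
  glInf_injective n (by rw [← glInf_stabGL h, e, glInf_stabGL])

theorem stabTilde_injective (h : n ≤ m) : Function.Injective (stabTilde 𝕜 h) := by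
  rw [injective_iff_map_eq_one]
  intro x hx
  have hx' : glTildeProj 𝕜 n x = 1 := by
    apply stabGL_injective h
    rw [← glTildeProj_stabTilde, hx, map_one, map_one]
  obtain ⟨c, rfl⟩ := exists_glTildeIncl_eq hx'
  rw [stabTilde_incl, ← map_one (glTildeIncl 𝕜 m)] at hx
  rw [glTildeIncl_injective hx, map_one]

theorem stabTilde_stabTilde (h : n ≤ m) (h' : m ≤ l) (x : GLTilde 𝕜 n) :
    stabTilde 𝕜 h' (stabTilde 𝕜 h x) = stabTilde 𝕜 (h.trans h') x := by
  refine Subtype.ext (SemidirectProduct.ext (funext fun τ => ?_) (glInf_injective l ?_))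
  · change x.1.left ((τ.res h').res h) = x.1.left (τ.res (h.trans h'))
    rw [HaarTheory.res_res]
  · change glInf l (stabGL h' (stabGL h x.1.right)) = glInf l (stabGL (h.trans h') x.1.right)
    rw [glInf_stabGL, glInf_stabGL, glInf_stabGL]

theorem stabTilde_self (x : GLTilde 𝕜 n) : stabTilde 𝕜 le_rfl x = x := by
  refine Subtype.ext (SemidirectProduct.ext (funext fun τ => ?_) (glInf_injective n ?_))
  · change x.1.left (τ.res le_rfl) = x.1.left τ
    rw [HaarTheory.res_self]
  · exact glInf_stabGL _ _

instance : DirectedSystem (fun n => GLTilde 𝕜 n) (fun _ _ h => stabTilde 𝕜 h) where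
  map_self _ x := stabTilde_self x
  map_map _ _ _ h h' x := stabTilde_stabTilde h h' x

/-- The direct limit of the groups `GL_n(K)~`. -/
def GLTildeInf (𝕜 : Type) [RCLike 𝕜] : Type :=
  DirectLimit (fun n => GLTilde 𝕜 n) (fun _ _ h => stabTilde 𝕜 h)

noncomputable instance : Group (GLTildeInf 𝕜) :=
  inferInstanceAs (Group (DirectLimit (fun n => GLTilde 𝕜 n) (fun _ _ h => stabTilde 𝕜 h)))

/-- The canonical homomorphism from `GL_n(K)~` to the direct limit. -/
noncomputable def toInf (𝕜 : Type) [RCLike 𝕜] (n : ℕ) : GLTilde 𝕜 n →* GLTildeInf 𝕜 where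
  toFun x := Quotient.mk (DirectLimit.setoid (fun _ _ h => stabTilde 𝕜 h)) ⟨n, x⟩
  map_one' := (DirectLimit.one_def n).symm
  map_mul' x y := by
    exact (DirectLimit.mul_def (f := fun _ _ h => stabTilde 𝕜 h) n x y).symm

theorem toInf_stabTilde (h : n ≤ m) (x : GLTilde 𝕜 n) : toInf 𝕜 m (stabTilde 𝕜 h x) = toInf 𝕜 n x :=
  (DirectLimit.eq_of_le (f := fun _ _ h => stabTilde 𝕜 h) (⟨n, x⟩ : Σ i, GLTilde 𝕜 i) m h).symm

theorem toInf_injective : Function.Injective (toInf 𝕜 n) :=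
  DirectLimit.mk_injective (fun _ _ h => stabTilde 𝕜 h) (fun _ _ h => stabTilde_injective h) n

theorem toInf_incl (n m : ℕ) (c : PosReal) :
    toInf 𝕜 n (glTildeIncl 𝕜 n c) = toInf 𝕜 m (glTildeIncl 𝕜 m c) := by
  rw [← toInf_stabTilde (le_max_left n m), ← toInf_stabTilde (le_max_right n m), stabTilde_incl,
    stabTilde_incl]

theorem exists_toInf_eq (x : GLTildeInf 𝕜) : ∃ n y, toInf 𝕜 n y = x := by
  obtain ⟨n, y, rfl⟩ := DirectLimit.exists_eq_mk (fun _ _ h => stabTilde 𝕜 h) x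
  exact ⟨n, y, rfl⟩

/-- The projection from the direct limit of the groups `GL_n(K)~` to the automorphisms of
`K^(ℕ)`. -/
noncomputable def infProj (𝕜 : Type) [RCLike 𝕜] : GLTildeInf 𝕜 →* GLInf (LaurentSeries 𝕜) where
  toFun := DirectLimit.lift _ (fun n x => glInf n (glTildeProj 𝕜 n x)) fun n m h x => by
    rw [glTildeProj_stabTilde, glInf_stabGL]
  map_one' := by
    rw [← map_one (toInf 𝕜 0)]
    exact map_one ((glInf 0).comp (glTildeProj 𝕜 0))
  map_mul' x y := by
    obtain ⟨n, x, rfl⟩ := exists_toInf_eq x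
    obtain ⟨m, y, rfl⟩ := exists_toInf_eq y
    rw [← toInf_stabTilde (le_max_left n m) x, ← toInf_stabTilde (le_max_right n m) y, ← map_mul]
    exact map_mul ((glInf (max n m)).comp (glTildeProj 𝕜 (max n m))) _ _

theorem infProj_toInf (x : GLTilde 𝕜 n) : infProj 𝕜 (toInf 𝕜 n x) = glInf n (glTildeProj 𝕜 n x) :=
  rfl

/-- The kernel of `infProj` is `ℝ_+^*`. -/
theorem exists_incl_eq_of_infProj {x : GLTildeInf 𝕜} (hx : infProj 𝕜 x = 1) (m : ℕ) :
    ∃ c, toInf 𝕜 m (glTildeIncl 𝕜 m c) = x := by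
  obtain ⟨n, y, rfl⟩ := exists_toInf_eq x
  rw [infProj_toInf, ← map_one (glInf n)] at hx
  obtain ⟨c, rfl⟩ := exists_glTildeIncl_eq (glInf_injective n hx)
  exact ⟨c, toInf_incl m n c⟩

end Stabilization

section CanonicalLifts

open MeasureTheory HaarTheory
open scoped commutatorElement

variable {𝕜 : Type} [RCLike 𝕜] {n m : ℕ}

/-! ### The modulus of an automorphism of `L / N` -/

/-- A linear automorphism `T` of a finite-dimensional `𝕜`-vector space multiplies the Haar measures by
`|N(det T)|⁻¹`, where `N` is the norm of `𝕜` over `ℝ`. -/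
theorem map_eq_smul_of_equiv {V : Type*} [AddCommGroup V] [Module 𝕜 V] [TopologicalSpace V]
    [IsTopologicalAddGroup V] [MeasurableSpace V] [BorelSpace V] {d : ℕ} (e : V ≃L[𝕜] (Fin d → 𝕜))
    (T : V →ₗ[𝕜] V) (hT : LinearMap.det T ≠ 0) (μ : Measure V)
    [μ.IsAddHaarMeasure] : μ.map T = (|Algebra.norm ℝ (LinearMap.det T)|⁻¹).toNNReal • μ := by
  have hdet : LinearMap.det ((e.toLinearMap ∘ₗ T ∘ₗ e.symm.toLinearMap).restrictScalars ℝ) =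
      Algebra.norm ℝ (LinearMap.det T) := by
    rw [LinearMap.det_restrictScalars]
    exact congrArg _ (LinearMap.det_conj T e.toLinearEquiv)
  generalize hf' : (e.toLinearMap ∘ₗ T ∘ₗ e.symm.toLinearMap).restrictScalars ℝ = f at hdet
  have hfe : ∀ x, f x = e (T (e.symm x)) := fun x => by rw [← hf']; rfl
  have hf : LinearMap.det f ≠ 0 := by
    rw [hdet]
    exact Algebra.norm_ne_zero_iff.mpr hT
  have he : Measurable e := e.continuous.measurable
  have he' : Measurable e.symm := e.symm.continuous.measurable
  have hfm : Measurable f := (LinearMap.continuous_of_finiteDimensional f).measurable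
  have hμ : (μ.map e).IsAddHaarMeasure := ContinuousLinearEquiv.isAddHaarMeasure_map e μ
  have h2 := congrArg (Measure.map e.symm)
    (Measure.map_linearMap_addHaar_eq_smul_addHaar (μ.map e) hf)
  have e1 : (e.symm ∘ f) ∘ e = T := by
    ext1 x
    simp [hfe]
  have e2 : e.symm ∘ e = id := by
    ext1 x
    exact e.symm_apply_apply x
  rw [Measure.map_map he' hfm, Measure.map_map (he'.comp hfm) he, e1, Measure.map_smul,
    Measure.map_map he' he, e2, Measure.map_id, hdet, abs_inv] at h2
  exact h2

/-- If `g` preserves the lattices `N ≤ L` and acts on `L / N` with determinant `d`, then it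
multiplies the Haar measures on `L / N` by `|N(d)|⁻¹`, where `N` is the norm of `𝕜` over `ℝ`. -/
theorem factor_smul_of_stable (g : Matrix.GeneralLinearGroup (Fin n) (LaurentSeries 𝕜))
    (τ : HaarTheory 𝕜 n) {N L : OLattice 𝕜 n} (hNL : N ≤ L)
    (hN : ∀ x ∈ N.1, glLin g x ∈ N.1) (hL : ∀ x ∈ L.1, glLin g x ∈ L.1)
    (hgN : g • N = N) (hgL : g • L = L)
    (hdet : LinearMap.det (SubQuot.map (glLin g).toLinearMap hN hL) ≠ 0) :
    (factor τ (g • τ) N L hNL : ℝ) =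
      |Algebra.norm ℝ (LinearMap.det (SubQuot.map (glLin g).toLinearMap hN hL))|⁻¹ := by
  rw [factor_eq_of_smul (c := (|Algebra.norm ℝ (LinearMap.det
    (SubQuot.map (glLin g).toLinearMap hN hL))|⁻¹).toNNReal), Real.coe_toNNReal _ (by positivity)]
  have h1 := map_eq_smul_of_equiv (subQuotEquiv N L) _ hdet
    (τ.meas N L hNL)
  rw [← h1, smul_meas]
  exact (map_meas_congr τ (inv_smul_eq_iff.mpr hgN.symm) (inv_smul_eq_iff.mpr hgL.symm) hNL
    (OLattice.smul_le_smul g⁻¹ hNL) _ _ rfl hN hL (N.glLin_mem g) (L.glLin_mem g)).symm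

theorem OLattice.glLin_mem_of_smul_eq {g : Matrix.GeneralLinearGroup (Fin n) (LaurentSeries 𝕜)}
    {L : OLattice 𝕜 n} (h : g • L = L) : ∀ x ∈ L.1, glLin g x ∈ L.1 := fun x hx => by
  have : glLin g x ∈ (g • L).1 := ⟨x, hx, rfl⟩
  rwa [h] at this

theorem det_eq_one_of_isNilpotent {V : Type*} [AddCommGroup V] [Module 𝕜 V] [Module.Finite 𝕜 V]
    {T : V →ₗ[𝕜] V} (hT : IsNilpotent (T - 1)) : LinearMap.det T = 1 := by
  -- `det T` is the value at `1` of the characteristic polynomial of `1 - T`.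
  have hc := IsNilpotent.charpoly_eq_X_pow_finrank (φ := -(T - 1)) hT.neg
  have h2 := congrArg (Polynomial.eval 1) hc
  rw [LinearMap.eval_charpoly] at h2
  simpa using h2

/-- Unipotent elements preserve the Haar measures on `L / N`. -/
theorem factor_smul_of_unipotent {g : Matrix.GeneralLinearGroup (Fin n) (LaurentSeries 𝕜)}
    (hg : (g.val - 1) * (g.val - 1) = 0) (τ : HaarTheory 𝕜 n) {N L : OLattice 𝕜 n} (hNL : N ≤ L)
    (hgN : g • N = N) (hgL : g • L = L) : (factor τ (g • τ) N L hNL : ℝ) = 1 := by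
  have hd : LinearMap.det (SubQuot.map (glLin g).toLinearMap (OLattice.glLin_mem_of_smul_eq hgN)
      (OLattice.glLin_mem_of_smul_eq hgL)) = 1 := by
    refine det_eq_one_of_isNilpotent ⟨2, LinearMap.ext fun x => ?_⟩
    obtain ⟨x, rfl⟩ := SubQuot.mk_surjective x
    rw [pow_two]
    have hx : glLin g (glLin g x.1 - x.1) - (glLin g x.1 - x.1) = 0 := by
      have e := congrArg (fun M => M.mulVec x.1) hg
      simp only [← Matrix.mulVec_mulVec, Matrix.sub_mulVec, Matrix.one_mulVec,
        Matrix.zero_mulVec] at e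
      exact e
    have : (SubQuot.mk N.1 (0 : L.1)) = 0 := rfl
    rw [LinearMap.zero_apply, ← this]
    exact congrArg (SubQuot.mk N.1) (Subtype.ext hx)
  rw [factor_smul_of_stable g τ hNL _ _ hgN hgL (by rw [hd]; exact one_ne_zero), hd, map_one,
    abs_one, inv_one]

/-! ### Diagonal matrices and diagonal lattices -/

/-- The diagonal matrices in `GL_n(K)`. -/
def diagGL {K : Type*} [Field K] (n : ℕ) : (Fin n → Kˣ) →* Matrix.GeneralLinearGroup (Fin n) K where
  toFun d := ⟨Matrix.diagonal fun i => (d i : K), Matrix.diagonal fun i => ((d i)⁻¹ : Kˣ),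
    by simp [Matrix.diagonal_mul_diagonal], by simp [Matrix.diagonal_mul_diagonal]⟩
  map_one' := Units.ext (by simp)
  map_mul' d e := Units.ext (by simp [Matrix.diagonal_mul_diagonal])

theorem diagGL_val {K : Type*} [Field K] (d : Fin n → Kˣ) :
    (diagGL n d).val = Matrix.diagonal fun i => (d i : K) := rfl

theorem glLin_diagGL (d : Fin n → (LaurentSeries 𝕜)ˣ) (v : Fin n → LaurentSeries 𝕜) (i : Fin n) :
    glLin (diagGL n d) v i = d i * v i := by
  rw [glLin_apply, diagGL_val, Matrix.mulVec_diagonal]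

theorem diagGL_const_comm {K : Type*} [Field K] (c : Kˣ)
    (g : Matrix.GeneralLinearGroup (Fin n) K) :
    diagGL n (fun _ => c) * g = g * diagGL n (fun _ => c) := by
  refine Units.ext (Matrix.ext fun i j => ?_)
  rw [Units.val_mul, Units.val_mul, diagGL_val, Matrix.diagonal_mul, Matrix.mul_diagonal, mul_comm]

/-- The element `t^k` of `K^*`. -/
noncomputable def tPow (𝕜 : Type) [RCLike 𝕜] (k : ℤ) : (LaurentSeries 𝕜)ˣ where
  val := HahnSeries.single k 1
  inv := HahnSeries.single (-k) 1
  val_inv := by rw [HahnSeries.single_mul_single]; simp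
  inv_val := by rw [HahnSeries.single_mul_single]; simp

theorem tPow_inv (k : ℤ) : (tPow 𝕜 k)⁻¹ = tPow 𝕜 (-k) := Units.ext rfl

/-- The lattice of the vectors with `v_i ∈ t^(w_i) O`. -/
noncomputable def diagLattice (w : Fin n → ℤ) : OLattice 𝕜 n :=
  diagGL n (fun i => tPow 𝕜 (w i)) • stdLattice 𝕜 n

theorem OLattice.mem_smul {g : Matrix.GeneralLinearGroup (Fin n) (LaurentSeries 𝕜)}
    {L : OLattice 𝕜 n} {v : Fin n → LaurentSeries 𝕜} : v ∈ (g • L).1 ↔ glLin g⁻¹ v ∈ L.1 :=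
  mem_map_glLin

theorem mem_stdLattice {v : Fin n → LaurentSeries 𝕜} :
    v ∈ (stdLattice 𝕜 n).1 ↔ ∀ i, ∀ m < 0, (v i).coeff m = 0 := Iff.rfl

theorem mem_diagLattice {w : Fin n → ℤ} {v : Fin n → LaurentSeries 𝕜} :
    v ∈ (diagLattice (𝕜 := 𝕜) w).1 ↔ ∀ i, ∀ m < w i, (v i).coeff m = 0 := by
  rw [diagLattice, OLattice.mem_smul, mem_stdLattice, ← map_inv]
  refine forall_congr' fun i => ?_
  rw [glLin_diagGL, Pi.inv_apply, tPow_inv]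
  change (∀ m < 0, ((HahnSeries.single (-w i) (1 : 𝕜)) * v i).coeff m = 0) ↔ _
  simp only [HahnSeries.coeff_single_mul, one_mul, sub_neg_eq_add]
  exact ⟨fun H m hm => by simpa using H (m - w i) (by omega), fun H m hm => H _ (by omega)⟩

theorem OLattice.smul_eq_of_forall {g : Matrix.GeneralLinearGroup (Fin n) (LaurentSeries 𝕜)}
    {L : OLattice 𝕜 n} (h : ∀ v ∈ L.1, glLin g v ∈ L.1) (h' : ∀ v ∈ L.1, glLin g⁻¹ v ∈ L.1) :
    g • L = L := by
  refine Subtype.ext (Submodule.ext fun v => ?_)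
  rw [mem_smul]
  refine ⟨fun hv => ?_, h' v⟩
  have := h _ hv
  rw [map_inv] at this
  simpa using this

/-- Any two lattices which are stable under `g` contain a common lattice which is stable. -/
theorem OLattice.exists_stable_le {g : Matrix.GeneralLinearGroup (Fin n) (LaurentSeries 𝕜)}
    (L L' : OLattice 𝕜 n) (hL' : g • L' = L') : ∃ N, N ≤ L ∧ N ≤ L' ∧ g • N = N := by
  obtain ⟨a, ha⟩ : ∃ a : Matrix.GeneralLinearGroup (Fin n) (LaurentSeries 𝕜),
      L' = a • stdLattice 𝕜 n := by
    obtain ⟨L', a, rfl⟩ := L'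
    exact ⟨a, rfl⟩
  obtain ⟨b, hb⟩ := (a⁻¹ • L).exists_fil_le
  have hfil : ∀ k : ℤ, (diagLattice (𝕜 := 𝕜) (n := n) fun _ => k).1 = laurentFil 𝕜 n k := fun k =>
    Submodule.ext fun v => mem_diagLattice
  have hz : diagGL n (fun _ => tPow 𝕜 (max b 0)) • L' = a • diagLattice fun _ => max b 0 := by
    rw [ha, smul_smul, diagGL_const_comm, mul_smul]
    rfl
  -- `t^k L'` is stable since scalar matrices commute with `g`; `k = max b 0` makes it small enough.
  refine ⟨diagGL n (fun _ => tPow 𝕜 (max b 0)) • L', ?_, ?_, ?_⟩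
  · rw [hz]
    have h1 : diagLattice (𝕜 := 𝕜) (n := n) (fun _ => max b 0) ≤ a⁻¹ • L := fun v hv => by
      rw [hfil] at hv
      exact hb _ (le_max_left _ _) hv
    simpa using OLattice.smul_le_smul a h1
  · rw [hz, ha]
    refine OLattice.smul_le_smul a fun v hv => ?_
    rw [hfil] at hv
    exact fun i m hm => hv i m (hm.trans_le (le_max_right _ _))
  · rw [smul_smul, ← diagGL_const_comm, mul_smul, hL']

/-! ### Canonical lifts -/

/-- If `g` stabilizes `L` and `ρ ∈ μ(O^n | L)`, then `ρ g ρ⁻¹ = (g, ρ ⊗ g(ρ)⁻¹)` belongs to `GL_n(K)~`. -/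
theorem conj_mem_glTilde {L : OLattice 𝕜 n} {ρ : HaarTheory 𝕜 n → PosReal}
    (hρ : ρ ∈ RelHaar (stdLattice 𝕜 n) L)
    {g : Matrix.GeneralLinearGroup (Fin n) (LaurentSeries 𝕜)} (hg : g • L = L) :
    (SemidirectProduct.inl ρ * SemidirectProduct.inr g * (SemidirectProduct.inl ρ)⁻¹ :
      (HaarTheory 𝕜 n → PosReal) ⋊[mulAutArrow] Matrix.GeneralLinearGroup (Fin n) _) ∈
        GLTilde 𝕜 n := by
  have h1 := RelHaar.smul_mem g (RelHaar.inv_mem hρ)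
  rw [hg] at h1
  have h2 := RelHaar.mul_mem hρ h1
  rw [mem_GLTilde]
  simpa using h2

/-- The canonical lift of `g` to `GL_n(K)~` for a lattice `L` with `g L = L`: it is `(g, ρ ⊗ g(ρ)⁻¹)`
for any `ρ ∈ μ(O^n | L)`. -/
noncomputable def canonLift (g : Matrix.GeneralLinearGroup (Fin n) (LaurentSeries 𝕜))
    (L : OLattice 𝕜 n) (hg : g • L = L) : GLTilde 𝕜 n :=
  ⟨_, conj_mem_glTilde (RelHaar.nonempty (stdLattice 𝕜 n) L).some_mem hg⟩

theorem glTildeProj_canonLift (g : Matrix.GeneralLinearGroup (Fin n) (LaurentSeries 𝕜))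
    (L : OLattice 𝕜 n) (hg : g • L = L) : glTildeProj 𝕜 n (canonLift g L hg) = g := by
  change 1 * g * _ = g
  rw [one_mul]
  exact mul_one g

theorem canonLift_mul {g g' : Matrix.GeneralLinearGroup (Fin n) (LaurentSeries 𝕜)}
    {L : OLattice 𝕜 n} (hg : g • L = L) (hg' : g' • L = L) (h : (g * g') • L = L) :
    canonLift (g * g') L h = canonLift g L hg * canonLift g' L hg' := by
  refine Subtype.ext ?_
  rw [Subgroup.coe_mul]
  simp only [canonLift]
  rw [map_mul]
  group

theorem canonLift_congr {g g' : Matrix.GeneralLinearGroup (Fin n) (LaurentSeries 𝕜)}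
    {L : OLattice 𝕜 n} (h : g = g') (hg : g • L = L) (hg' : g' • L = L) :
    canonLift g L hg = canonLift g' L hg' := by
  subst h
  rfl

theorem canonLift_one {L : OLattice 𝕜 n} (h : (1 : Matrix.GeneralLinearGroup (Fin n) _) • L = L) :
    canonLift 1 L h = 1 := by
  refine Subtype.ext ?_
  rw [Subgroup.coe_one]
  simp only [canonLift]
  rw [map_one, mul_one, mul_inv_cancel]

theorem canonLift_commutator {g g' : Matrix.GeneralLinearGroup (Fin n) (LaurentSeries 𝕜)}
    {L : OLattice 𝕜 n} (hg : g • L = L) (hg' : g' • L = L) (h : ⁅g, g'⁆ • L = L) :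
    canonLift ⁅g, g'⁆ L h = ⁅canonLift g L hg, canonLift g' L hg'⁆ := by
  refine Subtype.ext ?_
  rw [← Subgroup.coe_subtype, map_commutatorElement, Subgroup.coe_subtype]
  simp only [canonLift]
  rw [map_commutatorElement, commutatorElement_def, commutatorElement_def]
  group

/-- The lifts `ρ g ρ⁻¹` and `ρ' g ρ'⁻¹` agree if `g` fixes the elements of `μ(L | L')`. -/
theorem conj_inl_eq {L L' : OLattice 𝕜 n} {ρ ρ' : HaarTheory 𝕜 n → PosReal}
    (hρ : ρ ∈ RelHaar (stdLattice 𝕜 n) L) (hρ' : ρ' ∈ RelHaar (stdLattice 𝕜 n) L')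
    {g : Matrix.GeneralLinearGroup (Fin n) (LaurentSeries 𝕜)}
    (H : ∀ σ ∈ RelHaar L L', ∀ τ, σ (g⁻¹ • τ) = σ τ) :
    (SemidirectProduct.inl ρ * SemidirectProduct.inr g * (SemidirectProduct.inl ρ)⁻¹ :
      (HaarTheory 𝕜 n → PosReal) ⋊[mulAutArrow] Matrix.GeneralLinearGroup (Fin n) _) =
    SemidirectProduct.inl ρ' * SemidirectProduct.inr g * (SemidirectProduct.inl ρ')⁻¹ := by
  have hσ := H _ (RelHaar.mul_mem (RelHaar.inv_mem hρ) hρ')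
  refine SemidirectProduct.ext (funext fun τ => ?_) (by simp)
  have e := hσ τ
  simp only [Pi.mul_apply, Pi.inv_apply] at e
  have : ∀ r : HaarTheory 𝕜 n → PosReal, (SemidirectProduct.inl r * SemidirectProduct.inr g *
      (SemidirectProduct.inl r)⁻¹ : (HaarTheory 𝕜 n → PosReal) ⋊[mulAutArrow]
        Matrix.GeneralLinearGroup (Fin n) _).left τ = r τ * (r (g⁻¹ • τ))⁻¹ := by
    intro r
    rw [← map_inv]
    simp
    rfl
  rw [this, this]
  rw [inv_mul_eq_iff_eq_mul] at e
  rw [e]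
  group

/-- The canonical lift may be computed with any `ρ ∈ μ(O^n | L)`. -/
theorem canonLift_val {L : OLattice 𝕜 n} {ρ : HaarTheory 𝕜 n → PosReal}
    (hρ : ρ ∈ RelHaar (stdLattice 𝕜 n) L)
    (g : Matrix.GeneralLinearGroup (Fin n) (LaurentSeries 𝕜)) (hg : g • L = L) :
    (canonLift g L hg).1 =
      SemidirectProduct.inl ρ * SemidirectProduct.inr g * (SemidirectProduct.inl ρ)⁻¹ :=
  conj_inl_eq (RelHaar.nonempty (stdLattice 𝕜 n) L).some_mem hρ fun _ hσ _ =>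
    RelHaar.eq_const hσ _ _

/-- The canonical lift of a unipotent element does not depend on the lattice. -/
theorem canonLift_eq_of_unipotent {g : Matrix.GeneralLinearGroup (Fin n) (LaurentSeries 𝕜)}
    (hu : (g.val - 1) * (g.val - 1) = 0) {L L' : OLattice 𝕜 n} (hg : g • L = L)
    (hg' : g • L' = L') : canonLift g L hg = canonLift g L' hg' := by
  have hρ := (RelHaar.nonempty (stdLattice 𝕜 n) L).some_mem
  have hρ' := (RelHaar.nonempty (stdLattice 𝕜 n) L').some_mem
  refine Subtype.ext ?_
  rw [canonLift_val hρ, canonLift_val hρ']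
  refine conj_inl_eq hρ hρ' fun σ hσ τ => ?_
  obtain ⟨N, hNL, hNL', hN⟩ := L.exists_stable_le L' hg'
  have e := hσ (g⁻¹ • τ) τ N hNL hNL'
  have f1 := factor_smul_of_unipotent hu (g⁻¹ • τ) hNL hN hg
  have f2 := factor_smul_of_unipotent hu (g⁻¹ • τ) hNL' hN hg'
  rw [smul_inv_smul] at f1 f2
  rw [f1, f2, mul_one, mul_one] at e
  exact Subtype.ext e.symm

/-- The conjugate of a canonical lift by a lift of `h` is the canonical lift of `h g h⁻¹` for `h L`. -/
theorem conj_canonLift (x : GLTilde 𝕜 n)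
    (g : Matrix.GeneralLinearGroup (Fin n) (LaurentSeries 𝕜)) (L : OLattice 𝕜 n) (hg : g • L = L) :
    x * canonLift g L hg * x⁻¹ =
      canonLift (glTildeProj 𝕜 n x * g * (glTildeProj 𝕜 n x)⁻¹) (glTildeProj 𝕜 n x • L)
        (by rw [smul_smul, inv_mul_cancel_right, mul_smul, hg]) := by
  have hρ := (RelHaar.nonempty (stdLattice 𝕜 n) L).some_mem
  set ρ := (RelHaar.nonempty (stdLattice 𝕜 n) L).some
  have hx := RelHaar.mul_mem (mem_GLTilde.mp x.2) (RelHaar.smul_mem x.1.right hρ)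
  refine Subtype.ext ?_
  rw [Subgroup.coe_mul, Subgroup.coe_mul, Subgroup.coe_inv, canonLift_val hρ]
  rw [canonLift_val (L := glTildeProj 𝕜 n x • L) hx]
  have hxe : x.1 = SemidirectProduct.inl x.1.left * SemidirectProduct.inr x.1.right :=
    (SemidirectProduct.inl_left_mul_inr_right x.1).symm
  have hr : glTildeProj 𝕜 n x = x.1.right := rfl
  have ha := SemidirectProduct.inl_aut (φ := mulAutArrow
    (G := Matrix.GeneralLinearGroup (Fin n) (LaurentSeries 𝕜)) (A := HaarTheory 𝕜 n)
    (M := PosReal)) x.1.right ρ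
  rw [hr, map_mul SemidirectProduct.inl, ha]
  generalize x.1.left = a at *
  generalize x.1.right = b at *
  rw [hxe]
  simp only [map_mul, map_inv]
  group

theorem stabSemi_inl (h : n ≤ m) (r : HaarTheory 𝕜 n → PosReal) :
    stabSemi 𝕜 h (SemidirectProduct.inl r) = SemidirectProduct.inl fun τ => r (τ.res h) :=
  SemidirectProduct.map_inl _ _ _ r

theorem stabSemi_inr (h : n ≤ m) (g : Matrix.GeneralLinearGroup (Fin n) (LaurentSeries 𝕜)) :
    stabSemi 𝕜 h (SemidirectProduct.inr g) = SemidirectProduct.inr (stabGL h g) :=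
  SemidirectProduct.map_inr _ _ _ g

/-- Canonical lifts are compatible with the stabilization. -/
theorem stabTilde_canonLift (h : n ≤ m)
    (g : Matrix.GeneralLinearGroup (Fin n) (LaurentSeries 𝕜)) (L : OLattice 𝕜 n) (hg : g • L = L) :
    stabTilde 𝕜 h (canonLift g L hg) =
      canonLift (stabGL h g) (L.ext h) (by rw [← OLattice.ext_smul, hg]) := by
  have hρ := (RelHaar.nonempty (stdLattice 𝕜 n) L).some_mem
  have hρ' := RelHaar.res_mem h hρ
  rw [OLattice.ext_std] at hρ'
  refine Subtype.ext ?_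
  rw [canonLift_val hρ']
  change stabSemi 𝕜 h (canonLift g L hg).1 = _
  rw [canonLift_val hρ, map_mul, map_mul, map_inv, stabSemi_inl, stabSemi_inr]

end CanonicalLifts

/-! ### The lift of the Steinberg relations -/

section SteinbergLift

open MeasureTheory HaarTheory
open scoped commutatorElement

section Elementary

variable {K : Type*} [Field K] {n m : ℕ}

theorem elemGL_inv (i j : Fin n) (h : i ≠ j) (a : K) : (elemGL i j h a)⁻¹ = elemGL i j h (-a) :=
  Units.ext rfl

theorem elemGL_mul (i j : Fin n) (h : i ≠ j) (a b : K) :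
    elemGL i j h a * elemGL i j h b = elemGL i j h (a + b) :=
  glInf_injective n (by rw [map_mul, glInf_elemGL, glInf_elemGL, glInf_elemGL, elemInf_add])

theorem elemGL_comm (i j l : Fin n) (hij : i ≠ j) (hjl : j ≠ l) (hil : i ≠ l) (a b : K) :
    ⁅elemGL i j hij a, elemGL j l hjl b⁆ = elemGL i l hil (a * b) :=
  glInf_injective n (by
    rw [map_commutatorElement, glInf_elemGL, glInf_elemGL, glInf_elemGL, elemInf_comm])

theorem elemGL_commute (i j k l : Fin n) (hij : i ≠ j) (hkl : k ≠ l) (hjk : j ≠ k) (hil : i ≠ l)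
    (a b : K) : ⁅elemGL i j hij a, elemGL k l hkl b⁆ = 1 :=
  glInf_injective n (by
    rw [map_commutatorElement, glInf_elemGL, glInf_elemGL, map_one,
      elemInf_commute _ _ _ _ _ _ (fun e => hjk (Fin.ext e)) (fun e => hil (Fin.ext e))])

theorem stabGL_elemGL (h : n ≤ m) (i j : Fin n) (hij : i ≠ j) (a : K) :
    stabGL h (elemGL i j hij a) =
      elemGL (Fin.castLE h i) (Fin.castLE h j) (fun e => hij (Fin.castLE_injective h e)) a :=
  glInf_injective m (by rw [glInf_stabGL, glInf_elemGL, glInf_elemGL]; rfl)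

theorem elemGL_unipotent (i j : Fin n) (h : i ≠ j) (a : K) :
    ((elemGL i j h a).val - 1) * ((elemGL i j h a).val - 1) = 0 := by
  change (Matrix.transvection i j a - 1) * (Matrix.transvection i j a - 1) = 0
  rw [Matrix.transvection, add_sub_cancel_left, Matrix.single_mul_single_of_ne _ _ _ _ h.symm]

end Elementary

variable {𝕜 : Type} [RCLike 𝕜] {n m : ℕ}

theorem glLin_elemGL (i j : Fin n) (h : i ≠ j) (a : LaurentSeries 𝕜) (v : Fin n → LaurentSeries 𝕜)
    (k : Fin n) : glLin (elemGL i j h a) v k = v k + if k = i then a * v j else 0 := by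
  rw [glLin_apply]
  change (Matrix.transvection i j a).mulVec v k = _
  rw [Matrix.transvection, Matrix.add_mulVec, Matrix.one_mulVec, Pi.add_apply,
    Matrix.single_mulVec]
  by_cases hk : k = i
  · subst hk
    simp
  · simp [hk]

theorem elemGL_mem_diagLattice {i j : Fin n} (h : i ≠ j) {a : LaurentSeries 𝕜} {w : Fin n → ℤ}
    (ha : ∀ m < w i - w j, a.coeff m = 0) :
    ∀ v ∈ (diagLattice (𝕜 := 𝕜) w).1, glLin (elemGL i j h a) v ∈ (diagLattice (𝕜 := 𝕜) w).1 := by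
  intro v hv
  rw [mem_diagLattice] at hv ⊢
  intro k m hm
  rw [glLin_elemGL, HahnSeries.coeff_add, hv k m hm, zero_add]
  split_ifs with hk
  · subst hk
    exact coeff_mul_of_lt _ _ _ _ ha (hv j) m (by omega)
  · simp

/-- The elementary matrix `1 + a E_ij` stabilizes the lattice `⨁ t^(w_k) O` if `a` lies in
`t^(w_i - w_j) O`. -/
theorem elemGL_smul_diagLattice {i j : Fin n} (h : i ≠ j) {a : LaurentSeries 𝕜} {w : Fin n → ℤ}
    (ha : ∀ m < w i - w j, a.coeff m = 0) :
    elemGL i j h a • diagLattice (𝕜 := 𝕜) w = diagLattice w := by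
  refine OLattice.smul_eq_of_forall (elemGL_mem_diagLattice h ha) ?_
  rw [elemGL_inv]
  exact elemGL_mem_diagLattice h fun m hm => by rw [HahnSeries.coeff_neg, ha m hm, neg_zero]

theorem elemGL_smul_single {i j : Fin n} (h : i ≠ j) (a : LaurentSeries 𝕜) :
    elemGL i j h a • diagLattice (𝕜 := 𝕜) (Pi.single i a.order) =
      diagLattice (Pi.single i a.order) :=
  elemGL_smul_diagLattice h fun m hm => HahnSeries.coeff_eq_zero_of_lt_order (by
    simpa [h.symm] using hm)

/-- The canonical lift of the elementary matrix `1 + a E_ij` to `GL_n(K)~`. The lattice with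
`t^(ord a) O` in the place `i` is one that it stabilizes; the choice does not matter by
`elemLift_eq`. -/
noncomputable def elemLift (i j : Fin n) (h : i ≠ j) (a : LaurentSeries 𝕜) : GLTilde 𝕜 n :=
  canonLift (elemGL i j h a) (diagLattice (Pi.single i a.order)) (elemGL_smul_single h a)

theorem elemLift_eq (i j : Fin n) (h : i ≠ j) (a : LaurentSeries 𝕜) (L : OLattice 𝕜 n)
    (hL : elemGL i j h a • L = L) : elemLift i j h a = canonLift (elemGL i j h a) L hL :=
  canonLift_eq_of_unipotent (elemGL_unipotent i j h a) _ hL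

theorem glTildeProj_elemLift (i j : Fin n) (h : i ≠ j) (a : LaurentSeries 𝕜) :
    glTildeProj 𝕜 n (elemLift i j h a) = elemGL i j h a := glTildeProj_canonLift _ _ _

theorem stabTilde_elemLift (h : n ≤ m) (i j : Fin n) (hij : i ≠ j) (a : LaurentSeries 𝕜) :
    stabTilde 𝕜 h (elemLift i j hij a) =
      elemLift (Fin.castLE h i) (Fin.castLE h j) (fun e => hij (Fin.castLE_injective h e)) a := by
  have hs : elemGL (Fin.castLE h i) (Fin.castLE h j) (fun e => hij (Fin.castLE_injective h e)) a •
      (diagLattice (𝕜 := 𝕜) (Pi.single i a.order)).ext h =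
        (diagLattice (𝕜 := 𝕜) (Pi.single i a.order)).ext h := by
    rw [← stabGL_elemGL h i j hij, ← OLattice.ext_smul, elemGL_smul_single]
  rw [elemLift_eq _ _ _ _ _ hs, elemLift, stabTilde_canonLift]
  exact canonLift_congr (stabGL_elemGL h i j hij a) _ _

theorem coeff_eq_zero_of_lt {a : LaurentSeries 𝕜} {k : ℤ} (hk : k ≤ a.order) :
    ∀ m < k, a.coeff m = 0 := fun _ hm => HahnSeries.coeff_eq_zero_of_lt_order (hm.trans_le hk)

/-- Both matrices stabilize the lattice with the weight `min (ord a) (ord b)` in the place `i`. -/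
theorem elemLift_mul (i j : Fin n) (h : i ≠ j) (a b : LaurentSeries 𝕜) :
    elemLift i j h a * elemLift i j h b = elemLift i j h (a + b) := by
  have hw : Pi.single (M := fun _ => ℤ) i (min a.order b.order) i -
      Pi.single (M := fun _ => ℤ) i (min a.order b.order) j = min a.order b.order := by
    simp [h.symm]
  have ha := elemGL_smul_diagLattice h (a := a) (w := Pi.single i (min a.order b.order)) (by
    rw [hw]; exact coeff_eq_zero_of_lt (min_le_left _ _))
  have hb := elemGL_smul_diagLattice h (a := b) (w := Pi.single i (min a.order b.order)) (by
    rw [hw]; exact coeff_eq_zero_of_lt (min_le_right _ _))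
  have hab : (elemGL i j h a * elemGL i j h b) • diagLattice (𝕜 := 𝕜)
      (Pi.single i (min a.order b.order)) = diagLattice (Pi.single i (min a.order b.order)) := by
    rw [mul_smul, hb, ha]
  rw [elemLift_eq i j h a _ ha, elemLift_eq i j h b _ hb, ← canonLift_mul ha hb hab,
    elemLift_eq i j h (a + b) _ (by rw [← elemGL_mul, hab])]
  exact canonLift_congr (elemGL_mul i j h a b) _ _

/-- The matrices stabilize the lattice with the weights `ord a + ord b`, `ord b` and `0` in the places
`i`, `j` and `l`. -/
theorem elemLift_comm (i j l : Fin n) (hij : i ≠ j) (hjl : j ≠ l) (hil : i ≠ l)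
    (a b : LaurentSeries 𝕜) :
    ⁅elemLift i j hij a, elemLift j l hjl b⁆ = elemLift i l hil (a * b) := by
  obtain ⟨w, hwi, hwj, hwl⟩ : ∃ w : Fin n → ℤ, w i = a.order + b.order ∧ w j = b.order ∧ w l = 0 :=
    ⟨Pi.single i (a.order + b.order) + Pi.single j b.order, by simp [hij], by simp [hij.symm],
      by simp [hil.symm, hjl.symm]⟩
  have ha := elemGL_smul_diagLattice hij (a := a) (w := w) (coeff_eq_zero_of_lt (by omega))
  have hb := elemGL_smul_diagLattice hjl (a := b) (w := w) (coeff_eq_zero_of_lt (by omega))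
  have hab := elemGL_smul_diagLattice hil (a := a * b) (w := w) (by
    rw [hwi, hwl, sub_zero]
    exact coeff_mul_of_lt _ _ _ _ (coeff_eq_zero_of_lt le_rfl) (coeff_eq_zero_of_lt le_rfl))
  rw [elemLift_eq _ _ _ a _ ha, elemLift_eq _ _ _ b _ hb, elemLift_eq _ _ _ (a * b) _ hab,
    ← canonLift_commutator ha hb (by rw [elemGL_comm i j l hij hjl hil, hab])]
  exact canonLift_congr (elemGL_comm i j l hij hjl hil a b) _ _

/-- The matrices stabilize the lattice with the weight `min (ord a) (ord b)` in the places `i` and `k`;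
the places `j` and `l` are different from these. -/
theorem elemLift_commute (i j k l : Fin n) (hij : i ≠ j) (hkl : k ≠ l) (hjk : j ≠ k) (hil : i ≠ l)
    (a b : LaurentSeries 𝕜) : ⁅elemLift i j hij a, elemLift k l hkl b⁆ = 1 := by
  obtain ⟨w, hwi, hwj, hwk, hwl⟩ : ∃ w : Fin n → ℤ, w i = min a.order b.order ∧ w j = 0 ∧
      w k = min a.order b.order ∧ w l = 0 :=
    ⟨fun x => if x = i ∨ x = k then min a.order b.order else 0, by simp,
      by simp [hij.symm, hjk], by simp, by simp [hil.symm, hkl.symm]⟩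
  have ha := elemGL_smul_diagLattice hij (a := a) (w := w) (coeff_eq_zero_of_lt (by omega))
  have hb := elemGL_smul_diagLattice hkl (a := b) (w := w) (coeff_eq_zero_of_lt (by omega))
  have e := elemGL_commute i j k l hij hkl hjk hil a b
  rw [elemLift_eq _ _ _ a _ ha, elemLift_eq _ _ _ b _ hb,
    ← canonLift_commutator ha hb (by rw [e, one_smul]),
    canonLift_congr e _ (one_smul _ _), canonLift_one]

/-- The image of `x_ij(a)` in the direct limit of the groups `GL_n(K)~`. -/
noncomputable def genLift (x : SteinbergGen (LaurentSeries 𝕜)) : GLTildeInf 𝕜 :=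
  toInf 𝕜 (max x.row x.col + 1)
    (elemLift ⟨x.row, by omega⟩ ⟨x.col, by omega⟩ (fun e => x.ne (Fin.ext_iff.mp e)) x.coef)

theorem toInf_elemLift {n m : ℕ} {i j : Fin n} {i' j' : Fin m} (h : i ≠ j) (h' : i' ≠ j')
    (hi : (i : ℕ) = i') (hj : (j : ℕ) = j') (a : LaurentSeries 𝕜) :
    toInf 𝕜 n (elemLift i j h a) = toInf 𝕜 m (elemLift i' j' h' a) := by
  rw [← toInf_stabTilde (le_max_left n m), ← toInf_stabTilde (le_max_right n m),
    stabTilde_elemLift, stabTilde_elemLift]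
  have e1 : Fin.castLE (le_max_left n m) i = Fin.castLE (le_max_right n m) i' := Fin.ext hi
  have e2 : Fin.castLE (le_max_left n m) j = Fin.castLE (le_max_right n m) j' := Fin.ext hj
  congr 2

/-- `genLift` may be computed in `GL_n(K)~` for any `n` greater than the indices. -/
theorem genLift_eq {i j : ℕ} (h : i ≠ j) (a : LaurentSeries 𝕜) {n : ℕ} (hi : i < n) (hj : j < n) :
    genLift ⟨i, j, h, a⟩ =
      toInf 𝕜 n (elemLift ⟨i, hi⟩ ⟨j, hj⟩ (fun e => h (Fin.ext_iff.mp e)) a) := by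
  refine toInf_elemLift _ _ ?_ ?_ a <;> rfl

/-- The homomorphism from the Steinberg group to the direct limit of the groups `GL_n(K)~` which
sends `x_ij(a)` to the canonical lift of `1 + a E_ij`. -/
noncomputable def stLift (𝕜 : Type) [RCLike 𝕜] : SteinbergGroup (LaurentSeries 𝕜) →* GLTildeInf 𝕜 :=
  SteinbergGroup.lift genLift
    (fun i j h a b => by
      have hi : i < i + j + 1 := by omega
      have hj : j < i + j + 1 := by omega
      rw [genLift_eq h a hi hj, genLift_eq h b hi hj, genLift_eq h (a + b) hi hj, ← map_mul,
        elemLift_mul])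
    (fun i j l hij hjl hil a b => by
      have hi : i < i + j + l + 1 := by omega
      have hj : j < i + j + l + 1 := by omega
      have hl : l < i + j + l + 1 := by omega
      rw [genLift_eq hij a hi hj, genLift_eq hjl b hj hl, genLift_eq hil (a * b) hi hl,
        ← map_commutatorElement, elemLift_comm])
    (fun i j k l hij hkl hjk hil a b => by
      have hi : i < i + j + k + l + 1 := by omega
      have hj : j < i + j + k + l + 1 := by omega
      have hk : k < i + j + k + l + 1 := by omega
      have hl : l < i + j + k + l + 1 := by omega
      rw [genLift_eq hij a hi hj, genLift_eq hkl b hk hl, ← map_commutatorElement,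
        elemLift_commute _ _ _ _ _ _ (fun e => hjk (Fin.ext_iff.mp e))
          (fun e => hil (Fin.ext_iff.mp e)), map_one])

theorem stLift_stX {i j : ℕ} (h : i ≠ j) (a : LaurentSeries 𝕜) {n : ℕ} (hi : i < n) (hj : j < n) :
    stLift 𝕜 (stX i j h a) =
      toInf 𝕜 n (elemLift ⟨i, hi⟩ ⟨j, hj⟩ (fun e => h (Fin.ext_iff.mp e)) a) :=
  (SteinbergGroup.lift_stX _ _ _ _ i j h a).trans (genLift_eq h a hi hj)

theorem infProj_stLift (s : SteinbergGroup (LaurentSeries 𝕜)) :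
    infProj 𝕜 (stLift 𝕜 s) = stToGL _ s := by
  have : (infProj 𝕜).comp (stLift 𝕜) = stToGL (LaurentSeries 𝕜) :=
    SteinbergGroup.hom_ext fun i j h a => by
      rw [MonoidHom.comp_apply, stLift_stX h a (n := i + j + 1) (by omega) (by omega),
        infProj_toInf, glTildeProj_elemLift, glInf_elemGL, stToGL_stX]
  exact DFunLike.congr_fun this s

end SteinbergLift

/-! ### The homomorphism of extensions -/

section Comparison

open MeasureTheory HaarTheory
open scoped commutatorElement

variable {𝕜 : Type} [RCLike 𝕜] {n m : ℕ}

/-- Two elements of the direct limit with the same projection differ by an element of `ℝ_+^*`. -/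
theorem exists_mul_incl_eq {x y : GLTildeInf 𝕜} (h : infProj 𝕜 x = infProj 𝕜 y) (m : ℕ) :
    ∃ c, y = x * toInf 𝕜 m (glTildeIncl 𝕜 m c) := by
  obtain ⟨c, hc⟩ := exists_incl_eq_of_infProj (x := x⁻¹ * y)
    (by rw [map_mul, map_inv, h, inv_mul_cancel]) m
  exact ⟨c, by rw [hc, mul_inv_cancel_left]⟩

/-- If `s ∈ St(K)` and `A ∈ GL_n(K)` have the same image in the automorphisms of `K^(ℕ)`, then the
image of `s` in the direct limit comes from a lift of `A` to `GL_n(K)~`. -/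
theorem exists_toInf_eq_stLift {s : SteinbergGroup (LaurentSeries 𝕜)}
    {A : Matrix.GeneralLinearGroup (Fin n) (LaurentSeries 𝕜)} (h : stToGL _ s = glInf n A) :
    ∃ x : GLTilde 𝕜 n, toInf 𝕜 n x = stLift 𝕜 s ∧ glTildeProj 𝕜 n x = A := by
  obtain ⟨x, rfl⟩ := glTildeProj_surjective A
  obtain ⟨c, hc⟩ := exists_mul_incl_eq (x := toInf 𝕜 n x) (y := stLift 𝕜 s)
    (by rw [infProj_stLift, infProj_toInf, h]) n
  refine ⟨x * glTildeIncl 𝕜 n c, by rw [hc, map_mul], ?_⟩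
  rw [map_mul, glTildeProj_incl, mul_one]

theorem exists_slLift (x : SLTilde (LaurentSeries 𝕜)) :
    ∃ y : GLTilde 𝕜 2, toInf 𝕜 2 y = stLift 𝕜 x.1.1 ∧ glTildeProj 𝕜 2 y = x.1.2 :=
  exists_toInf_eq_stLift (mem_SLTilde.mp x.2).1

/-- The lift of `A` to `GL_2(K)~` which is determined by an element `(s, A)` of `SL_2(K)~`: its image
in the direct limit of the groups `GL_n(K)~` is the image of `s`. -/
noncomputable def slLiftFun (x : SLTilde (LaurentSeries 𝕜)) : GLTilde 𝕜 2 :=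
  (exists_slLift x).choose

theorem toInf_slLiftFun (x : SLTilde (LaurentSeries 𝕜)) :
    toInf 𝕜 2 (slLiftFun x) = stLift 𝕜 x.1.1 := (exists_slLift x).choose_spec.1

theorem glTildeProj_slLiftFun (x : SLTilde (LaurentSeries 𝕜)) :
    glTildeProj 𝕜 2 (slLiftFun x) = x.1.2 := (exists_slLift x).choose_spec.2

theorem slLiftFun_mul (x y : SLTilde (LaurentSeries 𝕜)) :
    slLiftFun (x * y) = slLiftFun x * slLiftFun y := by
  refine toInf_injective ?_
  rw [map_mul, toInf_slLiftFun, toInf_slLiftFun, toInf_slLiftFun, Subgroup.coe_mul, Prod.fst_mul,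
    map_mul]

theorem slLiftFun_mem (x : SLTilde (LaurentSeries 𝕜)) : slLiftFun x ∈ SLPreimage 𝕜 := by
  rw [Subgroup.mem_comap, glTildeProj_slLiftFun]
  exact (mem_SLTilde.mp x.2).2

/-- The homomorphism `SL_2(K)~ → θ⁻¹(SL_2(K))` which is given by `slLiftFun`. -/
noncomputable def slLift (𝕜 : Type) [RCLike 𝕜] : SLTilde (LaurentSeries 𝕜) →* SLPreimage 𝕜 :=
  MonoidHom.mk' (fun x => ⟨slLiftFun x, slLiftFun_mem x⟩) fun x y => Subtype.ext (slLiftFun_mul x y)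

theorem slLift_val (x : SLTilde (LaurentSeries 𝕜)) : (slLift 𝕜 x).1 = slLiftFun x := rfl

/-- The conjugation of the lift of `1 + a E_ij` by a lift of a diagonal matrix. -/
theorem conj_elemLift {D : GLTilde 𝕜 n} {d : ℕ → (LaurentSeries 𝕜)ˣ}
    (hD : IsDiagInf (glInf n (glTildeProj 𝕜 n D)) d) (i j : Fin n) (h : i ≠ j)
    (a : LaurentSeries 𝕜) : D * elemLift i j h a * D⁻¹ =
      elemLift i j h ((d i).val * a * ((d j)⁻¹).val) := by
  have hp : glTildeProj 𝕜 n D * elemGL i j h a * (glTildeProj 𝕜 n D)⁻¹ =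
      elemGL i j h ((d i).val * a * ((d j)⁻¹).val) := by
    refine glInf_injective _ ?_
    rw [map_mul, map_mul, map_inv, glInf_elemGL, glInf_elemGL]
    exact hD.conj_elemInf i j _ a
  rw [elemLift_eq i j h ((d i).val * a * _) (glTildeProj 𝕜 n D • diagLattice (Pi.single i a.order)) (by
    rw [← hp, smul_smul, inv_mul_cancel_right, mul_smul, elemGL_smul_single]), elemLift,
    conj_canonLift]
  exact canonLift_congr hp _ _

theorem stLift_stActHom_stX (y : (LaurentSeries 𝕜)ˣ) {d : GLTilde 𝕜 2}
    (hd : glTildeProj 𝕜 2 d = cornerGL (LaurentSeries 𝕜) y) {i j : ℕ} (h : i ≠ j)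
    (a : LaurentSeries 𝕜) : stLift 𝕜 (stActHom y (stX i j h a)) =
      toInf 𝕜 2 d * stLift 𝕜 (stX i j h a) * (toInf 𝕜 2 d)⁻¹ := by
  obtain ⟨n, hn, hi, hj⟩ : ∃ n, 2 ≤ n ∧ i < n ∧ j < n := ⟨i + j + 2, by omega, by omega, by omega⟩
  have hD : IsDiagInf (glInf n (glTildeProj 𝕜 n (stabTilde 𝕜 hn d))) (cornerWeight y) := by
    rw [glTildeProj_stabTilde, glInf_stabGL, hd]
    exact isDiagInf_cornerGL y
  rw [stActHom_stX, stLift_stX h _ hi hj, stLift_stX h _ hi hj, ← toInf_stabTilde hn,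
    ← map_mul, ← map_inv, ← map_mul, conj_elemLift hD]

theorem stAct_apply {K : Type*} [Field K] (y : Kˣ) (s : SteinbergGroup K) :
    stAct y s = stActHom y s := rfl

/-- The action of `K^*` on the Steinberg group corresponds to the conjugation by a lift of
`diag(y, 1)`. -/
theorem stLift_stAct (y : (LaurentSeries 𝕜)ˣ) {d : GLTilde 𝕜 2}
    (hd : glTildeProj 𝕜 2 d = cornerGL (LaurentSeries 𝕜) y) (s : SteinbergGroup (LaurentSeries 𝕜)) :
    stLift 𝕜 (stAct y s) = toInf 𝕜 2 d * stLift 𝕜 s * (toInf 𝕜 2 d)⁻¹ := by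
  rw [stAct_apply]
  generalize hD : toInf 𝕜 2 d = D
  induction s using SteinbergGroup.induction with
  | one => rw [map_one, map_one, mul_one, mul_inv_cancel]
  | mul s s' hs hs' => rw [map_mul, map_mul, hs, hs', map_mul]; group
  | inv s hs => rw [map_inv, map_inv, hs, map_inv]; group
  | gen i j h a => rw [← hD]; exact stLift_stActHom_stX y hd h a

theorem slLift_slTildeAct (y : (LaurentSeries 𝕜)ˣ) (x : SLTilde (LaurentSeries 𝕜)) :
    slLift 𝕜 (slTildeAct _ y x) = slPreimageAct 𝕜 y (slLift 𝕜 x) := by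
  obtain ⟨d, hd⟩ := glTildeProj_surjective (cornerGL (LaurentSeries 𝕜) y)
  refine Subtype.ext (toInf_injective ?_)
  rw [slPreimageAct_apply 𝕜 y d hd, map_mul, map_mul, map_inv, slLift_val, slLift_val, toInf_slLiftFun,
    toInf_slLiftFun, ← stLift_stAct y hd]
  rfl

/-- The homomorphism `GL_2(K)^ → θ⁻¹(SL_2(K)) ⋊ K^*` which is given by `slLift` on `SL_2(K)~`, and by
the identity on `K^*`. -/
noncomputable def glHatLift (𝕜 : Type) [RCLike 𝕜] : GLHat (LaurentSeries 𝕜) →* GLHatReal 𝕜 :=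
  SemidirectProduct.map (slLift 𝕜) (MonoidHom.id _) fun y => MonoidHom.ext fun x =>
    slLift_slTildeAct y x

theorem exists_kTwo_lift (k : KTwo (LaurentSeries 𝕜)) :
    ∃ c, toInf 𝕜 2 (glTildeIncl 𝕜 2 c) = stLift 𝕜 k.1 :=
  exists_incl_eq_of_infProj (by rw [infProj_stLift]; exact k.2) 2

/-- The homomorphism `K_2(K) → ℝ_+^*` which is induced by `stLift`. -/
noncomputable def kTwoToReal (𝕜 : Type) [RCLike 𝕜] : KTwo (LaurentSeries 𝕜) →* PosReal :=
  MonoidHom.mk' (fun k => (exists_kTwo_lift k).choose) fun k l => by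
    refine glTildeIncl_injective (𝕜 := 𝕜) (n := 2) (toInf_injective ?_)
    rw [(exists_kTwo_lift (k * l)).choose_spec, map_mul, map_mul,
      (exists_kTwo_lift k).choose_spec, (exists_kTwo_lift l).choose_spec, Subgroup.coe_mul, map_mul]

theorem toInf_kTwoToReal (k : KTwo (LaurentSeries 𝕜)) (n : ℕ) :
    toInf 𝕜 n (glTildeIncl 𝕜 n (kTwoToReal 𝕜 k)) = stLift 𝕜 k.1 :=
  (toInf_incl n 2 _).trans (exists_kTwo_lift k).choose_spec

theorem isObtainedBy_kTwoToReal (𝕜 : Type) [RCLike 𝕜] :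
    IsObtainedBy (glHatIncl (LaurentSeries 𝕜)) (glHatProj (LaurentSeries 𝕜)) (kTwoToReal 𝕜)
      (glHatRealIncl 𝕜) (glHatRealProj 𝕜) := by
  refine ⟨glHatLift 𝕜, MonoidHom.ext fun k => ?_, MonoidHom.ext fun x => ?_⟩
  · refine SemidirectProduct.ext (Subtype.ext (toInf_injective ?_)) rfl
    exact (toInf_slLiftFun _).trans (toInf_kTwoToReal k 2).symm
  · change glTildeProj 𝕜 2 (slLift 𝕜 x.left) * cornerGL _ x.right = x.left.1.2 * cornerGL _ x.right
    rw [slLift_val, glTildeProj_slLiftFun]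

end Comparison

/-! ### Commutators of lifts of diagonal matrices -/

section TorusCommutators

open MeasureTheory HaarTheory
open scoped commutatorElement

variable {𝕜 : Type} [RCLike 𝕜] {n : ℕ}

theorem diagGL_comm {K : Type*} [Field K] (d e : Fin n → Kˣ) :
    diagGL n d * diagGL n e = diagGL n e * diagGL n d := by
  rw [← map_mul, mul_comm, map_mul]

theorem exists_eq_mul_incl {x y : GLTilde 𝕜 n} (h : glTildeProj 𝕜 n x = glTildeProj 𝕜 n y) :
    ∃ c, y = x * glTildeIncl 𝕜 n c := by
  obtain ⟨c, hc⟩ := exists_glTildeIncl_eq (x := x⁻¹ * y)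
    (by rw [map_mul, map_inv, h, inv_mul_cancel])
  exact ⟨c, by rw [hc, mul_inv_cancel_left]⟩

/-- The commutator of two elements of `GL_n(K)~` depends only on their images in `GL_n(K)`. -/
theorem commutator_eq_of_proj_eq {x y x' y' : GLTilde 𝕜 n}
    (h : glTildeProj 𝕜 n x = glTildeProj 𝕜 n y) (h' : glTildeProj 𝕜 n x' = glTildeProj 𝕜 n y') :
    ⁅y, y'⁆ = ⁅x, x'⁆ := by
  obtain ⟨c, rfl⟩ := exists_eq_mul_incl h
  obtain ⟨c', rfl⟩ := exists_eq_mul_incl h'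
  exact commutatorElement_mul_central (glTildeIncl_comm c) (glTildeIncl_comm c')

theorem exists_diagComm (d e : Fin n → (LaurentSeries 𝕜)ˣ) :
    ∃ c, ∀ x y : GLTilde 𝕜 n, glTildeProj 𝕜 n x = diagGL n d → glTildeProj 𝕜 n y = diagGL n e →
      ⁅x, y⁆ = glTildeIncl 𝕜 n c := by
  obtain ⟨x₀, hx₀⟩ := glTildeProj_surjective (diagGL n d)
  obtain ⟨y₀, hy₀⟩ := glTildeProj_surjective (diagGL n e)
  obtain ⟨c, hc⟩ := exists_glTildeIncl_eq (x := ⁅x₀, y₀⁆) (by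
    rw [map_commutatorElement, hx₀, hy₀, commutatorElement_eq_one_iff_mul_comm, diagGL_comm])
  exact ⟨c, fun x y hx hy => by
    rw [hc, commutator_eq_of_proj_eq (hx₀.trans hx.symm) (hy₀.trans hy.symm)]⟩

/-- The commutator in `ℝ_+^*` of lifts to `GL_n(K)~` of two diagonal matrices. -/
noncomputable def diagCommFun (d e : Fin n → (LaurentSeries 𝕜)ˣ) : PosReal :=
  (exists_diagComm d e).choose

theorem commutator_eq_diagCommFun {d e : Fin n → (LaurentSeries 𝕜)ˣ} {x y : GLTilde 𝕜 n}
    (hx : glTildeProj 𝕜 n x = diagGL n d) (hy : glTildeProj 𝕜 n y = diagGL n e) :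
    ⁅x, y⁆ = glTildeIncl 𝕜 n (diagCommFun d e) := (exists_diagComm d e).choose_spec x y hx hy

theorem diagCommFun_eq {d e : Fin n → (LaurentSeries 𝕜)ˣ} {x y : GLTilde 𝕜 n}
    (hx : glTildeProj 𝕜 n x = diagGL n d) (hy : glTildeProj 𝕜 n y = diagGL n e) {c : PosReal}
    (h : ⁅x, y⁆ = glTildeIncl 𝕜 n c) : diagCommFun d e = c :=
  glTildeIncl_injective ((commutator_eq_diagCommFun hx hy).symm.trans h)

theorem diagCommFun_mul (d d' e : Fin n → (LaurentSeries 𝕜)ˣ) :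
    diagCommFun (d * d') e = diagCommFun d e * diagCommFun d' e := by
  obtain ⟨x, hx⟩ := glTildeProj_surjective (diagGL n d)
  obtain ⟨x', hx'⟩ := glTildeProj_surjective (diagGL n d')
  obtain ⟨y, hy⟩ := glTildeProj_surjective (diagGL n e)
  refine diagCommFun_eq (x := x * x') (by rw [map_mul, hx, hx', map_mul]) hy ?_
  have key : ⁅x * x', y⁆ = x * ⁅x', y⁆ * x⁻¹ * ⁅x, y⁆ := by
    rw [commutatorElement_def, commutatorElement_def, commutatorElement_def]
    group
  rw [key, commutator_eq_diagCommFun hx' hy, commutator_eq_diagCommFun hx hy, ← glTildeIncl_comm _ x,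
    mul_inv_cancel_right, ← map_mul, mul_comm]

theorem diagCommFun_swap (d e : Fin n → (LaurentSeries 𝕜)ˣ) :
    diagCommFun d e = (diagCommFun e d)⁻¹ := by
  obtain ⟨x, hx⟩ := glTildeProj_surjective (diagGL n d)
  obtain ⟨y, hy⟩ := glTildeProj_surjective (diagGL n e)
  refine diagCommFun_eq hx hy ?_
  rw [map_inv, ← commutator_eq_diagCommFun hy hx, commutatorElement_inv]

/-- The commutator pairing on the diagonal matrices. -/
noncomputable def diagComm (𝕜 : Type) [RCLike 𝕜] (n : ℕ) :
    (Fin n → (LaurentSeries 𝕜)ˣ) →* (Fin n → (LaurentSeries 𝕜)ˣ) →* PosReal :=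
  MonoidHom.mk' (fun d => MonoidHom.mk' (diagCommFun d) fun e e' => by
    rw [diagCommFun_swap, diagCommFun_mul, mul_inv, ← diagCommFun_swap, ← diagCommFun_swap])
    fun d d' => MonoidHom.ext fun e => diagCommFun_mul d d' e

theorem diagComm_eq {d e : Fin n → (LaurentSeries 𝕜)ˣ} {x y : GLTilde 𝕜 n}
    (hx : glTildeProj 𝕜 n x = diagGL n d) (hy : glTildeProj 𝕜 n y = diagGL n e) {c : PosReal}
    (h : ⁅x, y⁆ = glTildeIncl 𝕜 n c) : diagComm 𝕜 n d e = c := diagCommFun_eq hx hy h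

theorem commutator_eq_diagComm {d e : Fin n → (LaurentSeries 𝕜)ˣ} {x y : GLTilde 𝕜 n}
    (hx : glTildeProj 𝕜 n x = diagGL n d) (hy : glTildeProj 𝕜 n y = diagGL n e) :
    ⁅x, y⁆ = glTildeIncl 𝕜 n (diagComm 𝕜 n d e) := commutator_eq_diagCommFun hx hy

theorem diagComm_swap (d e : Fin n → (LaurentSeries 𝕜)ˣ) :
    diagComm 𝕜 n d e = (diagComm 𝕜 n e d)⁻¹ := diagCommFun_swap d e

/-- Matrices that preserve a common lattice have commuting lifts. -/
theorem diagComm_eq_one_of_stable {d e : Fin n → (LaurentSeries 𝕜)ˣ} {L : OLattice 𝕜 n}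
    (hd : diagGL n d • L = L) (he : diagGL n e • L = L) : diagComm 𝕜 n d e = 1 := by
  refine diagComm_eq (glTildeProj_canonLift _ L hd) (glTildeProj_canonLift _ L he) ?_
  have h : ⁅diagGL n d, diagGL n e⁆ = 1 := by
    rw [commutatorElement_eq_one_iff_mul_comm, diagGL_comm]
  rw [← canonLift_commutator hd he (by rw [h, one_smul]), canonLift_congr h _ (one_smul _ _),
    canonLift_one, map_one]

/-- The permutation matrices. -/
noncomputable def permGL {K : Type*} [Field K] (σ : Equiv.Perm (Fin n)) :
    Matrix.GeneralLinearGroup (Fin n) K where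
  val := σ.permMatrix K
  inv := (σ⁻¹).permMatrix K
  val_inv := by rw [← Matrix.permMatrix_mul, inv_mul_cancel, Matrix.permMatrix_one]
  inv_val := by rw [← Matrix.permMatrix_mul, mul_inv_cancel, Matrix.permMatrix_one]

theorem permGL_conj {K : Type*} [Field K] (σ : Equiv.Perm (Fin n)) (d : Fin n → Kˣ) :
    permGL σ * diagGL n d * (permGL σ)⁻¹ = diagGL n (d ∘ σ) := by
  rw [mul_inv_eq_iff_eq_mul]
  refine Units.ext (Matrix.mulVec_injective (funext fun v => funext fun i => ?_))
  change (σ.permMatrix K * Matrix.diagonal fun i => (d i : K)).mulVec v i =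
    ((Matrix.diagonal fun i => (d (σ i) : K)) * σ.permMatrix K).mulVec v i
  rw [← Matrix.mulVec_mulVec, ← Matrix.mulVec_mulVec, Matrix.permMatrix_mulVec,
    Matrix.permMatrix_mulVec, Function.comp_apply, Matrix.mulVec_diagonal, Matrix.mulVec_diagonal,
    Function.comp_apply]

/-- The pairing is invariant under permutations, which are conjugations in `GL_n(K)`. -/
theorem diagComm_comp (σ : Equiv.Perm (Fin n)) (d e : Fin n → (LaurentSeries 𝕜)ˣ) :
    diagComm 𝕜 n (d ∘ σ) (e ∘ σ) = diagComm 𝕜 n d e := by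
  obtain ⟨x, hx⟩ := glTildeProj_surjective (diagGL n d)
  obtain ⟨y, hy⟩ := glTildeProj_surjective (diagGL n e)
  obtain ⟨p, hp⟩ := glTildeProj_surjective (𝕜 := 𝕜) (n := n) (permGL σ)
  refine diagComm_eq (x := p * x * p⁻¹) (y := p * y * p⁻¹)
    (by rw [map_mul, map_mul, map_inv, hx, hp, permGL_conj])
    (by rw [map_mul, map_mul, map_inv, hy, hp, permGL_conj]) ?_
  rw [← conjugate_commutatorElement, commutator_eq_diagComm hx hy, ← glTildeIncl_comm,
    mul_inv_cancel_right]

theorem PosReal.eq_one_of_eq_inv {c : PosReal} (h : c = c⁻¹) : c = 1 := by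
  have h1 : (c : ℝ) = (c : ℝ)⁻¹ := congrArg Subtype.val h
  have h2 : (c : ℝ) * c = 1 := by
    nth_rw 2 [h1]
    exact mul_inv_cancel₀ c.2.ne'
  exact Subtype.ext (by nlinarith [c.2] : (c : ℝ) = 1)

/-- The commutator pairing of diagonal matrices with the entries `f` in the place `i` and `g` in the
place `j`. -/
noncomputable def entryComm (𝕜 : Type) [RCLike 𝕜] {n : ℕ} (i j : Fin n) :
    (LaurentSeries 𝕜)ˣ →* (LaurentSeries 𝕜)ˣ →* PosReal :=
  (MonoidHom.compHom' (MonoidHom.mulSingle (fun _ => (LaurentSeries 𝕜)ˣ) j)).comp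
    ((diagComm 𝕜 n).comp (MonoidHom.mulSingle (fun _ => (LaurentSeries 𝕜)ˣ) i))

theorem entryComm_apply (i j : Fin n) (f g : (LaurentSeries 𝕜)ˣ) : entryComm 𝕜 i j f g =
    diagComm 𝕜 n (Pi.mulSingle i f) (Pi.mulSingle j g) := rfl

theorem entryComm_swap (i j : Fin n) (f g : (LaurentSeries 𝕜)ˣ) :
    entryComm 𝕜 i j f g = (entryComm 𝕜 j i g f)⁻¹ := diagComm_swap _ _

/-- The transposition of the places `i` and `j` shows that the commutator for `f` in the place `i` and
`f` in the place `j` is symmetric in `i` and `j`; it is also antisymmetric, and `ℝ_+^*` has no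
`2`-torsion. -/
theorem entryComm_self (i j : Fin n) (f : (LaurentSeries 𝕜)ˣ) : entryComm 𝕜 i j f f = 1 := by
  refine PosReal.eq_one_of_eq_inv ?_
  have hs : ∀ i j : Fin n, (Pi.mulSingle i f : Fin n → (LaurentSeries 𝕜)ˣ) ∘ Equiv.swap i j =
      Pi.mulSingle j f := fun i j => funext fun k => by
    simp only [Function.comp_apply, Pi.mulSingle_apply, Equiv.swap_apply_eq_iff,
      Equiv.swap_apply_left]
  have h := diagComm_comp (Equiv.swap i j) (Pi.mulSingle i f) (Pi.mulSingle j f)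
  rw [hs, Equiv.swap_comm, hs] at h
  rw [entryComm_apply]
  exact h.symm.trans (diagComm_swap _ _)

end TorusCommutators

section TameSymbol

open MeasureTheory HaarTheory
open scoped commutatorElement

variable {𝕜 : Type} [RCLike 𝕜] {n : ℕ}

/-! ### Orders and leading coefficients -/

/-- The leading coefficient of a nonzero Laurent series. -/
noncomputable def leadUnit : (LaurentSeries 𝕜)ˣ →* 𝕜ˣ :=
  Units.map
    { toFun := fun f => f.leadingCoeff
      map_one' := HahnSeries.leadingCoeff_one
      map_mul' := fun f g => HahnSeries.leadingCoeff_mul f g }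

theorem leadUnit_val (f : (LaurentSeries 𝕜)ˣ) :
    (leadUnit f : 𝕜) = (f : LaurentSeries 𝕜).leadingCoeff := rfl

/-- The valuation of `K`. -/
noncomputable def ordHom : (LaurentSeries 𝕜)ˣ →* Multiplicative ℤ where
  toFun f := Multiplicative.ofAdd (f : LaurentSeries 𝕜).order
  map_one' := congrArg _ HahnSeries.order_one
  map_mul' f g := congrArg _ (HahnSeries.order_mul f.ne_zero g.ne_zero)

theorem order_eq_toAdd (f : (LaurentSeries 𝕜)ˣ) :
    (f : LaurentSeries 𝕜).order = (ordHom f).toAdd := rfl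

theorem order_tPow (k : ℤ) : (tPow 𝕜 k : LaurentSeries 𝕜).order = k :=
  HahnSeries.order_single one_ne_zero

theorem leadUnit_tPow (k : ℤ) : leadUnit (tPow 𝕜 k) = 1 :=
  Units.ext HahnSeries.leadingCoeff_of_single

theorem tPow_zero : tPow 𝕜 0 = 1 := Units.ext rfl

theorem leadUnit_of_order_eq_zero {u : (LaurentSeries 𝕜)ˣ} (hu : (u : LaurentSeries 𝕜).order = 0) :
    (leadUnit u : 𝕜) = (u : LaurentSeries 𝕜).coeff 0 := by
  rw [leadUnit_val, HahnSeries.leadingCoeff_eq, hu]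

theorem order_inv_eq_zero {u : (LaurentSeries 𝕜)ˣ} (hu : (u : LaurentSeries 𝕜).order = 0) :
    ((u⁻¹ : (LaurentSeries 𝕜)ˣ) : LaurentSeries 𝕜).order = 0 := by
  rw [order_eq_toAdd] at hu ⊢
  rw [map_inv, toAdd_inv, hu, neg_zero]

/-- Every `f ∈ K^*` is a power of `t` times a unit with the same leading coefficient. -/
theorem exists_eq_tPow_mul (f : (LaurentSeries 𝕜)ˣ) : ∃ u : (LaurentSeries 𝕜)ˣ,
    f = tPow 𝕜 1 ^ (f : LaurentSeries 𝕜).order * u ∧ (u : LaurentSeries 𝕜).order = 0 ∧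
      leadUnit u = leadUnit f := by
  refine ⟨(tPow 𝕜 1 ^ (f : LaurentSeries 𝕜).order)⁻¹ * f, by rw [mul_inv_cancel_left], ?_, ?_⟩
  · have h1 : (ordHom (tPow 𝕜 1)).toAdd = 1 := order_tPow 1
    rw [order_eq_toAdd, map_mul, map_inv, map_zpow, toAdd_mul, toAdd_inv, toAdd_zpow, h1,
      order_eq_toAdd]
    simp
  · rw [map_mul, map_inv, map_zpow, leadUnit_tPow, one_zpow, inv_one, one_mul]

/-- The residue of `f^ν(g) / g^ν(f)`, which has order `0`, is its leading coefficient. -/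
theorem unsignedTame_eq (f g : (LaurentSeries 𝕜)ˣ) : unsignedTame f g =
    ((leadUnit f ^ (g : LaurentSeries 𝕜).order / leadUnit g ^ (f : LaurentSeries 𝕜).order : 𝕜ˣ) :
      𝕜) := by
  have h : ((f ^ (g : LaurentSeries 𝕜).order / g ^ (f : LaurentSeries 𝕜).order :
      (LaurentSeries 𝕜)ˣ) : LaurentSeries 𝕜).order = 0 := by
    rw [order_eq_toAdd, map_div, map_zpow, map_zpow, toAdd_div, toAdd_zpow, toAdd_zpow,
      order_eq_toAdd, order_eq_toAdd, smul_eq_mul, smul_eq_mul, mul_comm, sub_self]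
  rw [← map_zpow, ← map_zpow, ← map_div, leadUnit_of_order_eq_zero h, unsignedTame,
    Units.val_div_eq_div_val, Units.val_zpow_eq_zpow_val, Units.val_zpow_eq_zpow_val]

/-! ### Commutators with units -/

theorem diagGL_mem_diagLattice {d : Fin n → (LaurentSeries 𝕜)ˣ}
    (hd : ∀ i, (d i : LaurentSeries 𝕜).order = 0) (w : Fin n → ℤ) :
    ∀ v ∈ (diagLattice (𝕜 := 𝕜) w).1, glLin (diagGL n d) v ∈ (diagLattice (𝕜 := 𝕜) w).1 := by
  intro v hv
  rw [mem_diagLattice] at hv ⊢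
  intro i m hm
  rw [glLin_diagGL]
  exact coeff_mul_of_lt _ _ 0 (w i) (coeff_eq_zero_of_lt (hd i).ge) (hv i) m (by omega)

theorem diagGL_smul_diagLattice {d : Fin n → (LaurentSeries 𝕜)ˣ}
    (hd : ∀ i, (d i : LaurentSeries 𝕜).order = 0) (w : Fin n → ℤ) :
    diagGL n d • diagLattice (𝕜 := 𝕜) w = diagLattice w := by
  refine OLattice.smul_eq_of_forall (diagGL_mem_diagLattice hd w) ?_
  rw [← map_inv]
  exact diagGL_mem_diagLattice (fun i => order_inv_eq_zero (hd i)) w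

theorem order_mulSingle {u : (LaurentSeries 𝕜)ˣ} (hu : (u : LaurentSeries 𝕜).order = 0)
    (i k : Fin n) : ((Pi.mulSingle i u : Fin n → (LaurentSeries 𝕜)ˣ) k : LaurentSeries 𝕜).order =
      0 := by
  rw [Pi.mulSingle_apply]
  split_ifs
  · exact hu
  · exact HahnSeries.order_one

theorem entryComm_unit_unit (i j : Fin n) {u v : (LaurentSeries 𝕜)ˣ}
    (hu : (u : LaurentSeries 𝕜).order = 0) (hv : (v : LaurentSeries 𝕜).order = 0) :
    entryComm 𝕜 i j u v = 1 :=
  diagComm_eq_one_of_stable (diagGL_smul_diagLattice (order_mulSingle hu i) 0)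
    (diagGL_smul_diagLattice (order_mulSingle hv j) 0)

theorem stdLattice_eq : stdLattice 𝕜 n = diagLattice 0 := by
  refine Subtype.ext (Submodule.ext fun v => ?_)
  rw [mem_diagLattice, mem_stdLattice]
  rfl

theorem HaarTheory.factor_self (τ τ' : HaarTheory 𝕜 n) (N : OLattice 𝕜 n) :
    (factor τ τ' N N le_rfl : ℝ) = 1 := by
  have h := factor_mul τ τ' (le_refl N) (le_refl N)
  have h1 := (factor_pos τ τ' N N le_rfl).ne'
  exact_mod_cast (mul_eq_left₀ h1).mp h.symm

/-- The commutator of a diagonal matrix which preserves `O^n` with one that sends `O^n` to a smaller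
lattice is the factor by which the first one changes the Haar measures on the quotient. -/
theorem diagComm_eq_factor {d e : Fin n → (LaurentSeries 𝕜)ˣ}
    (hd : diagGL n d • stdLattice 𝕜 n = stdLattice 𝕜 n)
    (he : diagGL n e • stdLattice 𝕜 n ≤ stdLattice 𝕜 n) (τ : HaarTheory 𝕜 n) :
    (diagComm 𝕜 n d e : ℝ) =
      factor τ ((diagGL n d)⁻¹ • τ) (diagGL n e • stdLattice 𝕜 n) (stdLattice 𝕜 n) he := by
  have hx : (⟨1, diagGL n d⟩ : (HaarTheory 𝕜 n → PosReal) ⋊[mulAutArrow]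
      Matrix.GeneralLinearGroup (Fin n) (LaurentSeries 𝕜)) ∈ GLTilde 𝕜 n := by
    rw [mem_GLTilde, hd]
    exact RelHaar.one_mem
  obtain ⟨r, hr⟩ := RelHaar.nonempty (stdLattice 𝕜 n) (diagGL n e • stdLattice 𝕜 n)
  have h := commutator_eq_diagComm (x := ⟨_, hx⟩)
    (y := (⟨⟨r, diagGL n e⟩, hr⟩ : GLTilde 𝕜 n)) rfl rfl
  generalize diagComm 𝕜 n d e = c at h ⊢
  rw [commutatorElement_def, mul_inv_eq_iff_eq_mul, mul_inv_eq_iff_eq_mul, mul_assoc] at h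
  have e1 := congrFun (congrArg (fun z : GLTilde 𝕜 n => z.1.left) h) τ
  change 1 * r ((diagGL n d)⁻¹ • τ) = c * (r ((1 : Matrix.GeneralLinearGroup _ _)⁻¹ • τ) * 1) at e1
  rw [one_mul, mul_one, inv_one, one_smul] at e1
  have e2 := hr τ ((diagGL n d)⁻¹ • τ) _ he le_rfl
  rw [factor_self, mul_one, e1] at e2
  change (c : ℝ) * r τ = r τ * _ at e2
  rw [mul_comm] at e2
  exact mul_left_cancel₀ (r τ).2.ne' e2

/-- A linear map which acts on `L / N` as the multiplication by `c`. -/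
theorem SubQuot.map_eq_smul {N L : Submodule 𝕜 (Fin n → LaurentSeries 𝕜)}
    (f : (Fin n → LaurentSeries 𝕜) →ₗ[𝕜] (Fin n → LaurentSeries 𝕜))
    (hN : ∀ x ∈ N, f x ∈ N) (hL : ∀ x ∈ L, f x ∈ L) (c : 𝕜) (h : ∀ x ∈ L, f x - c • x ∈ N) :
    SubQuot.map f hN hL = c • LinearMap.id := by
  refine LinearMap.ext fun x => ?_
  induction x using Submodule.Quotient.induction_on with
  | H x => exact (Submodule.Quotient.eq (N.submoduleOf L)).mpr (h x.1 x.2)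

theorem finrank_subQuot_single (j : Fin n) :
    Module.finrank 𝕜 (SubQuot (diagLattice (𝕜 := 𝕜) (Pi.single j 1)).1 (stdLattice 𝕜 n).1) = 1 := by
  let f : (stdLattice 𝕜 n).1 →ₗ[𝕜] 𝕜 :=
    { toFun := fun v => (v.1 j).coeff 0
      map_add' := fun _ _ => rfl
      map_smul' := fun _ _ => rfl }
  have hf : Function.Surjective f := fun c => by
    refine ⟨⟨Pi.single j (HahnSeries.single 0 c), mem_stdLattice.mpr fun i m hm => ?_⟩, ?_⟩
    · by_cases hi : i = j
      · subst hi
        rw [Pi.single_eq_same, HahnSeries.coeff_single_of_ne hm.ne]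
      · rw [Pi.single_eq_of_ne hi, HahnSeries.coeff_zero]
    · change ((Pi.single j (HahnSeries.single 0 c) : Fin n → LaurentSeries 𝕜) j).coeff 0 = c
      rw [Pi.single_eq_same, HahnSeries.coeff_single_same]
  have hk : (diagLattice (𝕜 := 𝕜) (Pi.single j 1)).1.submoduleOf (stdLattice 𝕜 n).1 =
      LinearMap.ker f := by
    ext v
    rw [LinearMap.mem_ker]
    change v.1 ∈ (diagLattice (𝕜 := 𝕜) (Pi.single j 1)).1 ↔ _
    rw [mem_diagLattice]
    constructor
    · intro h
      exact h j 0 (by simp)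
    · intro h i m hm
      have hv := mem_stdLattice.mp v.2 i
      by_cases hi : i = j
      · subst hi
        rw [Pi.single_eq_same] at hm
        rcases (Int.lt_add_one_iff.mp hm : m ≤ 0).lt_or_eq with h0 | h0
        · exact hv m h0
        · rw [h0]
          exact h
      · rw [Pi.single_eq_of_ne hi] at hm
        exact hv m hm
  exact ((Submodule.quotEquivOfEq _ _ hk).trans (f.quotKerEquivOfSurjective hf)).finrank_eq.trans
    (Module.finrank_self 𝕜)

/-- The modulus `|N(c)|` of the multiplication by `c`, where `N` is the norm of `𝕜` over `ℝ`. -/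
noncomputable def modulus (𝕜 : Type) [RCLike 𝕜] : 𝕜ˣ →* PosReal where
  toFun c := ⟨|Algebra.norm ℝ (c : 𝕜)|, abs_pos.mpr (Algebra.norm_ne_zero_iff.mpr c.ne_zero)⟩
  map_one' := Subtype.ext (by simp)
  map_mul' c d := Subtype.ext (by
    change |Algebra.norm ℝ ((c * d : 𝕜ˣ) : 𝕜)| = |_| * |_|
    rw [Units.val_mul, map_mul, abs_mul])

theorem mulSingle_tPow (j : Fin n) :
    (Pi.mulSingle j (tPow 𝕜 1) : Fin n → (LaurentSeries 𝕜)ˣ) =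
      fun i => tPow 𝕜 ((Pi.single j 1 : Fin n → ℤ) i) := by
  funext i
  by_cases hi : i = j
  · subst hi
    rw [Pi.mulSingle_eq_same, Pi.single_eq_same]
  · rw [Pi.mulSingle_eq_of_ne hi, Pi.single_eq_of_ne hi, tPow_zero]

/-- The matrix with the unit `u` in the place `i` acts on `O^n / (O ⊕ … ⊕ tO ⊕ … ⊕ O)`, with `tO` in the
place `j`, as the residue of `u` if `i = j`, and trivially otherwise. -/
theorem diagGL_mulSingle_sub_mem {u : (LaurentSeries 𝕜)ˣ} (hu : (u : LaurentSeries 𝕜).order = 0)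
    (i j : Fin n) : ∀ v ∈ (stdLattice 𝕜 n).1, glLin (diagGL n (Pi.mulSingle i u)) v -
      ((if i = j then leadUnit u else 1 : 𝕜ˣ) : 𝕜) • v ∈
        (diagLattice (𝕜 := 𝕜) (Pi.single j 1)).1 := by
  intro v hv
  rw [mem_stdLattice] at hv
  have hdv : glLin (diagGL n (Pi.mulSingle i u)) v ∈ (stdLattice 𝕜 n).1 := by
    rw [stdLattice_eq]
    exact diagGL_mem_diagLattice (order_mulSingle hu i) 0 v (by rwa [← stdLattice_eq])
  rw [mem_diagLattice]
  intro k m hm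
  by_cases hk : k = j
  · subst hk
    rw [Pi.sub_apply, glLin_diagGL, Pi.smul_apply]
    by_cases hi : i = k
    · subst hi
      rw [if_pos rfl, Pi.mulSingle_eq_same, ← HahnSeries.C_mul_eq_smul, ← sub_mul]
      refine coeff_mul_of_lt _ _ 1 0 (fun l hl => ?_) (hv i) m (by simpa using hm)
      rw [HahnSeries.coeff_sub, leadUnit_of_order_eq_zero hu]
      rcases (Int.lt_add_one_iff.mp hl : l ≤ 0).lt_or_eq with h0 | h0
      · rw [coeff_eq_zero_of_lt hu.ge l h0, HahnSeries.C_apply,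
          HahnSeries.coeff_single_of_ne h0.ne, sub_zero]
      · rw [h0, HahnSeries.C_apply, HahnSeries.coeff_single_same, sub_self]
    · rw [if_neg hi, Pi.mulSingle_eq_of_ne (Ne.symm hi), Units.val_one, Units.val_one, one_mul,
        one_smul, sub_self, HahnSeries.coeff_zero]
  · rw [Pi.single_eq_of_ne hk] at hm
    rw [Pi.sub_apply, Pi.smul_apply, HahnSeries.coeff_sub, HahnSeries.coeff_smul,
      mem_stdLattice.mp hdv k m hm, hv k m hm, smul_zero, sub_zero]

theorem diagLattice_single_le (j : Fin n) : diagLattice (𝕜 := 𝕜) (Pi.single j 1) ≤ stdLattice 𝕜 n := by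
  intro v hv
  refine mem_stdLattice.mpr fun i m hm => mem_diagLattice.mp hv i m ?_
  by_cases hi : i = j
  · subst hi
    rw [Pi.single_eq_same]
    omega
  · rwa [Pi.single_eq_of_ne hi]

/-- The commutator of the matrices with a unit `u` in the place `i` and with `t` in the place `j`. The
inverse of the first matrix acts on a line with determinant `u(0)⁻¹` or `1`, and this multiplies Haar
measures by the inverse of its modulus. -/
theorem entryComm_unit_tPow (i j : Fin n) {u : (LaurentSeries 𝕜)ˣ}
    (hu : (u : LaurentSeries 𝕜).order = 0) :
    entryComm 𝕜 i j u (tPow 𝕜 1) = modulus 𝕜 (if i = j then leadUnit u else 1) := by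
  obtain ⟨τ⟩ := nonempty_haarTheory 𝕜 n
  have hstd : diagGL n (Pi.mulSingle i u) • stdLattice 𝕜 n = stdLattice 𝕜 n := by
    rw [stdLattice_eq]
    exact diagGL_smul_diagLattice (order_mulSingle hu i) 0
  have hdiag := diagGL_smul_diagLattice (order_mulSingle hu i) (Pi.single j 1)
  have hle := diagLattice_single_le (𝕜 := 𝕜) j
  have hN : diagGL n (Pi.mulSingle j (tPow 𝕜 1)) • stdLattice 𝕜 n =
      diagLattice (Pi.single j 1) := by
    rw [mulSingle_tPow]
    rfl
  have h1 := diagComm_eq_factor hstd (hN ▸ hle) τ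
  simp only [hN] at h1
  have hu' := order_inv_eq_zero hu
  have hinv : (diagGL n (Pi.mulSingle i u))⁻¹ = diagGL n (Pi.mulSingle i u⁻¹) := by
    rw [← map_inv, Pi.mulSingle_inv]
  have hstd' : (diagGL n (Pi.mulSingle i u⁻¹)) • stdLattice 𝕜 n = stdLattice 𝕜 n := by
    rw [← hinv]
    exact inv_smul_eq_iff.mpr hstd.symm
  have hdiag' : (diagGL n (Pi.mulSingle i u⁻¹)) • diagLattice (𝕜 := 𝕜) (Pi.single j 1) =
      diagLattice (Pi.single j 1) := by
    rw [← hinv]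
    exact inv_smul_eq_iff.mpr hdiag.symm
  have hdet : LinearMap.det (SubQuot.map (glLin (diagGL n (Pi.mulSingle i u⁻¹))).toLinearMap
      (OLattice.glLin_mem_of_smul_eq hdiag') (OLattice.glLin_mem_of_smul_eq hstd')) =
      ((if i = j then leadUnit u⁻¹ else 1 : 𝕜ˣ) : 𝕜) := by
    rw [SubQuot.map_eq_smul _ _ _ _ (diagGL_mulSingle_sub_mem hu' i j), LinearMap.det_smul,
      finrank_subQuot_single, LinearMap.det_id, pow_one, mul_one]
  rw [hinv, factor_smul_of_stable _ τ hle _ _ hdiag' hstd' (by rw [hdet]; exact Units.ne_zero _),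
    hdet] at h1
  refine Subtype.ext (h1.trans ?_)
  have h2 : (if i = j then leadUnit u⁻¹ else 1 : 𝕜ˣ) = (if i = j then leadUnit u else 1)⁻¹ := by
    split_ifs
    · rw [map_inv]
    · rw [inv_one]
  have h3 : (modulus 𝕜 (if i = j then leadUnit u⁻¹ else 1))⁻¹ =
      modulus 𝕜 (if i = j then leadUnit u else 1) := by
    rw [h2, map_inv, inv_inv]
  exact congrArg Subtype.val h3

theorem entryComm_zpow_left (i j : Fin n) (f g : (LaurentSeries 𝕜)ˣ) (k : ℤ) :
    entryComm 𝕜 i j (f ^ k) g = entryComm 𝕜 i j f g ^ k :=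
  map_zpow ((entryComm 𝕜 i j).flip g) f k

/-- The commutator pairing of diagonal matrices in terms of orders and leading coefficients. -/
theorem entryComm_eq (i j : Fin n) (f g : (LaurentSeries 𝕜)ˣ) :
    entryComm 𝕜 i j f g = if i = j then modulus 𝕜 (leadUnit f ^ (g : LaurentSeries 𝕜).order /
      leadUnit g ^ (f : LaurentSeries 𝕜).order) else 1 := by
  obtain ⟨u, hf, hu, hu'⟩ := exists_eq_tPow_mul f
  obtain ⟨v, hg, hv, hv'⟩ := exists_eq_tPow_mul g
  have h : entryComm 𝕜 i j f g = (entryComm 𝕜 j i v (tPow 𝕜 1) ^ (f : LaurentSeries 𝕜).order)⁻¹ *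
      entryComm 𝕜 i j u (tPow 𝕜 1) ^ (g : LaurentSeries 𝕜).order := by
    generalize (f : LaurentSeries 𝕜).order = a at hf ⊢
    generalize (g : LaurentSeries 𝕜).order = b at hg ⊢
    rw [hf, hg, map_mul, map_mul, MonoidHom.mul_apply, MonoidHom.mul_apply,
      entryComm_unit_unit i j hu hv, mul_one, entryComm_zpow_left, entryComm_zpow_left, map_zpow,
      entryComm_self, one_zpow, one_zpow, one_mul, map_zpow, entryComm_swap i j _ v, inv_zpow,
      mul_comm]
  rw [h, entryComm_unit_tPow j i hv, entryComm_unit_tPow i j hu, hu', hv']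
  by_cases hij : i = j
  · subst hij
    rw [if_pos rfl, if_pos rfl, if_pos rfl, map_div, map_zpow, map_zpow, mul_comm, div_eq_mul_inv]
  · rw [if_neg hij, if_neg hij, if_neg (Ne.symm hij), map_one, one_zpow, one_zpow, inv_one, mul_one]

/-! ### The value at a Steinberg symbol -/

theorem isDiagInf_diagGL {K : Type*} [Field K] {n : ℕ} {d : Fin n → Kˣ} {e : ℕ → Kˣ}
    (h : ∀ i : Fin n, d i = e i) (h' : ∀ i, n ≤ i → e i = 1) : IsDiagInf (glInf n (diagGL n d)) e := by
  intro k c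
  change matInf n (diagGL n d).val (Finsupp.single k c) = _
  rw [matInf_apply, diagGL_val, Matrix.sub_mulVec, Matrix.one_mulVec]
  by_cases hk : k < n
  · obtain ⟨k, rfl⟩ : ∃ k' : Fin n, k = k' := ⟨⟨k, hk⟩, rfl⟩
    have e1 : finProj n (Finsupp.single (k : ℕ) c) = Pi.single k c := by
      rw [← finIncl_single, finProj_finIncl]
    have e2 : (Matrix.diagonal fun i => (d i : K)).mulVec (Pi.single k c) =
        Pi.single k (d k * c) := by
      ext i
      rw [Matrix.mulVec_diagonal]
      by_cases hi : i = k
      · subst hi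
        simp
      · simp [hi]
    rw [e1, e2, map_sub, finIncl_single, finIncl_single, add_sub_cancel, h]
  · have e1 : finProj n (Finsupp.single k c) = 0 := by
      ext i
      have : k ≠ i := fun e => hk (e ▸ i.2)
      simp [finProj, this]
    rw [e1, Matrix.mulVec_zero, sub_zero, map_zero, add_zero, h' k (not_lt.mp hk), Units.val_one,
      one_mul]

theorem IsDiagInf.unique {K : Type*} [Field K] {g h : GLInf K} {d : ℕ → Kˣ} (hg : IsDiagInf g d)
    (hh : IsDiagInf h d) : g = h :=
  GLInf.ext_single fun k c => (hg k c).trans (hh k c).symm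

/-- The image in the direct limit of the groups `GL_n(K)~` of a commutator of elements of `St(K)` over
diagonal matrices. -/
theorem stLift_commutator_eq {s s' : SteinbergGroup (LaurentSeries 𝕜)}
    {d e : Fin n → (LaurentSeries 𝕜)ˣ} (hs : stToGL _ s = glInf n (diagGL n d))
    (hs' : stToGL _ s' = glInf n (diagGL n e)) :
    stLift 𝕜 ⁅s, s'⁆ = toInf 𝕜 n (glTildeIncl 𝕜 n (diagComm 𝕜 n d e)) := by
  obtain ⟨x, hx, hxd⟩ := exists_toInf_eq_stLift hs
  obtain ⟨y, hy, hye⟩ := exists_toInf_eq_stLift hs'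
  rw [map_commutatorElement, ← hx, ← hy, ← map_commutatorElement, commutator_eq_diagComm hxd hye]

/-- `h_12(f)` and `h_13(g)` lie over `diag(f, f⁻¹, 1)` and `diag(g, 1, g⁻¹)`. Of the four terms of the
pairing of these matrices, only the one with both entries in the first place is nontrivial. -/
theorem kTwoToReal_steinbergSymbol (f g : (LaurentSeries 𝕜)ˣ) :
    (kTwoToReal 𝕜 (steinbergSymbol f g) : ℝ) = |Algebra.norm ℝ (unsignedTame f g)| := by
  have hs : stToGL _ (stH 0 1 (by decide) f) = glInf 3 (diagGL 3
      (Pi.mulSingle 0 f * Pi.mulSingle 1 f⁻¹)) :=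
    (isDiagInf_stH _ _ _ f).unique (isDiagInf_diagGL
      (fun i => by fin_cases i <;> simp) fun i hi => by
        rw [if_neg (by omega), if_neg (by omega)])
  have hs' : stToGL _ (stH 0 2 (by decide) g) = glInf 3 (diagGL 3
      (Pi.mulSingle 0 g * Pi.mulSingle 2 g⁻¹)) :=
    (isDiagInf_stH _ _ _ g).unique (isDiagInf_diagGL
      (fun i => by fin_cases i <;> simp) fun i hi => by
        rw [if_neg (by omega), if_neg (by omega)])
  have h : kTwoToReal 𝕜 (steinbergSymbol f g) = entryComm 𝕜 (0 : Fin 3) 0 f g := by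
    have h1 := (toInf_kTwoToReal (steinbergSymbol f g) 3).trans (stLift_commutator_eq hs hs')
    rw [glTildeIncl_injective (toInf_injective h1), map_mul, map_mul, MonoidHom.mul_apply,
      MonoidHom.mul_apply, ← entryComm_apply, ← entryComm_apply, ← entryComm_apply, ← entryComm_apply,
      entryComm_eq 0 2, entryComm_eq 1 0, entryComm_eq 1 2, if_neg (by decide),
      if_neg (by decide), if_neg (by decide), mul_one, mul_one, mul_one]
  rw [h, entryComm_eq, if_pos rfl, unsignedTame_eq]
  rfl

end TameSymbol

/-- For `K = ℝ((t))` and `K = ℂ((t))`, the extension `glHatRealProj` of `GL_2(K)` by `ℝ_+^*` is a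
central extension, and it is obtained from the central extension `glHatProj` of `GL_2(K)` by
`K_2(K)` by means of the homomorphism `K_2(K) → ℝ_+^*` with `(f, g) ↦ |residue(f^ν(g) / g^ν(f))|`
for `ℝ`, and with `(f, g) ↦ |residue(f^ν(g) / g^ν(f))|²` for `ℂ`. -/
theorem proposition4 :
    (IsCentralExtension (glHatIncl (LaurentSeries ℝ)) (glHatProj (LaurentSeries ℝ)) ∧
      IsCentralExtension (glHatRealIncl ℝ) (glHatRealProj ℝ) ∧
      ∃ φ : KTwo (LaurentSeries ℝ) →* PosReal,
        (∀ f g : (LaurentSeries ℝ)ˣ, (φ (steinbergSymbol f g) : ℝ) = |unsignedTame f g|) ∧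
        IsObtainedBy (glHatIncl (LaurentSeries ℝ)) (glHatProj (LaurentSeries ℝ)) φ
          (glHatRealIncl ℝ) (glHatRealProj ℝ)) ∧
    (IsCentralExtension (glHatIncl (LaurentSeries ℂ)) (glHatProj (LaurentSeries ℂ)) ∧
      IsCentralExtension (glHatRealIncl ℂ) (glHatRealProj ℂ) ∧
      ∃ φ : KTwo (LaurentSeries ℂ) →* PosReal,
        (∀ f g : (LaurentSeries ℂ)ˣ, (φ (steinbergSymbol f g) : ℝ) = ‖unsignedTame f g‖ ^ 2) ∧
        IsObtainedBy (glHatIncl (LaurentSeries ℂ)) (glHatProj (LaurentSeries ℂ)) φ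
          (glHatRealIncl ℂ) (glHatRealProj ℂ)) := by
  refine ⟨⟨isCentralExtension_glHat _, isCentralExtension_glHatReal ℝ, kTwoToReal ℝ, fun f g => ?_,
      isObtainedBy_kTwoToReal ℝ⟩,
    isCentralExtension_glHat _, isCentralExtension_glHatReal ℂ, kTwoToReal ℂ, fun f g => ?_,
      isObtainedBy_kTwoToReal ℂ⟩
  · rw [kTwoToReal_steinbergSymbol]
    rw [Algebra.norm_self, MonoidHom.id_apply]
  · rw [kTwoToReal_steinbergSymbol, Algebra.norm_complex_apply, Complex.normSq_eq_norm_sq,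
      abs_of_nonneg (sq_nonneg _)]
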